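/- Let $\Phi\subset\mathbb{R}^r$ be an irreducible simply-laced (ADE) root system with roots of length $\sqrt2$, with simple roots $\alpha_1,\dots,\alpha_r$, lowest root $\alpha_0=-\sum_{a=1}^r n_a\alpha_a$, $n_0=1$ and Coxeter number $h=\sum_{i=0}^r n_i$. Split the simple roots into black ($\bullet$) and white ($\circ$) ones, each set consisting of mutually orthogonal roots; let $w=\prod_{\alpha\in\bullet}w_\alpha\prod_{\beta\in\circ}w_\beta$ be the Coxeter element, $\lambda_a$ the fundamental weights, $(\lambda_a,\alpha_b)=\delta_{ab}$, and set $\gamma_a=(1-w^{-1})\lambda_a$, $\Gamma_a=\{w^{-p}\gamma_a:\ 0\le p\le h-1\}$. There is a projection of $\mathbb{R}^r$ onto the spin-1 eigenplane of $w$ (identified, up to scale, with $\mathbb{C}$) in which $w$ acts as the rotation by $2\pi/h$ and $\gamma_a$ has angle $0$ for $a\in\circ$ and $-\pi/h$ for $a\in\bullet$. For any such projection let $\frac{\pi}{h}u_\alpha$ be the angle of the projection of the root $\alpha$, and $u_{\alpha\beta}=u_\alpha-u_\beta$ (defined modulo $2h$). For a real coupling $g$ and particles $a,b\in\{1,\dots,r\}$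 put $$S_{ab}(\theta)=\prod_{\beta\in\Gamma_b}\{1+u_{\gamma_a\beta}\}_-^{(\lambda_a,\beta)},\qquad \{x\}_-=\frac{(x-1)_-(x+1)_-}{(x-1+B)_-(x+1-B)_-},$$ $$(x)_-=\frac1{\sinh\left(\frac\theta2-\frac{i\pi x}{2h}\right)},\qquad B=\frac{g^2}{2\pi}\,\frac1{1+g^2/4\pi},$$ $$S^{(0)}_{ab}(\theta)=-\frac{ig^2}{4h}\sum_{\beta\in\Gamma_b}(\gamma_a,\beta)\coth\Big(\frac\theta2-\frac{i\pi}{2h}u_{\gamma_a\beta}\Big),$$ $$\Sigma_{ab}(\theta)=\frac{\big(S^{(0)}_{ab}(\theta)\big)^2}{2}-\frac{g^2}{4\pi}S^{(0)}_{ab}(\theta)+\frac{g^4}{32h^2}\sum_{\beta\in\Gamma_b}\frac{((1+w^{-1})\lambda_a,\beta)}{\sinh^2\big(\frac\theta2-\frac{i\pi}{2h}u_{\gamma_a\beta}\big)}.$$ For real $\theta_{p'}<\theta_p$, with $\theta_{pq}=\theta_p-\theta_q$, let $\Gamma_2$ be the counterclockwise boundary of the infinitely wide rectangle of height $2\pi$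 whose lower side is the real line, indented by infinitesimal lower half-circles at $\theta_{p'}$ and $\theta_p$, and whose upper side is the translate of the lower side by $2\pi i$. Let $$I=\sum_{e=1}^r\oint_{\Gamma_2}d\theta_k\,\theta_k\,S^{(0)}_{ea}(\theta_{kp})\,S^{(0)}_{eb}(\theta_{kp'}),$$ $$S^{(1)}_{ab}(\theta_{pp'})=\frac{\big(S^{(0)}_{ab}(\theta_{pp'})\big)^2}{2}+\frac{g^2}{4\pi}\theta_{pp'}\frac{\partial}{\partial\theta_{pp'}}S^{(0)}_{ab}(\theta_{pp'})-\frac1{8\pi^2}\sum_{e=1}^r\frac{\partial}{\partial\theta_{pp'}}\oint_{\Gamma_2}d\theta_k\,\theta_k\,S^{(0)}_{ea}(\theta_{kp})\,S^{(0)}_{eb}(\theta_{kp'}).$$ Then, for all $a,b$: 1. For every $\theta\in\mathbb{C}\setminus\frac{i\pi}{h}\mathbb{Z}$, as $g\to0$, $S_{ab}(\theta)=1+S^{(0)}_{ab}(\theta)+\Sigma_{ab}(\theta)+O(g^6)$. 2. For every $g$ and all real $\theta_{p'}<\theta_p$, each contour integral converges, depends only on $\theta_{pp'}$ and is differentiable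 in $\theta_{pp'}$, as is $S^{(0)}_{ab}(\theta_{pp'})$, and $$I=2\pi g^2\,\theta_{pp'}S^{(0)}_{ab}(\theta_{pp'})+\frac{\pi^2g^4}{2h^2}\sum_{\beta\in\Gamma_b}((1+w^{-1})\lambda_a,\beta)\coth\Big(\frac{\theta_{pp'}}2-\frac{i\pi}{2h}u_{\gamma_a\beta}\Big),$$ $$S^{(1)}_{ab}(\theta_{pp'})=\Sigma_{ab}(\theta_{pp'}).$$ That is, the one-loop S-matrix obtained from perturbation theory is exactly the order-$g^4$ term of the bootstrap S-matrix. 3. For every $g$, $\Sigma_{ab}$ is holomorphic on $\mathbb{C}\setminus\frac{i\pi}{h}\mathbb{Z}$, and it is the only holomorphic function there that agrees with $S^{(1)}_{ab}(\theta_{pp'})$ for all real $\theta_{p'}<\theta_p$. -/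

import Mathlib

noncomputable section

namespace Toda

/-- The Euclidean space `ℝ^r` in which the roots live. -/
abbrev E (r : ℕ) : Type := EuclideanSpace ℝ (Fin r)

/-- A root system in the Euclidean space `ℝ^r` is simply laced with roots of length `√2` when the
Cartan integers `⟨α, β^∨⟩ = 2(α, β)/(β, β)` are the scalar products `(α, β)`. In particular
`(α, α) = 2` for all roots `α`, and the reflections of the root system are the orthogonal ones. -/
def IsSimplyLaced {r : ℕ} {ι N : Type*} [AddCommGroup N] [Module ℝ N]
    (P : RootPairing ι ℝ (E r) N) : Prop :=
  ∀ i j, P.pairing i j = inner ℝ (P.root i) (P.root j)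

/-- The Lie-algebraic data entering an affine Toda theory, for a root system `P` with a choice `b`
of simple roots `α_a` (indexed by `a : b.support`): the lowest root `α₀ = - ∑ n_a α_a`, the Kac
labels `n_a`, and a splitting of the simple roots into black and white ones, each of the two sets
consisting of mutually orthogonal roots. -/
structure Data {r : ℕ} {ι N : Type*} [AddCommGroup N] [Module ℝ N]
    (P : RootPairing ι ℝ (E r) N) (b : P.Base) where
  /-- the index of the lowest root `α₀` -/
  lowest : ι
  /-- the Kac labels `n_a`, `a = 1, …, r` (and `n_0 = 1`) -/
  label : b.support → ℕ
  root_lowest : P.root lowest = -∑ a, label a • P.root a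
  /-- every root is obtained from `α₀` by adding simple roots -/
  isLowest : ∀ i, P.root i - P.root lowest ∈ AddSubmonoid.closure (P.root '' b.support)
  /-- the black simple roots; the other ones are white -/
  black : Finset b.support
  black_orthogonal : ∀ a ∈ black, ∀ a' ∈ black, a ≠ a' → P.IsOrthogonal a a'
  white_orthogonal : ∀ a ∉ black, ∀ a' ∉ black, a ≠ a' → P.IsOrthogonal a a'

namespace Data

variable {r : ℕ} {ι N : Type*} [AddCommGroup N] [Module ℝ N]
  {P : RootPairing ι ℝ (E r) N} {b : P.Base} (T : Data P b)

/-- The Coxeter number `h = ∑_{i=0}^r n_i`, where `n_0 = 1`. -/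
def h : ℕ := 1 + ∑ a, T.label a

open Classical in
/-- The white simple roots. -/
def white : Finset b.support := T.blackᶜ

theorem commute_black :
    (T.black : Set b.support).Pairwise
      (Function.onFun Commute fun a : b.support => P.reflection a) :=
  fun a ha a' ha' hne =>
    RootPairing.isOrthogonal_comm P a a' (T.black_orthogonal a ha a' ha' hne)

theorem commute_white :
    (T.white : Set b.support).Pairwise
      (Function.onFun Commute fun a : b.support => P.reflection a) :=
  fun a ha a' ha' hne =>
    RootPairing.isOrthogonal_comm P a a'
      (T.white_orthogonal a (by simpa [white] using ha) a' (by simpa [white] using ha') hne)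

/-- The Coxeter element `w = ∏_{α ∈ •} w_α ∏_{β ∈ ∘} w_β` in the Steinberg ordering. -/
def w : E r ≃ₗ[ℝ] E r :=
  T.black.noncommProd (fun a => P.reflection a) T.commute_black *
    T.white.noncommProd (fun a => P.reflection a) T.commute_white

/-- The fundamental weight `λ_a`, i.e. the vector with `(λ_a, α_c) = δ_{ac}`
(see `inner_fundWeight`). -/
def fundWeight [P.IsRootSystem] (_T : Data P b) (a : b.support) : E r :=
  (InnerProductSpace.toDual ℝ (E r)).symm (LinearMap.toContinuousLinearMap (b.toWeightBasis.coord a))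

open Classical in
theorem inner_fundWeight [P.IsRootSystem] (a c : b.support) :
    inner ℝ (T.fundWeight a) (P.root c) = if a = c then (1 : ℝ) else 0 := by
  rw [fundWeight, InnerProductSpace.toDual_symm_apply]
  simp [Finsupp.single_apply, eq_comm]

variable [P.IsRootSystem]

/-- The orbit representative `γ_a = (1 - w⁻¹) λ_a`. -/
def gam (a : b.support) : E r := T.fundWeight a - T.w⁻¹ (T.fundWeight a)

open Classical in
/-- The Coxeter orbit `Γ_a = {w^{-p} γ_a : p = 0, …, h - 1}`. -/
def orbit (a : b.support) : Finset (E r) :=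
  (Finset.range T.h).image fun p => (T.w⁻¹ ^ p) (T.gam a)

/-- `π : ℝ^r → ℂ` is the projection onto the spin-1 eigenplane of the Coxeter element `w`, this
plane being identified (up to scale) with `ℂ` by an orthogonal frame in which `w` acts as the
rotation by the angle `2π/h`, and in which `γ_a` is projected to the angle `0` if `a` is white and
to the angle `-π/h` if `a` is black. (Such a `π` is the scalar product with an eigenvector of `w`
for the eigenvalue `e^{±2πi/h}`, so it vanishes on the orthogonal complement of the eigenplane.) -/
structure IsSpinOneProjection (π : E r →ₗ[ℝ] ℂ) : Prop where
  map_w : ∀ x, π (T.w x) = Complex.exp (2 * Real.pi * Complex.I / T.h) * π x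
  white_angle : ∀ a ∉ T.black, ∃ t : ℝ, 0 < t ∧ π (T.gam a) = t
  black_angle : ∀ a ∈ T.black, ∃ t : ℝ, 0 < t ∧
    π (T.gam a) = t * Complex.exp (-(Real.pi * Complex.I / T.h))

/-- The angle `u_α` of the projection of `α`, in units of `π/h`. It is determined up to multiples
of `2h`, and everything below is invariant under `u_α → u_α ± 2h`; the representative in `(-h, h]`
is used. -/
def u (π : E r →ₗ[ℝ] ℂ) (x : E r) : ℝ := T.h / Real.pi * Complex.arg (π x)

/-- The difference of angles `u_{αβ} = u_α - u_β`. -/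
def uDiff (π : E r →ₗ[ℝ] ℂ) (x y : E r) : ℝ := T.u π x - T.u π y

/-- The argument `θ/2 - iπx/(2h)`. -/
def halfArg (θ : ℂ) (x : ℝ) : ℂ := θ / 2 - Complex.I * Real.pi * x / (2 * T.h)

/-- The block `(x)_- = 1 / sinh(θ/2 - iπx/(2h))`. -/
def bracket (θ : ℂ) (x : ℝ) : ℂ := 1 / Complex.sinh (T.halfArg θ x)

/-- The block `{x}_- = (x-1)_- (x+1)_- / ((x-1+B)_- (x+1-B)_-)`. -/
def block (B : ℝ) (θ : ℂ) (x : ℝ) : ℂ :=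
  T.bracket θ (x - 1) * T.bracket θ (x + 1) /
    (T.bracket θ (x - 1 + B) * T.bracket θ (x + 1 - B))

end Data

/-- The function `B(g) = (g²/2π) / (1 + g²/4π)` of the coupling. -/
def B (g : ℝ) : ℝ := g ^ 2 / (2 * Real.pi) * (1 / (1 + g ^ 2 / (4 * Real.pi)))

/-- The hyperbolic cotangent. -/
def coth (z : ℂ) : ℂ := Complex.cosh z / Complex.sinh z

/-- The integral of `f` along the lower half-circle of radius `ε` around `c`, from `c - ε` to
`c + ε`. -/
def lowerHalfCircle (f : ℂ → ℂ) (c ε : ℝ) : ℂ :=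
  ∫ φ in Real.pi..(2 * Real.pi),
    f (c + ε * Complex.exp (φ * Complex.I)) * (ε * Complex.I * Complex.exp (φ * Complex.I))

/-- The integral of `f` along the line from `-R` to `R`, where the points `c₁ < c₂` are avoided by
lower half-circles of radius `ε`. -/
def indentedLine (f : ℂ → ℂ) (c₁ c₂ R ε : ℝ) : ℂ :=
  (∫ x in (-R)..(c₁ - ε), f x) + lowerHalfCircle f c₁ ε +
    (∫ x in (c₁ + ε)..(c₂ - ε), f x) + lowerHalfCircle f c₂ ε + ∫ x in (c₂ + ε)..R, f x

/-- The integral of `f` along the closed, counterclockwise contour that consists of the indented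
line above, the same line translated by `i n π` and traversed backwards, and the two vertical
sides at `± R`. -/
def indentedRectangle (n : ℕ) (f : ℂ → ℂ) (c₁ c₂ R ε : ℝ) : ℂ :=
  indentedLine f c₁ c₂ R ε
    + Complex.I * (∫ y in (0 : ℝ)..(n * Real.pi), f (R + y * Complex.I))
    - indentedLine (fun z => f (z + n * Real.pi * Complex.I)) c₁ c₂ R ε
    - Complex.I * (∫ y in (0 : ℝ)..(n * Real.pi), f (-R + y * Complex.I))

/-- The limit of infinite horizontal sides and infinitesimal half-circles. -/
def contourFilter : Filter (ℝ × ℝ) := Filter.atTop ×ˢ nhdsWithin 0 (Set.Ioi 0)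

/-- The contour integral `∮_{Γ_n} f` for the singular points `c₁ < c₂` on the real line. -/
def contourIntegral (n : ℕ) (f : ℂ → ℂ) (c₁ c₂ : ℝ) : ℂ :=
  Filter.limUnder contourFilter fun q : ℝ × ℝ => indentedRectangle n f c₁ c₂ q.1 q.2

namespace Data

variable {r : ℕ} {ι N : Type*} [AddCommGroup N] [Module ℝ N]
  {P : RootPairing ι ℝ (E r) N} {b : P.Base} (T : Data P b) [P.IsRootSystem]
  (π : E r →ₗ[ℝ] ℂ)

/-- The bootstrap S-matrix `S_{ac}(θ) = ∏_{β ∈ Γ_c} {1 + u_{γ_a β}}_-^{(λ_a, β)}` at coupling `g`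
(the exponents are integers). -/
def bootstrapS (g : ℝ) (a c : b.support) (θ : ℂ) : ℂ :=
  ∏ β ∈ T.orbit c,
    T.block (B g) θ (1 + T.uDiff π (T.gam a) β) ^ ((inner ℝ (T.fundWeight a) β : ℝ) : ℂ)

/-- The tree-level S-matrix
`S⁽⁰⁾_{ac}(θ) = -(i g²/4h) ∑_{β ∈ Γ_c} (γ_a, β) coth(θ/2 - iπ u_{γ_a β}/(2h))`. -/
def treeS (g : ℝ) (a c : b.support) (θ : ℂ) : ℂ :=
  -(Complex.I * g ^ 2 / (4 * T.h)) *
    ∑ β ∈ T.orbit c, ((inner ℝ (T.gam a) β : ℝ) : ℂ) *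
      coth (T.halfArg θ (T.uDiff π (T.gam a) β))

/-- `((1 + w⁻¹) λ_a, x)`. -/
def plusPairing (a : b.support) (x : E r) : ℝ :=
  inner ℝ (T.fundWeight a + T.w⁻¹ (T.fundWeight a)) x

/-- The order-`g⁴` term
`(S⁽⁰⁾_{ac})²/2 - (g²/4π) S⁽⁰⁾_{ac} + (g⁴/32h²) ∑_{β ∈ Γ_c} ((1+w⁻¹)λ_a, β) / sinh²(θ/2 - iπu_{γ_a β}/(2h))`
of the bootstrap S-matrix. -/
def bootstrapS₁ (g : ℝ) (a c : b.support) (θ : ℂ) : ℂ :=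
  T.treeS π g a c θ ^ 2 / 2 - g ^ 2 / (4 * Real.pi) * T.treeS π g a c θ +
    g ^ 4 / (32 * T.h ^ 2) * ∑ β ∈ T.orbit c,
      (T.plusPairing a β : ℂ) / Complex.sinh (T.halfArg θ (T.uDiff π (T.gam a) β)) ^ 2

/-- The integrand `θ_k S⁽⁰⁾_{ea}(θ_k - θ_p) S⁽⁰⁾_{ec}(θ_k - θ_{p'})`. -/
def integrand (g : ℝ) (e a c : b.support) (θp θp' : ℝ) (θk : ℂ) : ℂ :=
  θk * T.treeS π g e a (θk - θp) * T.treeS π g e c (θk - θp')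

/-- `∮_{Γ_2} dθ_k θ_k S⁽⁰⁾_{ea}(θ_{kp}) S⁽⁰⁾_{ec}(θ_{kp'})`, for real rapidities `θ_p > θ_{p'}`. -/
def loopIntegral (g : ℝ) (e a c : b.support) (θp θp' : ℝ) : ℂ :=
  contourIntegral 2 (T.integrand π g e a c θp θp') θp' θp

/-- The perturbative one-loop S-matrix, computed from the tree-level one:
`S⁽¹⁾_{ac}(θ_{pp'}) = S⁽⁰⁾_{ac}²/2 + (g²/4π) θ_{pp'} ∂S⁽⁰⁾_{ac}/∂θ_{pp'}
  - (1/8π²) ∑_e ∂/∂θ_{pp'} ∮_{Γ_2} dθ_k θ_k S⁽⁰⁾_{ea}(θ_{kp}) S⁽⁰⁾_{ec}(θ_{kp'})`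
with `θ_{pp'} = θ_p - θ_{p'}`; the derivative is taken at fixed `θ_{p'}`. -/
def loopS₁ (g : ℝ) (a c : b.support) (θp θp' : ℝ) : ℂ :=
  T.treeS π g a c ((θp - θp' : ℝ) : ℂ) ^ 2 / 2
    + g ^ 2 / (4 * Real.pi) * ((θp - θp' : ℝ) : ℂ) *
        deriv (fun t : ℝ => T.treeS π g a c (t : ℂ)) (θp - θp')
    - 1 / (8 * Real.pi ^ 2) *
        ∑ e, deriv (fun t : ℝ => T.loopIntegral π g e a c (θp' + t) θp') (θp - θp')

/-- The rapidities `θ ∈ ℂ` away from the points `iπk/h`, `k ∈ ℤ`, at which the S-matrices may have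
poles. -/
def regular : Set ℂ := {θ | ∀ k : ℤ, θ ≠ Complex.I * Real.pi * k / T.h}

end Data

end Toda

end

/-! Geometry. The Coxeter element is a product of two involutions, `blackRefl` and `whiteRefl`. A
positive eigenvector of the Cartan matrix (`exists_perron`) defines a linear map to `ℂ` under which
these become reflections in two lines, and `w` the rotation by `2φ`. Every root is a combination of
simple roots with coefficients of one sign, so no root projects into a certain open cone of opening
`φ` (`not_hasAngle_of_mem_Ioo`). Rotating by `w`, one finds that all roots project to multiples of
`φ` and that `mφ = π` for some `m`. The roots at the angle `tφ` satisfy `∑ (α, v) α = v - w ^ t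
(whiteRefl v)` (`angleSum_eq`). Comparing `t = 0` with `t = m` gives `w ^ m = 1`; summing over `t <
2m` gives `∑ (α, v) α = 2m v` over all roots, whereas `∑ (α, α₀)² = 4h` (`sum_inner_lowest_sq`).
Hence `m = h`, without any classification.

Loop integral. The integrand is `z G(z)` with `G` of period `2πi`, so the two horizontal sides
combine to `-2πi ∫ G` along the indented line. The vertical sides disappear because each orbit sums
to zero, which makes the tree amplitude decay exponentially. The addition formula `coth_mul_coth`
reduces `G` to single `coth`'s, each with the primitive `2 log (i sinh)` below its pole. A pair of
roots then contributes a `coth` times `θ_{pp'} + (iπ/h) (j - j')`, where `j`, `j'` are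
representatives in `[0, 2h)` of two angles. The sum over particles is done by a completeness
relation weighted by the angle (`sum_weight_inner_mul`). Since `∑ j w^j` inverts `w - 1` up to the
factor `2h`, the representatives turn `γ_a` into `λ_a` and `w⁻¹ λ_a`, which add up to `(1 + w⁻¹)
λ_a` (`sum_val_sub_val`, `sum_loopValue`). In `S⁽¹⁾` the terms with `θ ∂S⁽⁰⁾` cancel, and `Σ`
remains (`loopS₁_eq`).

Bootstrap. Each block is expanded logarithmically to second order in `B`. Its two shifts belong to
`β` and `w⁻¹ β`, so reindexing the orbit replaces `λ_a` by `λ_a - w⁻¹ λ_a` at first and by `λ_a +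
w⁻¹ λ_a` at second order (`prod_block_isBigO`). Uniqueness of the continuation is the identity
theorem on the connected set `regular`. -/

noncomputable section

set_option linter.unusedSectionVars false

namespace Toda

namespace Data

/-! ### The Coxeter element as a product of two involutions -/

section Basics

variable {r : ℕ} {ι N : Type*} [AddCommGroup N] [Module ℝ N]
  {P : RootPairing ι ℝ (E r) N} {b : P.Base} (T : Data P b)

/-- Both functionals agree on the roots because the system is simply laced, and the roots span. -/
theorem coroot'_eq_inner [P.IsRootSystem] (hP : IsSimplyLaced P) (i : ι) (v : E r) :
    P.coroot' i v = inner ℝ (P.root i) v := by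
  have hv : v ∈ Submodule.span ℝ (Set.range P.root) := by
    rw [RootPairing.IsRootSystem.span_root_eq_top]; trivial
  induction hv using Submodule.span_induction with
  | mem x hx =>
    obtain ⟨j, rfl⟩ := hx
    rw [P.root_coroot'_eq_pairing, hP, real_inner_comm]
  | zero => simp
  | add x y _ _ hx hy => rw [map_add, hx, hy, inner_add_right]
  | smul t x _ hx => rw [map_smul, hx, inner_smul_right, smul_eq_mul]

theorem reflection_eq [P.IsRootSystem] (hP : IsSimplyLaced P) (i : ι) (v : E r) :
    P.reflection i v = v - inner ℝ (P.root i) v • P.root i := by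
  rw [P.reflection_apply, coroot'_eq_inner hP]

theorem inner_root_self (hP : IsSimplyLaced P) (i : ι) :
    inner ℝ (P.root i) (P.root i) = (2 : ℝ) := by
  rw [← hP, P.pairing_same]

/-- The roots being mutually orthogonal, each reflection leaves the corrections made by the others
unchanged. -/
theorem noncommProd_reflection_apply [P.IsRootSystem] (hP : IsSimplyLaced P)
    (s : Finset b.support)
    (hs : (s : Set b.support).Pairwise
      (Function.onFun Commute fun a : b.support => P.reflection a))
    (horth : ∀ a ∈ s, ∀ a' ∈ s, a ≠ a' → inner ℝ (P.root a) (P.root a') = (0 : ℝ)) (v : E r) :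
    s.noncommProd (fun a : b.support => P.reflection a) hs v =
      v - ∑ a ∈ s, inner ℝ (P.root a) v • P.root a := by
  classical
  induction s using Finset.induction_on with
  | empty => simp
  | insert a s ha ih =>
    rw [Finset.noncommProd_insert_of_notMem _ _ _ _ ha, LinearEquiv.mul_apply,
      ih _ (fun x hx y hy => horth x (Finset.mem_insert_of_mem hx) y (Finset.mem_insert_of_mem hy)),
      reflection_eq hP, Finset.sum_insert ha, inner_sub_right, inner_sum]
    rw [Finset.sum_eq_zero (s := s) (f := fun i => inner ℝ (P.root a)
      (inner ℝ (P.root i) v • P.root i))]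
    · rw [sub_zero]; abel
    · intro x hx
      rw [inner_smul_right, horth a (Finset.mem_insert_self _ _) x (Finset.mem_insert_of_mem hx)
        (by rintro rfl; exact ha hx), mul_zero]

/-- The product of the reflections in the white simple roots. -/
def whiteRefl : E r ≃ₗ[ℝ] E r :=
  T.white.noncommProd (fun a => P.reflection a) T.commute_white

/-- The product of the reflections in the black simple roots. -/
def blackRefl : E r ≃ₗ[ℝ] E r :=
  T.black.noncommProd (fun a => P.reflection a) T.commute_black

theorem mem_white {a : b.support} : a ∈ T.white ↔ a ∉ T.black := by simp [white]

theorem inner_white (hP : IsSimplyLaced P) {a c : b.support} (ha : a ∈ T.white)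
    (hc : c ∈ T.white) (hne : a ≠ c) : inner ℝ (P.root a) (P.root c) = (0 : ℝ) := by
  rw [← hP]
  exact (T.white_orthogonal a (T.mem_white.1 ha) c (T.mem_white.1 hc) hne).1

theorem inner_black (hP : IsSimplyLaced P) {a c : b.support} (ha : a ∈ T.black)
    (hc : c ∈ T.black) (hne : a ≠ c) : inner ℝ (P.root a) (P.root c) = (0 : ℝ) := by
  rw [← hP]
  exact (T.black_orthogonal a ha c hc hne).1

variable [P.IsRootSystem]

theorem whiteRefl_apply (hP : IsSimplyLaced P) (v : E r) :
    T.whiteRefl v = v - ∑ a ∈ T.white, inner ℝ (P.root a) v • P.root a :=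
  noncommProd_reflection_apply hP _ _ (fun _ ha _ hc => T.inner_white hP ha hc) v

theorem blackRefl_apply (hP : IsSimplyLaced P) (v : E r) :
    T.blackRefl v = v - ∑ a ∈ T.black, inner ℝ (P.root a) v • P.root a :=
  noncommProd_reflection_apply hP _ _ (fun _ ha _ hc => T.inner_black hP ha hc) v

theorem inner_sum_white (hP : IsSimplyLaced P) {a : b.support} (ha : a ∈ T.white)
    (f : b.support → ℝ) :
    inner ℝ (P.root a) (∑ c ∈ T.white, f c • P.root c) = 2 * f a := by
  rw [inner_sum, Finset.sum_eq_single_of_mem a ha, inner_smul_right, inner_root_self hP, mul_comm]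
  intro c hc hne
  rw [inner_smul_right, T.inner_white hP ha hc hne.symm, mul_zero]

theorem inner_sum_black (hP : IsSimplyLaced P) {a : b.support} (ha : a ∈ T.black)
    (f : b.support → ℝ) :
    inner ℝ (P.root a) (∑ c ∈ T.black, f c • P.root c) = 2 * f a := by
  rw [inner_sum, Finset.sum_eq_single_of_mem a ha, inner_smul_right, inner_root_self hP, mul_comm]
  intro c hc hne
  rw [inner_smul_right, T.inner_black hP ha hc hne.symm, mul_zero]

theorem whiteRefl_root (hP : IsSimplyLaced P) {a : b.support} (ha : a ∈ T.white) :
    T.whiteRefl (P.root a) = -P.root a := by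
  rw [T.whiteRefl_apply hP, Finset.sum_eq_single_of_mem a ha, inner_root_self hP, two_smul]
  · abel
  · intro c hc hne
    rw [T.inner_white hP hc ha hne, zero_smul]

theorem blackRefl_root (hP : IsSimplyLaced P) {a : b.support} (ha : a ∈ T.black) :
    T.blackRefl (P.root a) = -P.root a := by
  rw [T.blackRefl_apply hP, Finset.sum_eq_single_of_mem a ha, inner_root_self hP, two_smul]
  · abel
  · intro c hc hne
    rw [T.inner_black hP hc ha hne, zero_smul]

theorem whiteRefl_whiteRefl (hP : IsSimplyLaced P) (v : E r) :
    T.whiteRefl (T.whiteRefl v) = v := by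
  conv_lhs => rw [T.whiteRefl_apply hP v, map_sub, map_sum, T.whiteRefl_apply hP v]
  have h : ∀ a ∈ T.white, T.whiteRefl (inner ℝ (P.root a) v • P.root a) =
      -(inner ℝ (P.root a) v • P.root a) := fun a ha => by
    rw [map_smul, T.whiteRefl_root hP ha, smul_neg]
  rw [Finset.sum_congr rfl h, Finset.sum_neg_distrib]; abel

theorem blackRefl_blackRefl (hP : IsSimplyLaced P) (v : E r) :
    T.blackRefl (T.blackRefl v) = v := by
  conv_lhs => rw [T.blackRefl_apply hP v, map_sub, map_sum, T.blackRefl_apply hP v]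
  have h : ∀ a ∈ T.black, T.blackRefl (inner ℝ (P.root a) v • P.root a) =
      -(inner ℝ (P.root a) v • P.root a) := fun a ha => by
    rw [map_smul, T.blackRefl_root hP ha, smul_neg]
  rw [Finset.sum_congr rfl h, Finset.sum_neg_distrib]; abel

theorem inner_whiteRefl (hP : IsSimplyLaced P) (x y : E r) :
    inner ℝ (T.whiteRefl x) y = (inner ℝ x (T.whiteRefl y) : ℝ) := by
  rw [T.whiteRefl_apply hP, T.whiteRefl_apply hP, inner_sub_left, inner_sub_right, sum_inner,
    inner_sum]
  congr 1
  refine Finset.sum_congr rfl fun a _ => ?_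
  rw [inner_smul_left, inner_smul_right, real_inner_comm x (P.root a)]
  simp [mul_comm]

theorem inner_blackRefl (hP : IsSimplyLaced P) (x y : E r) :
    inner ℝ (T.blackRefl x) y = (inner ℝ x (T.blackRefl y) : ℝ) := by
  rw [T.blackRefl_apply hP, T.blackRefl_apply hP, inner_sub_left, inner_sub_right, sum_inner,
    inner_sum]
  congr 1
  refine Finset.sum_congr rfl fun a _ => ?_
  rw [inner_smul_left, inner_smul_right, real_inner_comm x (P.root a)]
  simp [mul_comm]

theorem w_apply (v : E r) : T.w v = T.blackRefl (T.whiteRefl v) := rfl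

theorem w_inv_apply (hP : IsSimplyLaced P) (v : E r) :
    T.w⁻¹ v = T.whiteRefl (T.blackRefl v) := by
  have h : T.w (T.whiteRefl (T.blackRefl v)) = v := by
    rw [w_apply, T.whiteRefl_whiteRefl hP, T.blackRefl_blackRefl hP]
  conv_lhs => rw [← h]
  exact T.w.symm_apply_apply _

theorem w_w_inv (v : E r) : T.w (T.w⁻¹ v) = v := T.w.apply_symm_apply v

theorem w_inv_w (v : E r) : T.w⁻¹ (T.w v) = v := T.w.symm_apply_apply v

theorem inner_w (hP : IsSimplyLaced P) (x y : E r) :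
    inner ℝ (T.w x) y = (inner ℝ x (T.w⁻¹ y) : ℝ) := by
  rw [w_apply, T.inner_blackRefl hP, T.inner_whiteRefl hP, T.w_inv_apply hP]

theorem inner_w_w (hP : IsSimplyLaced P) (x y : E r) :
    inner ℝ (T.w x) (T.w y) = (inner ℝ x y : ℝ) := by
  rw [T.inner_w hP, w_inv_w]

/-- The dihedral relation: conjugation by the white involution inverts `w`. -/
theorem whiteRefl_w (hP : IsSimplyLaced P) (v : E r) :
    T.whiteRefl (T.w v) = T.w⁻¹ (T.whiteRefl v) := by
  rw [T.w_inv_apply hP, w_apply]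

theorem eq_zero_of_inner_simple_eq_zero {v : E r}
    (hv : ∀ a : b.support, inner ℝ (P.root a) v = (0 : ℝ)) : v = 0 := by
  have h : ∀ y : E r, inner ℝ y v = (0 : ℝ) := by
    intro y
    rw [← b.toWeightBasis.sum_repr y, sum_inner]
    refine Finset.sum_eq_zero fun a _ => ?_
    rw [inner_smul_left, RootPairing.Base.toWeightBasis_apply, hv, mul_zero]
  exact inner_self_eq_zero.1 (h v)

/-- A fixed vector has the same image under both involutions, so its white and black corrections
coincide. Independence of the simple roots kills all of them, and `v` is orthogonal to a basis. -/
theorem eq_zero_of_w_eq (hP : IsSimplyLaced P) {v : E r} (hv : T.w v = v) : v = 0 := by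
  classical
  have h1 : T.whiteRefl v = T.blackRefl v := by
    conv_rhs => rw [← hv, w_apply, T.blackRefl_blackRefl hP]
  rw [T.whiteRefl_apply hP, T.blackRefl_apply hP, sub_right_inj] at h1
  have hli := (Fintype.linearIndependent_iff (R := ℝ)).1 b.toWeightBasis.linearIndependent
    (fun a => if a ∈ T.black then inner ℝ (P.root a) v else -inner ℝ (P.root a) v) (by
      simp only [RootPairing.Base.toWeightBasis_apply, ite_smul]
      rw [Finset.sum_ite]
      have e1 : Finset.univ.filter (fun a => a ∈ T.black) = T.black := by ext; simp
      have e2 : Finset.univ.filter (fun a => a ∉ T.black) = T.white := by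
        ext; simp [mem_white]
      rw [e1, e2, ← h1]
      simp)
  refine eq_zero_of_inner_simple_eq_zero (b := b) fun a => ?_
  have := hli a
  by_cases ha : a ∈ T.black
  · simpa [ha] using this
  · simpa [ha] using this

open Classical in
theorem sum_smul_fundWeight (s : Finset b.support) (a : b.support) :
    ∑ c ∈ s, inner ℝ (P.root c) (T.fundWeight a) • P.root c = if a ∈ s then P.root a else 0 := by
  have h : ∀ c : b.support, (inner ℝ (P.root c) (T.fundWeight a) : ℝ) = if a = c then 1 else 0 := by
    intro c; rw [real_inner_comm]; convert T.inner_fundWeight a c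
  simp [h]

/-- The black involution fixes `λ_a`, and the white one then subtracts `α_a`. -/
theorem gam_white (hP : IsSimplyLaced P) {a : b.support} (ha : a ∈ T.white) :
    T.gam a = P.root a := by
  classical
  have ha' : a ∉ T.black := T.mem_white.1 ha
  rw [gam, T.w_inv_apply hP, T.blackRefl_apply hP, sum_smul_fundWeight, if_neg ha', sub_zero,
    T.whiteRefl_apply hP, sum_smul_fundWeight, if_pos ha]
  abel

/-- The black involution subtracts `α_a` from `λ_a`; the white one fixes `λ_a` and acts on `α_a`. -/
theorem gam_black (hP : IsSimplyLaced P) {a : b.support} (ha : a ∈ T.black) :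
    T.gam a = T.whiteRefl (P.root a) := by
  classical
  have ha' : a ∉ T.white := fun h => T.mem_white.1 h ha
  rw [gam, T.w_inv_apply hP, T.blackRefl_apply hP, sum_smul_fundWeight, if_pos ha, map_sub,
    T.whiteRefl_apply hP (T.fundWeight a), sum_smul_fundWeight, if_neg ha']
  abel

end Basics

end Data

namespace Data

/-! ### A positive eigenvector of the Cartan matrix -/

section Perron

variable {r : ℕ} {ι N : Type*} [AddCommGroup N] [Module ℝ N]
  {P : RootPairing ι ℝ (E r) N} {b : P.Base} (T : Data P b)

/-- The linear combinations of the simple roots, as a function of the coefficients. -/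
def simpleComb (b : P.Base) : EuclideanSpace ℝ b.support →L[ℝ] E r :=
  LinearMap.toContinuousLinearMap
    { toFun := fun x => ∑ c : b.support, x c • P.root c
      map_add' := fun x y => by simp [add_smul, Finset.sum_add_distrib]
      map_smul' := fun t x => by simp [mul_smul, Finset.smul_sum] }

theorem simpleComb_apply (x : EuclideanSpace ℝ b.support) :
    simpleComb b x = ∑ c : b.support, x c • P.root c := rfl

variable [P.IsRootSystem]

theorem simpleComb_eq_zero {x : EuclideanSpace ℝ b.support} (hx : simpleComb b x = 0) : x = 0 := by
  ext c
  refine (Fintype.linearIndependent_iff (R := ℝ)).1 b.toWeightBasis.linearIndependent x.ofLp ?_ c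
  simpa [simpleComb_apply] using hx

variable [Finite ι] [P.IsCrystallographic]

theorem inner_simple_nonpos (hP : IsSimplyLaced P) {a c : b.support} (hne : a ≠ c) :
    (inner ℝ (P.root a) (P.root c) : ℝ) ≤ 0 := by
  rw [← hP, ← P.algebraMap_pairingIn ℤ]
  have := b.pairingIn_le_zero_of_ne (i := a) (j := c) (fun h => hne (Subtype.ext h)) a.2 c.2
  simpa using this

theorem norm_simpleComb_sq (x : EuclideanSpace ℝ b.support) :
    ‖simpleComb b x‖ ^ 2 =
      ∑ a : b.support, ∑ c : b.support, x a * x c * inner ℝ (P.root a) (P.root c) := by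
  rw [← real_inner_self_eq_norm_sq, simpleComb_apply, sum_inner]
  refine Finset.sum_congr rfl fun a _ => ?_
  rw [inner_sum]
  refine Finset.sum_congr rfl fun c _ => ?_
  rw [inner_smul_left, inner_smul_right]
  simp [mul_assoc]

/-- Distinct simple roots have nonpositive products, so passing to absolute values keeps the
diagonal terms and can only lower the others. -/
theorem norm_simpleComb_abs_le (hP : IsSimplyLaced P) (x : EuclideanSpace ℝ b.support) :
    ‖simpleComb b (WithLp.toLp 2 fun c => |x c|)‖ ^ 2 ≤ ‖simpleComb b x‖ ^ 2 := by
  rw [norm_simpleComb_sq, norm_simpleComb_sq]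
  refine Finset.sum_le_sum fun a _ => Finset.sum_le_sum fun c _ => ?_
  simp only
  rcases eq_or_ne a c with rfl | hne
  · rw [abs_mul_abs_self]
  · rw [← abs_mul]
    exact mul_le_mul_of_nonpos_right (le_abs_self _) (inner_simple_nonpos hP hne)

/-- A Perron–Frobenius eigenvector of the Cartan matrix. -/
theorem exists_perron [P.IsReduced] [P.IsIrreducible] (hP : IsSimplyLaced P) :
    ∃ (x : b.support → ℝ) (μ : ℝ), (∀ a, 0 < x a) ∧ 0 ≤ μ ∧ μ < 2 ∧
      ∀ a : b.support, inner ℝ (P.root a) (∑ c : b.support, x c • P.root c) = (2 - μ) * x a := by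
  classical
  have hnt : Nontrivial (E r) := RootPairing.IsIrreducible.nontrivial P
  have hne : Nonempty b.support := by
    by_contra hemp
    rw [not_nonempty_iff] at hemp
    have : Subsingleton (E r) := b.toWeightBasis.repr.toEquiv.subsingleton
    exact not_subsingleton (E r) this
  obtain ⟨a₀⟩ := hne
  -- The quadratic form of `S` is `‖∑ x c α_c‖²`; a minimiser on the unit sphere will be an
  -- eigenvector.
  let S : EuclideanSpace ℝ b.support →L[ℝ] EuclideanSpace ℝ b.support :=
    (ContinuousLinearMap.adjoint (simpleComb b)) ∘L simpleComb b
  have hS : IsSelfAdjoint S := ContinuousLinearMap.IsPositive.isSelfAdjoint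
    (ContinuousLinearMap.isPositive_adjoint_comp_self _)
  have hSq : ∀ x, S.reApplyInnerSelf x = ‖simpleComb b x‖ ^ 2 := fun x => by
    rw [ContinuousLinearMap.reApplyInnerSelf_apply, ContinuousLinearMap.comp_apply,
      ContinuousLinearMap.adjoint_inner_left, real_inner_self_eq_norm_sq]; rfl
  obtain ⟨x₀, hx₀, hmin⟩ := (isCompact_sphere (0 : EuclideanSpace ℝ b.support) 1).exists_isMinOn
    ⟨EuclideanSpace.single a₀ 1, by simp⟩ S.reApplyInnerSelf_continuous.continuousOn
  -- Taking absolute values preserves the norm and does not raise the form, so the result is again a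
  -- minimiser.
  set x : EuclideanSpace ℝ b.support := WithLp.toLp 2 fun c => |x₀ c| with hx
  have hxn : ‖x‖ = 1 := by
    have : ‖x₀‖ = 1 := by simpa using hx₀
    rw [← this, EuclideanSpace.norm_eq, EuclideanSpace.norm_eq]; simp [hx]
  have hxmin : IsMinOn S.reApplyInnerSelf (Metric.sphere 0 ‖x‖) x := by
    rw [hxn]
    intro y hy
    have h3 : S.reApplyInnerSelf x₀ ≤ S.reApplyInnerSelf y := hmin hy
    refine le_trans ?_ h3
    rw [hSq, hSq]
    exact norm_simpleComb_abs_le hP x₀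
  have heig := hS.eq_smul_self_of_isLocalExtrOn (Or.inl hxmin.localize)
  set l : ℝ := S.rayleighQuotient x with hl
  have hcoord : ∀ a : b.support, inner ℝ (P.root a) (∑ c : b.support, x c • P.root c) =
      l * x a := fun a => by
    have h1 : inner ℝ (EuclideanSpace.single a (1 : ℝ)) (S x) =
        (inner ℝ (P.root a) (simpleComb b x) : ℝ) := by
      rw [ContinuousLinearMap.comp_apply, ContinuousLinearMap.adjoint_inner_right]
      congr 1
      rw [simpleComb_apply]
      simp
    rw [← simpleComb_apply, ← h1, heig, EuclideanSpace.inner_single_left]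
    simp
  have hxnn : ∀ a, 0 ≤ x a := fun a => abs_nonneg _
  have hx0 : x ≠ 0 := by rintro h; rw [h, norm_zero] at hxn; exact zero_ne_one hxn
  have hlpos : 0 < l := by
    rw [hl, ContinuousLinearMap.rayleighQuotient, hSq, hxn]
    have : 0 < ‖simpleComb b x‖ := norm_pos_iff.2 fun h => hx0 (simpleComb_eq_zero h)
    positivity
  have hoff : ∀ a, l * x a = 2 * x a + ∑ c ∈ Finset.univ.erase a,
      x c * inner ℝ (P.root a) (P.root c) := fun a => by
    rw [← hcoord, inner_sum, ← Finset.add_sum_erase _ _ (Finset.mem_univ a), inner_smul_right,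
      inner_root_self hP, mul_comm]
    simp only [inner_smul_right]
  have hterm : ∀ a, ∀ c ∈ Finset.univ.erase a, x c * inner ℝ (P.root a) (P.root c) ≤ 0 :=
    fun a c hc => mul_nonpos_of_nonneg_of_nonpos (hxnn c)
      (inner_simple_nonpos hP (Finset.ne_of_mem_erase hc).symm)
  have hpos : ∀ a, 0 < x a := by
    intro a
    by_contra ha
    -- At a vanishing coordinate the nonpositive off-diagonal terms sum to zero, so each vanishes.
    -- The zero spreads to all neighbours and, by irreducibility, everywhere.
    have hall : ∀ c, x c = 0 := fun c => by
      refine b.induction_on_cartanMatrix (fun c => x c = 0) (i := a)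
        (le_antisymm (not_lt.1 ha) (hxnn a)) (fun i j hi hij => ?_)
      rcases eq_or_ne i j with rfl | hne
      · exact hi
      have h0 := hoff i
      rw [hi, mul_zero, mul_zero, zero_add] at h0
      have h1 := (Finset.sum_eq_zero_iff_of_nonpos (hterm i)).1 h0.symm j
        (Finset.mem_erase.2 ⟨hne.symm, Finset.mem_univ _⟩)
      refine (mul_eq_zero.1 h1).resolve_right fun h2 => hij ?_
      rw [RootPairing.Base.cartanMatrix_apply_eq_zero_iff_pairing, hP, real_inner_comm, h2]
    exact hx0 (by ext c; exact hall c)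
  -- The off-diagonal terms at `a₀` are nonpositive, hence `l ≤ 2`.
  refine ⟨x.ofLp, 2 - l, hpos, ?_, by linarith, fun a => by rw [hcoord]; ring⟩
  have h1 := hoff a₀
  have h2 := Finset.sum_nonpos (hterm a₀)
  have h3 : (2 - l) * x a₀ ≥ 0 := by linarith
  exact nonneg_of_mul_nonneg_left h3 (hpos a₀)

end Perron

end Data

namespace Data

/-! ### Heights of roots and the Coxeter number -/

section Heights

variable {r : ℕ} {ι N : Type*} [AddCommGroup N] [Module ℝ N]
  {P : RootPairing ι ℝ (E r) N} {b : P.Base} (T : Data P b)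

theorem exists_nat_coeff (b : P.Base) (i : ι) :
    ∃ (f : b.support → ℕ) (s : ℝ), (s = 1 ∨ s = -1) ∧
      P.root i = s • ∑ a : b.support, (f a : ℝ) • P.root a := by
  obtain ⟨f, -, hf⟩ := b.exists_root_eq_sum_nat_or_neg i
  have h : ∑ j ∈ b.support, f j • P.root j = ∑ a : b.support, ((f a : ℕ) : ℝ) • P.root a := by
    rw [← Finset.sum_coe_sort]
    simp only [Nat.cast_smul_eq_nsmul]
  rw [h] at hf
  rcases hf with hf | hf
  · exact ⟨fun a => f a, 1, Or.inl rfl, by rw [one_smul, hf]⟩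
  · exact ⟨fun a => f a, -1, Or.inr rfl, by rw [neg_one_smul, hf]⟩

/-- A root which is a combination of mutually orthogonal simple roots is one of them, up to a
sign. -/
theorem exists_eq_of_orthogonal_coeff (hP : IsSimplyLaced P) (S : Finset b.support)
    (horth : ∀ a ∈ S, ∀ c ∈ S, a ≠ c → inner ℝ (P.root a) (P.root c) = (0 : ℝ))
    {i : ι} {f : b.support → ℕ} {s : ℝ} (hs : s = 1 ∨ s = -1)
    (hf : P.root i = s • ∑ a : b.support, (f a : ℝ) • P.root a) (hS : ∀ a ∉ S, f a = 0) :
    ∃ a ∈ S, P.root i = s • P.root a := by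
  classical
  have h1 : ∑ a : b.support, (f a : ℝ) • P.root a = ∑ a ∈ S, (f a : ℝ) • P.root a := by
    refine (Finset.sum_subset (Finset.subset_univ S) fun a _ ha => ?_).symm
    rw [hS a ha, Nat.cast_zero, zero_smul]
  rw [h1] at hf
  -- Orthogonality turns `(α, α) = 2` into `∑ f a ^ 2 = 1`, which over `ℕ` leaves a single
  -- coefficient, equal to `1`.
  have h2 : (2 : ℝ) = ∑ a ∈ S, 2 * (f a : ℝ) ^ 2 := by
    have hs2 : s * s = 1 := by rcases hs with rfl | rfl <;> norm_num
    have e := inner_root_self hP i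
    rw [hf, inner_smul_left, inner_smul_right, ← mul_assoc, RCLike.conj_to_real, hs2, one_mul,
      sum_inner] at e
    refine e.symm.trans ?_
    refine Finset.sum_congr rfl fun a ha => ?_
    rw [inner_smul_left, inner_sum, Finset.sum_eq_single_of_mem a ha, inner_smul_right,
      inner_root_self hP]
    · simp only [RCLike.conj_to_real]; ring
    · intro c hc hne
      rw [inner_smul_right, horth a ha c hc hne.symm, mul_zero]
  have h3 : ∑ a ∈ S, f a ^ 2 = 1 := by
    rw [← Finset.mul_sum] at h2
    have : (∑ a ∈ S, (f a : ℝ) ^ 2) = 1 := by linarith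
    exact_mod_cast this
  obtain ⟨a, ha, hfa⟩ : ∃ a ∈ S, f a ≠ 0 := by
    by_contra! hcon
    rw [Finset.sum_eq_zero (fun a ha => by rw [hcon a ha]; rfl)] at h3
    exact zero_ne_one h3
  have h4 : f a ^ 2 + ∑ c ∈ S.erase a, f c ^ 2 = 1 := by
    rw [Finset.add_sum_erase S (fun c => f c ^ 2) ha]; exact h3
  have h5 : 1 ≤ f a ^ 2 := Nat.one_le_iff_ne_zero.2 (pow_ne_zero 2 hfa)
  have h6 : f a = 1 := by nlinarith [Nat.zero_le (∑ c ∈ S.erase a, f c ^ 2)]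
  have h7 : ∑ c ∈ S.erase a, f c ^ 2 = 0 := by omega
  refine ⟨a, ha, ?_⟩
  rw [hf, Finset.sum_eq_single_of_mem a ha, h6, Nat.cast_one, one_smul]
  intro c hc hne
  have := (Finset.sum_eq_zero_iff.1 h7) c (Finset.mem_erase.2 ⟨hne, hc⟩)
  rw [pow_eq_zero_iff two_ne_zero] at this
  rw [this, Nat.cast_zero, zero_smul]

variable [Finite ι] [P.IsCrystallographic] [P.IsRootSystem]

theorem inner_simple_nonneg_of_mem_closure {v : E r}
    (hv : v ∈ AddSubmonoid.closure (P.root '' b.support)) (a : b.support) :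
    0 ≤ (inner ℝ (T.fundWeight a) v : ℝ) := by
  classical
  induction hv using AddSubmonoid.closure_induction with
  | mem x hx =>
    obtain ⟨c, hc, rfl⟩ := hx
    have := T.inner_fundWeight a ⟨c, hc⟩
    simp only at this
    rw [this]
    split_ifs <;> norm_num
  | zero => simp
  | add x y _ _ hx hy => rw [inner_add_right]; exact add_nonneg hx hy

/-- The highest root is dominant. -/
theorem inner_simple_lowest_nonpos (hP : IsSimplyLaced P) (a : b.support) :
    (inner ℝ (P.root a) (P.root T.lowest) : ℝ) ≤ 0 := by
  classical
  -- The reflection of `α₀` in `α_a` is a root, and it differs from `α₀` by `-(α_a, α₀) α_a`; this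
  -- coefficient cannot be negative.
  have h := T.isLowest (P.reflectionPerm a T.lowest)
  rw [P.root_reflectionPerm, reflection_eq hP, sub_sub_cancel_left] at h
  have h1 := T.inner_simple_nonneg_of_mem_closure h a
  rw [inner_neg_right, inner_smul_right, T.inner_fundWeight] at h1
  simpa using h1

variable [P.IsReduced]

/-- The classical `(2ρ, α_a) = 2`: the reflection in `α_a` permutes the other positive roots and
changes the sign of every product, so only `α_a` contributes. -/
theorem sum_pos_inner_simple [Fintype ι] [DecidablePred b.IsPos] (hP : IsSimplyLaced P)
    (a : b.support) :
    ∑ i with b.IsPos i, (inner ℝ (P.root i) (P.root a) : ℝ) = 2 := by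
  classical
  have ha : (a : ι) ∈ Finset.univ.filter b.IsPos := by
    simpa using b.isPos_of_mem_support a.2
  rw [← Finset.add_sum_erase _ _ ha, inner_root_self hP, add_eq_left]
  have hinn : ∀ i, (inner ℝ (P.root (P.reflectionPerm a i)) (P.root a) : ℝ) =
      -inner ℝ (P.root i) (P.root a) := fun i => by
    rw [P.root_reflectionPerm, reflection_eq hP, inner_sub_left, inner_smul_left,
      inner_root_self hP, real_inner_comm (P.root i) (P.root a)]
    simp only [RCLike.conj_to_real]; ring
  refine Finset.sum_involution (fun i _ => P.reflectionPerm a i) (fun i _ => ?_)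
    (fun i _ h1 h2 => h1 ?_) (fun i hi => ?_) (fun i _ => P.reflectionPerm_self a i)
  · rw [hinn]; ring
  · have := hinn i
    rw [h2] at this; linarith
  · simp only [Finset.mem_erase, Finset.mem_filter, Finset.mem_univ, true_and] at hi ⊢
    refine ⟨fun h => ?_, hi.2.reflectionPerm a.2 hi.1⟩
    have h3 := hi.2.reflectionPerm a.2 hi.1
    have h4 : P.reflectionPerm a a = i := by
      have := P.reflectionPerm_self a i
      rwa [h] at this
    have h5 := hi.2
    rw [← h4] at h5
    have h6 := (RootPairing.Base.IsPos.neg_iff_not b (a : ι)).1 h5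
    exact h6 (b.isPos_of_mem_support a.2)

theorem inner_lowest_nonpos (hP : IsSimplyLaced P) {i : ι} (hi : b.IsPos i) :
    (inner ℝ (P.root i) (P.root T.lowest) : ℝ) ≤ 0 := by
  refine hi.induction_on_add (p := fun i => (inner ℝ (P.root i) (P.root T.lowest) : ℝ) ≤ 0)
    (fun j hj => T.inner_simple_lowest_nonpos hP ⟨j, hj⟩) fun j k l hl hj hk => ?_
  rw [hl, inner_add_left]
  exact add_nonpos hj (T.inner_simple_lowest_nonpos hP ⟨k, hk⟩)

/-- Expand `α₀` in simple roots. The labels sum to `h - 1`, which is how the Coxeter number enters.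
-/
theorem sum_pos_inner_lowest [Fintype ι] [DecidablePred b.IsPos] (hP : IsSimplyLaced P) :
    ∑ i with b.IsPos i, (inner ℝ (P.root i) (P.root T.lowest) : ℝ) =
      -(2 * ∑ a, (T.label a : ℝ)) := by
  rw [T.root_lowest]
  simp only [inner_neg_right, inner_sum, Finset.sum_neg_distrib]
  rw [Finset.sum_comm, Finset.mul_sum]
  congr 1
  refine Finset.sum_congr rfl fun a _ => ?_
  simp only [← Nat.cast_smul_eq_nsmul ℝ, inner_smul_right]
  rw [← Finset.mul_sum, sum_pos_inner_simple hP, mul_comm]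

theorem inner_root_int (hP : IsSimplyLaced P) (i j : ι) :
    ∃ n : ℤ, (inner ℝ (P.root i) (P.root j) : ℝ) = n :=
  ⟨P.pairingIn ℤ i j, by rw [← hP, ← P.algebraMap_pairingIn ℤ]; simp⟩

/-- The equality case of Cauchy–Schwarz for two vectors of squared length `2`. -/
theorem eq_neg_of_inner_le (hP : IsSimplyLaced P) {i j : ι}
    (h : (inner ℝ (P.root i) (P.root j) : ℝ) ≤ -2) : P.root i = -P.root j := by
  have h1 : ‖P.root i + P.root j‖ ^ 2 ≤ 0 := by
    rw [← real_inner_self_eq_norm_sq, inner_add_left, inner_add_right, inner_add_right,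
      inner_root_self hP, inner_root_self hP, real_inner_comm (P.root i) (P.root j)]
    linarith
  have h2 : P.root i + P.root j = 0 := by
    rw [← norm_eq_zero]; exact pow_eq_zero_iff two_ne_zero |>.1 (le_antisymm h1 (sq_nonneg _))
  exact eq_neg_of_add_eq_zero_left h2

/-- For positive roots the product with `α₀` is `0` or `-1`, apart from `-2` at the highest root
`-α₀`. The square is therefore minus the product, with an extra `2` at that one root: `2 (h - 1) +
2`. -/
theorem sum_pos_inner_lowest_sq [Fintype ι] [DecidablePred b.IsPos] (hP : IsSimplyLaced P) :
    ∑ i with b.IsPos i, (inner ℝ (P.root i) (P.root T.lowest) : ℝ) ^ 2 = 2 * T.h := by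
  classical
  set i₀ : ι := P.reflectionPerm T.lowest T.lowest with hi₀
  have hr₀ : P.root i₀ = -P.root T.lowest := by
    rw [hi₀, P.root_reflectionPerm, P.reflection_apply_self]
  have hpos : b.IsPos i₀ := by
    refine (RootPairing.Base.IsPos.neg_iff_not b T.lowest).2 fun h => ?_
    have := T.inner_lowest_nonpos hP h
    rw [inner_root_self hP] at this
    norm_num at this
  have hterm : ∀ i ∈ Finset.univ.filter b.IsPos,
      (inner ℝ (P.root i) (P.root T.lowest) : ℝ) ^ 2 =
        -inner ℝ (P.root i) (P.root T.lowest) + if i = i₀ then 2 else 0 := by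
    intro i hi
    have hi' : b.IsPos i := by simpa using hi
    have h1 := T.inner_lowest_nonpos hP hi'
    split_ifs with hii
    · rw [hii, hr₀, inner_neg_left, inner_root_self hP]; norm_num
    · obtain ⟨n, hn⟩ := inner_root_int hP i T.lowest
      have h2 : ¬ (inner ℝ (P.root i) (P.root T.lowest) : ℝ) ≤ -2 := fun h =>
        hii (P.root.injective ((eq_neg_of_inner_le hP h).trans hr₀.symm))
      rw [hn] at h1 h2 ⊢
      have h3 : n ≤ 0 := by exact_mod_cast h1
      have h4 : ¬ n ≤ -2 := by exact_mod_cast h2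
      have h5 : n = 0 ∨ n = -1 := by omega
      rcases h5 with rfl | rfl <;> norm_num
  rw [Finset.sum_congr rfl hterm, Finset.sum_add_distrib, Finset.sum_neg_distrib,
    T.sum_pos_inner_lowest hP, Finset.sum_ite_eq', if_pos (by simpa using hpos), h]
  push_cast; ring

theorem sum_inner_lowest_sq [Fintype ι] (hP : IsSimplyLaced P) :
    ∑ i, (inner ℝ (P.root i) (P.root T.lowest) : ℝ) ^ 2 = 4 * T.h := by
  classical
  rw [← Finset.sum_filter_add_sum_filter_not Finset.univ b.IsPos, T.sum_pos_inner_lowest_sq hP]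
  have h : ∑ i with ¬ b.IsPos i, (inner ℝ (P.root i) (P.root T.lowest) : ℝ) ^ 2 =
      ∑ i with b.IsPos i, (inner ℝ (P.root i) (P.root T.lowest) : ℝ) ^ 2 := by
    refine Finset.sum_nbij' (fun i => P.reflectionPerm i i) (fun i => P.reflectionPerm i i)
      (fun i hi => ?_) (fun i hi => ?_) (fun i _ => ?_) (fun i _ => ?_) (fun i _ => ?_)
    · simp only [Finset.mem_filter, Finset.mem_univ, true_and] at hi ⊢
      exact (RootPairing.Base.IsPos.neg_iff_not b i).2 hi
    · simp only [Finset.mem_filter, Finset.mem_univ, true_and] at hi ⊢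
      exact fun h => (RootPairing.Base.IsPos.neg_iff_not b i).1 h hi
    · exact P.indexNeg.neg_neg i
    · exact P.indexNeg.neg_neg i
    · rw [P.root_reflectionPerm, P.reflection_apply_self, inner_neg_left, neg_sq]
  rw [h, T.sum_pos_inner_lowest_sq hP]; ring

end Heights

end Data

/-! ### Angles of complex numbers -/

/-- The complex number `z` is nonzero and has the angle `ψ`. -/
def HasAngle (z : ℂ) (ψ : ℝ) : Prop := ∃ t : ℝ, 0 < t ∧ z = t * Complex.exp (ψ * Complex.I)

namespace HasAngle

theorem mul_exp {z : ℂ} {ψ : ℝ} (h : HasAngle z ψ) (χ : ℝ) :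
    HasAngle (Complex.exp (χ * Complex.I) * z) (ψ + χ) := by
  obtain ⟨t, ht, rfl⟩ := h
  refine ⟨t, ht, ?_⟩
  rw [Complex.ofReal_add, add_mul, Complex.exp_add]; ring

theorem neg {z : ℂ} {ψ : ℝ} (h : HasAngle z ψ) : HasAngle (-z) (ψ + Real.pi) := by
  have := h.mul_exp Real.pi
  rwa [Complex.exp_pi_mul_I, neg_one_mul] at this

theorem conj {z : ℂ} {ψ : ℝ} (h : HasAngle z ψ) : HasAngle (starRingEnd ℂ z) (-ψ) := by
  obtain ⟨t, ht, rfl⟩ := h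
  refine ⟨t, ht, ?_⟩
  rw [map_mul, Complex.conj_ofReal, ← Complex.exp_conj, map_mul, Complex.conj_ofReal,
    Complex.conj_I]
  push_cast; ring_nf

theorem add_two_pi_mul_int {z : ℂ} {ψ : ℝ} (h : HasAngle z ψ) (n : ℤ) :
    HasAngle z (ψ + 2 * Real.pi * n) := by
  obtain ⟨t, ht, rfl⟩ := h
  refine ⟨t, ht, ?_⟩
  have : ((ψ + 2 * Real.pi * n : ℝ) : ℂ) * Complex.I =
      ψ * Complex.I + n * (2 * Real.pi * Complex.I) := by push_cast; ring
  rw [this, Complex.exp_add, Complex.exp_int_mul_two_pi_mul_I, mul_one]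

theorem ne_zero {z : ℂ} {ψ : ℝ} (h : HasAngle z ψ) : z ≠ 0 := by
  obtain ⟨t, ht, rfl⟩ := h
  exact mul_ne_zero (by exact_mod_cast ht.ne') (Complex.exp_ne_zero _)

theorem arg {z : ℂ} (hz : z ≠ 0) : HasAngle z (Complex.arg z) :=
  ⟨‖z‖, norm_pos_iff.2 hz, (Complex.norm_mul_exp_arg_mul_I z).symm⟩

theorem eq_add {z : ℂ} {ψ χ : ℝ} (h : HasAngle z ψ) (h' : HasAngle z χ) :
    ∃ n : ℤ, ψ = χ + 2 * Real.pi * n := by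
  obtain ⟨t, ht, h⟩ := h
  obtain ⟨s, hs, h'⟩ := h'
  have hn1 : ‖z‖ = t := by
    rw [h, norm_mul, Complex.norm_exp_ofReal_mul_I, Complex.norm_real, mul_one, Real.norm_eq_abs,
      abs_of_pos ht]
  have hn2 : ‖z‖ = s := by
    rw [h', norm_mul, Complex.norm_exp_ofReal_mul_I, Complex.norm_real, mul_one, Real.norm_eq_abs,
      abs_of_pos hs]
  have hts : t = s := hn1.symm.trans hn2
  subst hts
  have hne : (t : ℂ) ≠ 0 := by exact_mod_cast ht.ne'
  have he := mul_left_cancel₀ hne (h.symm.trans h')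
  obtain ⟨n, hn⟩ := Complex.exp_eq_exp_iff_exists_int.1 he
  refine ⟨n, ?_⟩
  have h3 : (ψ : ℂ) * Complex.I = ((χ + 2 * Real.pi * n : ℝ) : ℂ) * Complex.I := by
    rw [hn]; push_cast; ring
  exact_mod_cast mul_right_cancel₀ Complex.I_ne_zero h3

theorem im_eq {z : ℂ} {ψ : ℝ} (h : HasAngle z ψ) : ∃ t : ℝ, 0 < t ∧ z.re = t * Real.cos ψ ∧
    z.im = t * Real.sin ψ := by
  obtain ⟨t, ht, rfl⟩ := h
  exact ⟨t, ht, by rw [Complex.re_ofReal_mul, Complex.exp_ofReal_mul_I_re],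
    by rw [Complex.im_ofReal_mul, Complex.exp_ofReal_mul_I_im]⟩

end HasAngle

namespace Data

/-! ### The Coxeter plane -/

section Plane

variable {r : ℕ} {ι N : Type*} [AddCommGroup N] [Module ℝ N]
  {P : RootPairing ι ℝ (E r) N} {b : P.Base} (T : Data P b)

/-- The coefficients `x` form a positive eigenvector of the Cartan matrix, for the eigenvalue
`2 - 2 cos φ`. -/
structure IsPerron (b : P.Base) (x : b.support → ℝ) (φ : ℝ) : Prop where
  pos : ∀ a, 0 < x a
  angle_pos : 0 < φ
  angle_le : φ ≤ Real.pi / 2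
  eigen : ∀ a : b.support,
    inner ℝ (P.root a) (∑ c : b.support, x c • P.root c) = (2 - 2 * Real.cos φ) * x a

theorem IsPerron.sin_pos {b : P.Base} {x : b.support → ℝ} {φ : ℝ} (hx : IsPerron b x φ) :
    0 < Real.sin φ :=
  Real.sin_pos_of_pos_of_lt_pi hx.angle_pos (by linarith [hx.angle_le, Real.pi_pos])

theorem exists_isPerron [Finite ι] [P.IsRootSystem] [P.IsCrystallographic] [P.IsReduced]
    [P.IsIrreducible] (hP : IsSimplyLaced P) (b : P.Base) : ∃ x φ, IsPerron b x φ := by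
  obtain ⟨x, μ, hx, h0, h2, heig⟩ := exists_perron (b := b) hP
  refine ⟨x, Real.arccos (μ / 2), hx, Real.arccos_pos.2 (by linarith),
    Real.arccos_le_pi_div_two.2 (by linarith), fun a => ?_⟩
  rw [heig, Real.cos_arccos (by linarith) (by linarith)]; ring

variable [P.IsRootSystem]

open Classical in
/-- The projection to the plane spanned by the white and the black part of a Perron–Frobenius
eigenvector. -/
def planeMap (x : b.support → ℝ) (φ : ℝ) : E r →ₗ[ℝ] ℂ :=
  b.toWeightBasis.constr ℝ fun a =>
    if a ∈ T.black then -(x a * Complex.exp (φ * Complex.I)) else (x a : ℂ)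

variable {x : b.support → ℝ} {φ : ℝ}

theorem planeMap_white {a : b.support} (ha : a ∈ T.white) :
    T.planeMap x φ (P.root a) = x a := by
  rw [← b.toWeightBasis_apply, planeMap, Module.Basis.constr_basis, if_neg (T.mem_white.1 ha)]

theorem planeMap_black {a : b.support} (ha : a ∈ T.black) :
    T.planeMap x φ (P.root a) = -(x a * Complex.exp (φ * Complex.I)) := by
  rw [← b.toWeightBasis_apply, planeMap, Module.Basis.constr_basis, if_pos ha]

theorem sum_black_add_sum_white {M : Type*} [AddCommMonoid M] (f : b.support → M) :
    ∑ a ∈ T.black, f a + ∑ a ∈ T.white, f a = ∑ a, f a := by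
  classical
  have : T.white = T.blackᶜ := by ext; simp [mem_white]
  rw [this, Finset.sum_add_sum_compl]

/-- The eigenvector equation at a black vertex: among the black terms only the diagonal one, `2 x
c`, survives. -/
theorem IsPerron.sum_white (hx : IsPerron b x φ) (hP : IsSimplyLaced P) {c : b.support}
    (hc : c ∈ T.black) :
    ∑ a ∈ T.white, inner ℝ (P.root a) (P.root c) * x a = -(2 * Real.cos φ * x c) := by
  have h := hx.eigen c
  rw [← T.sum_black_add_sum_white, inner_add_right, T.inner_sum_black hP hc, inner_sum] at h
  simp only [inner_smul_right] at h
  simp only [real_inner_comm _ (P.root c)] at h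
  rw [Finset.sum_congr rfl fun a _ => mul_comm _ _]
  linarith

theorem IsPerron.sum_black (hx : IsPerron b x φ) (hP : IsSimplyLaced P) {c : b.support}
    (hc : c ∈ T.white) :
    ∑ a ∈ T.black, inner ℝ (P.root a) (P.root c) * x a = -(2 * Real.cos φ * x c) := by
  have h := hx.eigen c
  rw [← T.sum_black_add_sum_white, inner_add_right, T.inner_sum_white hP hc, inner_sum] at h
  simp only [inner_smul_right] at h
  simp only [real_inner_comm _ (P.root c)] at h
  rw [Finset.sum_congr rfl fun a _ => mul_comm _ _]
  linarith

theorem exp_add_exp_neg (φ : ℝ) : Complex.exp (φ * Complex.I) + Complex.exp (-φ * Complex.I) =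
    2 * Real.cos φ := by
  rw [Complex.ofReal_cos, Complex.two_cos]

theorem conj_exp_mul_I (φ : ℝ) :
    starRingEnd ℂ (Complex.exp (φ * Complex.I)) = Complex.exp (-φ * Complex.I) := by
  rw [← Complex.exp_conj, map_mul, Complex.conj_ofReal, Complex.conj_I]; ring_nf

/-- White roots lie on the real axis and change sign. For black roots the eigenvector equation
supplies `2 cos φ = e^{iφ} + e^{-iφ}`, exactly what a reflection in the imaginary axis requires. -/
theorem planeMap_whiteRefl (hP : IsSimplyLaced P) (hx : IsPerron b x φ) (v : E r) :
    T.planeMap x φ (T.whiteRefl v) = -starRingEnd ℂ (T.planeMap x φ v) := by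
  have h : (T.planeMap x φ).comp (T.whiteRefl : E r →ₗ[ℝ] E r) =
      -(Complex.conjAe.toLinearMap.comp (T.planeMap x φ)) := by
    refine b.toWeightBasis.ext fun c => ?_
    simp only [RootPairing.Base.toWeightBasis_apply, LinearMap.comp_apply, LinearMap.neg_apply,
      LinearEquiv.coe_coe, AlgEquiv.toLinearMap_apply, Complex.conjAe_coe]
    by_cases hc : c ∈ T.black
    · have hs := hx.sum_white T hP hc
      rw [T.whiteRefl_apply hP, map_sub, map_sum, T.planeMap_black hc]
      have : ∑ a ∈ T.white, T.planeMap x φ (inner ℝ (P.root a) (P.root c) • P.root a) =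
          ((∑ a ∈ T.white, inner ℝ (P.root a) (P.root c) * x a : ℝ) : ℂ) := by
        rw [Complex.ofReal_sum]
        refine Finset.sum_congr rfl fun a ha => ?_
        rw [map_smul, T.planeMap_white ha, Complex.real_smul, Complex.ofReal_mul]
      rw [this, hs, map_neg, map_mul, Complex.conj_ofReal, conj_exp_mul_I]
      push_cast
      rw [← Complex.ofReal_cos]
      linear_combination (-(x c : ℂ)) * exp_add_exp_neg φ
    · have hc' := T.mem_white.2 hc
      rw [T.whiteRefl_root hP hc', map_neg, T.planeMap_white hc', Complex.conj_ofReal]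
  exact LinearMap.congr_fun h v

/-- The same argument with the colours exchanged; the reflected direction is now that of `e^{iφ}`,
along which the black roots lie. -/
theorem planeMap_blackRefl (hP : IsSimplyLaced P) (hx : IsPerron b x φ) (v : E r) :
    T.planeMap x φ (T.blackRefl v) =
      -(Complex.exp ((2 * φ : ℝ) * Complex.I) * starRingEnd ℂ (T.planeMap x φ v)) := by
  have he : Complex.exp ((2 * φ : ℝ) * Complex.I) =
      Complex.exp (φ * Complex.I) * Complex.exp (φ * Complex.I) := by
    rw [← Complex.exp_add]; push_cast; ring_nf
  have he' : Complex.exp (φ * Complex.I) * Complex.exp (-φ * Complex.I) = 1 := by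
    rw [← Complex.exp_add]; ring_nf; exact Complex.exp_zero
  have h : (T.planeMap x φ).comp (T.blackRefl : E r →ₗ[ℝ] E r) =
      -(Complex.exp ((2 * φ : ℝ) * Complex.I) •
        (Complex.conjAe.toLinearMap.comp (T.planeMap x φ))) := by
    refine b.toWeightBasis.ext fun c => ?_
    simp only [RootPairing.Base.toWeightBasis_apply, LinearMap.comp_apply, LinearMap.neg_apply,
      LinearEquiv.coe_coe, AlgEquiv.toLinearMap_apply, Complex.conjAe_coe, LinearMap.smul_apply,
      smul_eq_mul]
    by_cases hc : c ∈ T.black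
    · rw [T.blackRefl_root hP hc, map_neg, T.planeMap_black hc, map_neg, map_mul,
        Complex.conj_ofReal, conj_exp_mul_I, he]
      linear_combination (-(x c : ℂ) * Complex.exp (φ * Complex.I)) * he'
    · have hc' := T.mem_white.2 hc
      have hs := hx.sum_black T hP hc'
      rw [T.blackRefl_apply hP, map_sub, map_sum, T.planeMap_white hc']
      have : ∑ a ∈ T.black, T.planeMap x φ (inner ℝ (P.root a) (P.root c) • P.root a) =
          -(((∑ a ∈ T.black, inner ℝ (P.root a) (P.root c) * x a : ℝ) : ℂ) *
            Complex.exp (φ * Complex.I)) := by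
        rw [Complex.ofReal_sum, Finset.sum_mul, ← Finset.sum_neg_distrib]
        refine Finset.sum_congr rfl fun a ha => ?_
        rw [map_smul, T.planeMap_black ha, Complex.real_smul, Complex.ofReal_mul]; ring
      rw [this, hs, Complex.conj_ofReal, he]
      push_cast
      rw [← Complex.ofReal_cos]
      linear_combination (x c : ℂ) * Complex.exp (φ * Complex.I) * exp_add_exp_neg φ -
        (x c : ℂ) * he'
  exact LinearMap.congr_fun h v

theorem planeMap_w (hP : IsSimplyLaced P) (hx : IsPerron b x φ) (v : E r) :
    T.planeMap x φ (T.w v) = Complex.exp ((2 * φ : ℝ) * Complex.I) * T.planeMap x φ v := by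
  rw [w_apply, T.planeMap_blackRefl hP hx, T.planeMap_whiteRefl hP hx, map_neg, Complex.conj_conj]
  ring

theorem planeMap_w_zpow (hP : IsSimplyLaced P) (hx : IsPerron b x φ) (v : E r) (n : ℤ) :
    T.planeMap x φ ((T.w ^ n) v) =
      Complex.exp ((2 * n * φ : ℝ) * Complex.I) * T.planeMap x φ v := by
  have hpos : ∀ (k : ℕ) (v : E r), T.planeMap x φ ((T.w ^ k) v) =
      Complex.exp ((2 * k * φ : ℝ) * Complex.I) * T.planeMap x φ v := by
    intro k
    induction k with
    | zero => intro v; simp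
    | succ k ih =>
      intro v
      rw [pow_succ, LinearEquiv.mul_apply, ih, T.planeMap_w hP hx, ← mul_assoc, ← Complex.exp_add]
      push_cast; ring_nf
  obtain ⟨k, rfl | rfl⟩ := n.eq_nat_or_neg
  · simpa using hpos k v
  · have := hpos k ((T.w ^ (-(k : ℤ))) v)
    rw [← zpow_natCast, ← LinearEquiv.mul_apply, ← zpow_add, add_neg_cancel, zpow_zero,
      LinearEquiv.coe_one, id_eq] at this
    rw [this, ← mul_assoc, ← Complex.exp_add]
    push_cast
    rw [show (2 * -(k : ℂ) * φ * Complex.I + 2 * k * φ * Complex.I) = 0 by ring, Complex.exp_zero,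
      one_mul]

end Plane

end Data

namespace Data

/-! ### Directions of the projected roots -/

section RootAngles

variable {r : ℕ} {ι N : Type*} [AddCommGroup N] [Module ℝ N]
  {P : RootPairing ι ℝ (E r) N} {b : P.Base} (T : Data P b) [P.IsRootSystem]
  {x : b.support → ℝ} {φ : ℝ}

/-- `A` and `B` collect the white and the black coefficients, which share the sign `s`. If one of
them vanishes, positivity of `x` removes that colour, and orthogonality of the other colour leaves a
single simple root. -/
theorem planeMap_root (hP : IsSimplyLaced P) (hx : IsPerron b x φ) (i : ι) :
    ∃ A B s : ℝ, 0 ≤ A ∧ 0 ≤ B ∧ (s = 1 ∨ s = -1) ∧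
      T.planeMap x φ (P.root i) = s * (A - B * Complex.exp (φ * Complex.I)) ∧
      (B = 0 → ∃ a ∈ T.white, P.root i = s • P.root a) ∧
      (A = 0 → ∃ a ∈ T.black, P.root i = s • P.root a) := by
  obtain ⟨f, s, hs, hf⟩ := exists_nat_coeff b i
  have hnn : ∀ a, 0 ≤ (f a : ℝ) * x a := fun a => mul_nonneg (Nat.cast_nonneg _) (hx.pos a).le
  refine ⟨∑ a ∈ T.white, f a * x a, ∑ a ∈ T.black, f a * x a, s,
    Finset.sum_nonneg fun a _ => hnn a, Finset.sum_nonneg fun a _ => hnn a, hs, ?_, ?_, ?_⟩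
  · rw [hf, map_smul, Complex.real_smul, map_sum, ← T.sum_black_add_sum_white]
    congr 1
    rw [Complex.ofReal_sum, Complex.ofReal_sum, Finset.sum_mul, sub_eq_add_neg,
      ← Finset.sum_neg_distrib, add_comm]
    congr 1
    · refine Finset.sum_congr rfl fun a ha => ?_
      rw [map_smul, T.planeMap_white ha, Complex.real_smul, Complex.ofReal_mul]
    · refine Finset.sum_congr rfl fun a ha => ?_
      rw [map_smul, T.planeMap_black ha, Complex.real_smul, Complex.ofReal_mul]; ring
  · intro hB
    refine exists_eq_of_orthogonal_coeff hP T.white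
      (fun a ha c hc hne => T.inner_white hP ha hc hne) hs hf fun a ha => ?_
    have ha' : a ∈ T.black := by by_contra h; exact ha (T.mem_white.2 h)
    have := (Finset.sum_eq_zero_iff_of_nonneg fun a _ => hnn a).1 hB a ha'
    exact_mod_cast (mul_eq_zero.1 this).resolve_right (hx.pos a).ne'
  · intro hA
    refine exists_eq_of_orthogonal_coeff hP T.black
      (fun a ha c hc hne => T.inner_black hP ha hc hne) hs hf fun a ha => ?_
    have := (Finset.sum_eq_zero_iff_of_nonneg fun a _ => hnn a).1 hA a (T.mem_white.2 ha)
    exact_mod_cast (mul_eq_zero.1 this).resolve_right (hx.pos a).ne'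

/-- The cone between the white and the black simple roots contains the projection of no root. -/
theorem not_hasAngle_of_mem_Ioo (hP : IsSimplyLaced P) (hx : IsPerron b x φ) (i : ι) {ψ : ℝ}
    (h0 : 0 < ψ) (h1 : ψ < φ) : ¬ HasAngle (T.planeMap x φ (P.root i)) ψ := by
  intro hψ
  obtain ⟨A, B, s, hA, hB, hs, h, -, -⟩ := T.planeMap_root hP hx i
  obtain ⟨t, ht, hre, him⟩ := hψ.im_eq
  have hlt := hx.angle_le
  have hpi := Real.pi_pos
  have e1 : (T.planeMap x φ (P.root i)).re = s * (A - B * Real.cos φ) := by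
    rw [h, Complex.re_ofReal_mul, Complex.sub_re, Complex.re_ofReal_mul,
      Complex.exp_ofReal_mul_I_re, Complex.ofReal_re]
  have e2 : (T.planeMap x φ (P.root i)).im = -(s * (B * Real.sin φ)) := by
    rw [h, Complex.im_ofReal_mul, Complex.sub_im, Complex.im_ofReal_mul,
      Complex.exp_ofReal_mul_I_im, Complex.ofReal_im]
    ring
  rw [hre] at e1
  rw [him] at e2
  have hsin := hx.sin_pos
  have hsψ : 0 < Real.sin ψ := Real.sin_pos_of_pos_of_lt_pi h0 (by linarith)
  have hsd : 0 < Real.sin (φ - ψ) := Real.sin_pos_of_pos_of_lt_pi (by linarith) (by linarith)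
  -- This combination eliminates `B`. It forces `s = 1`, whereas `e2` forces `s = -1`.
  have e3 : t * Real.sin (φ - ψ) = s * (A * Real.sin φ) := by
    rw [Real.sin_sub]; linear_combination Real.sin φ * e1 - Real.cos φ * e2
  have p1 : 0 < t * Real.sin (φ - ψ) := mul_pos ht hsd
  have p2 : 0 < t * Real.sin ψ := mul_pos ht hsψ
  have p3 : 0 ≤ A * Real.sin φ := mul_nonneg hA hsin.le
  have p4 : 0 ≤ B * Real.sin φ := mul_nonneg hB hsin.le
  rcases hs with rfl | rfl <;> linarith

/-- On this edge of the empty cone `B = 0`, and the sign of the real part excludes negatives of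
white roots. -/
theorem eq_white_of_hasAngle_zero (hP : IsSimplyLaced P) (hx : IsPerron b x φ) {i : ι}
    (h0 : HasAngle (T.planeMap x φ (P.root i)) 0) : ∃ a ∈ T.white, i = a := by
  obtain ⟨A, B, s, hA, hB, hs, h, hw, -⟩ := T.planeMap_root hP hx i
  obtain ⟨t, ht, hre, him⟩ := h0.im_eq
  rw [Real.sin_zero, mul_zero, h, Complex.im_ofReal_mul, Complex.sub_im, Complex.im_ofReal_mul,
    Complex.exp_ofReal_mul_I_im, Complex.ofReal_im] at him
  rw [Real.cos_zero, mul_one, h, Complex.re_ofReal_mul, Complex.sub_re, Complex.re_ofReal_mul,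
    Complex.exp_ofReal_mul_I_re, Complex.ofReal_re] at hre
  have hsin := hx.sin_pos
  have hs0 : s ≠ 0 := by rcases hs with rfl | rfl <;> norm_num
  have hB0 : B = 0 := by
    have := (mul_eq_zero.1 him).resolve_left hs0
    rw [zero_sub, neg_eq_zero] at this
    exact (mul_eq_zero.1 this).resolve_right hsin.ne'
  obtain ⟨a, ha, hia⟩ := hw hB0
  refine ⟨a, ha, P.root.injective ?_⟩
  rcases hs with rfl | rfl
  · rw [hia, one_smul]
  · rw [hB0] at hre; linarith

/-- On the other edge of the cone `A = 0`, and here the sign must be negative. -/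
theorem eq_neg_black_of_hasAngle (hP : IsSimplyLaced P) (hx : IsPerron b x φ) {i : ι}
    (h0 : HasAngle (T.planeMap x φ (P.root i)) φ) : ∃ a ∈ T.black, P.root i = -P.root a := by
  obtain ⟨A, B, s, hA, hB, hs, h, -, hw⟩ := T.planeMap_root hP hx i
  obtain ⟨t, ht, hre, him⟩ := h0.im_eq
  rw [h, Complex.im_ofReal_mul, Complex.sub_im, Complex.im_ofReal_mul,
    Complex.exp_ofReal_mul_I_im, Complex.ofReal_im] at him
  rw [h, Complex.re_ofReal_mul, Complex.sub_re, Complex.re_ofReal_mul,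
    Complex.exp_ofReal_mul_I_re, Complex.ofReal_re] at hre
  have hsin := hx.sin_pos
  have hs0 : s ≠ 0 := by rcases hs with rfl | rfl <;> norm_num
  have hsB : -(s * B) = t := mul_right_cancel₀ hsin.ne' (by linear_combination him)
  have hA0 : A = 0 := by
    have h3 : s * A = 0 := by linear_combination hre - Real.cos φ * hsB
    exact (mul_eq_zero.1 h3).resolve_left hs0
  obtain ⟨a, ha, hia⟩ := hw hA0
  refine ⟨a, ha, ?_⟩
  rcases hs with rfl | rfl
  · linarith
  · rw [hia, neg_one_smul]

theorem planeMap_root_ne_zero (hP : IsSimplyLaced P) (hx : IsPerron b x φ) (i : ι) :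
    T.planeMap x φ (P.root i) ≠ 0 := by
  intro h0
  obtain ⟨A, B, s, hA, hB, hs, h, hw, -⟩ := T.planeMap_root hP hx i
  have hs0 : s ≠ 0 := by rcases hs with rfl | rfl <;> norm_num
  have him : (T.planeMap x φ (P.root i)).im = 0 := by rw [h0]; rfl
  rw [h, Complex.im_ofReal_mul, Complex.sub_im, Complex.im_ofReal_mul,
    Complex.exp_ofReal_mul_I_im, Complex.ofReal_im] at him
  have hB0 : B = 0 := by
    have := (mul_eq_zero.1 him).resolve_left hs0
    rw [zero_sub, neg_eq_zero] at this
    exact (mul_eq_zero.1 this).resolve_right hx.sin_pos.ne'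
  obtain ⟨a, ha, hia⟩ := hw hB0
  rw [hia, map_smul, T.planeMap_white ha, Complex.real_smul] at h0
  have := (hx.pos a).ne'
  exact (mul_ne_zero (by exact_mod_cast hs0) (by exact_mod_cast this)) h0

theorem exists_root_eq_noncommProd (s : Finset b.support)
    (hs : (s : Set b.support).Pairwise
      (Function.onFun Commute fun a : b.support => P.reflection a)) (i : ι) :
    ∃ j, P.root j = s.noncommProd (fun a : b.support => P.reflection a) hs (P.root i) := by
  refine Finset.noncommProd_induction s _ hs (fun g => ∀ i, ∃ j, P.root j = g (P.root i))
    (fun g g' hg hg' i => ?_) (fun i => ⟨i, rfl⟩)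
    (fun a _ i => ⟨P.reflectionPerm a i, P.root_reflectionPerm a i⟩) i
  obtain ⟨j, hj⟩ := hg' i
  obtain ⟨k, hk⟩ := hg j
  exact ⟨k, by rw [hk, hj]; rfl⟩

theorem exists_root_eq_whiteRefl (i : ι) : ∃ j, P.root j = T.whiteRefl (P.root i) :=
  exists_root_eq_noncommProd _ _ i

theorem exists_root_eq_blackRefl (i : ι) : ∃ j, P.root j = T.blackRefl (P.root i) :=
  exists_root_eq_noncommProd _ _ i

theorem exists_root_eq_w (i : ι) : ∃ j, P.root j = T.w (P.root i) := by
  obtain ⟨k, hk⟩ := T.exists_root_eq_whiteRefl i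
  obtain ⟨j, hj⟩ := T.exists_root_eq_blackRefl k
  exact ⟨j, by rw [hj, hk, w_apply]⟩

theorem exists_root_eq_w_inv (hP : IsSimplyLaced P) (i : ι) : ∃ j, P.root j = T.w⁻¹ (P.root i) := by
  obtain ⟨k, hk⟩ := T.exists_root_eq_blackRefl i
  obtain ⟨j, hj⟩ := T.exists_root_eq_whiteRefl k
  exact ⟨j, by rw [hj, hk, T.w_inv_apply hP]⟩

theorem exists_root_eq_w_zpow (hP : IsSimplyLaced P) (n : ℤ) (i : ι) :
    ∃ j, P.root j = (T.w ^ n) (P.root i) := by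
  have h : ∀ (g : E r ≃ₗ[ℝ] E r), (∀ i, ∃ j, P.root j = g (P.root i)) → ∀ (k : ℕ) (i : ι),
      ∃ j, P.root j = (g ^ k) (P.root i) := by
    intro g hg k
    induction k with
    | zero => exact fun i => ⟨i, rfl⟩
    | succ k ih =>
      intro i
      obtain ⟨j, hj⟩ := hg i
      obtain ⟨l, hl⟩ := ih j
      exact ⟨l, by rw [hl, hj, pow_succ]; rfl⟩
  obtain ⟨k, rfl | rfl⟩ := n.eq_nat_or_neg
  · simpa using h T.w T.exists_root_eq_w k i
  · simpa using h T.w⁻¹ (T.exists_root_eq_w_inv hP) k i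

theorem hasAngle_white (hx : IsPerron b x φ) {a : b.support} (ha : a ∈ T.white) :
    HasAngle (T.planeMap x φ (P.root a)) 0 :=
  ⟨x a, hx.pos a, by rw [T.planeMap_white ha]; simp⟩

theorem hasAngle_neg_black (hx : IsPerron b x φ) {a : b.support} (ha : a ∈ T.black) :
    HasAngle (T.planeMap x φ (-P.root a)) φ :=
  ⟨x a, hx.pos a, by rw [map_neg, T.planeMap_black ha, neg_neg]⟩

theorem hasAngle_w_zpow (hP : IsSimplyLaced P) (hx : IsPerron b x φ) {v : E r} {ψ : ℝ}
    (h : HasAngle (T.planeMap x φ v) ψ) (n : ℤ) :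
    HasAngle (T.planeMap x φ ((T.w ^ n) v)) (ψ + 2 * n * φ) := by
  rw [T.planeMap_w_zpow hP hx]; exact h.mul_exp _

theorem exists_neg_root (i : ι) : ∃ j, P.root j = -P.root i :=
  ⟨P.reflectionPerm i i, by rw [P.root_reflectionPerm, P.reflection_apply_self]⟩

/-- The angle between the two walls divides `π`. -/
theorem exists_nat_mul_angle_eq_pi (T : Data P b) [Nonempty b.support] (hP : IsSimplyLaced P)
    (hx : IsPerron b x φ) : ∃ m : ℕ, 0 < m ∧ m * φ = Real.pi := by
  -- If one colour is absent, the eigenvector equation has no neighbour terms; then `cos φ = 0`, so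
  -- `φ = π / 2` and `m = 2`.
  have hcos : (∃ c, x c * Real.cos φ = 0) → ∃ m : ℕ, 0 < m ∧ m * φ = Real.pi := by
    rintro ⟨c, hc⟩
    have h0 : Real.cos φ = 0 := (mul_eq_zero.1 hc).resolve_left (hx.pos c).ne'
    refine ⟨2, two_pos, ?_⟩
    rcases lt_or_eq_of_le hx.angle_le with h | h
    · exact absurd h0 (Real.cos_pos_of_mem_Ioo ⟨by linarith [hx.angle_pos], h⟩).ne'
    · rw [h]; push_cast; ring
  rcases T.black.eq_empty_or_nonempty with hb | ⟨β, hβ⟩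
  · obtain ⟨c⟩ := ‹Nonempty b.support›
    have hc : c ∈ T.white := T.mem_white.2 (by rw [hb]; simp)
    have := hx.sum_black T hP hc
    rw [hb, Finset.sum_empty] at this
    exact hcos ⟨c, by linarith⟩
  rcases T.white.eq_empty_or_nonempty with hw | ⟨α, hα⟩
  · have := hx.sum_white T hP hβ
    rw [hw, Finset.sum_empty] at this
    exact hcos ⟨β, by linarith⟩
  set k := ⌊Real.pi / φ⌋₊ with hk
  have hφ := hx.angle_pos
  have h1 : k * φ ≤ Real.pi := by
    rw [← le_div_iff₀ hφ]; exact Nat.floor_le (div_nonneg Real.pi_pos.le hφ.le)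
  have h2 : Real.pi < (k + 1) * φ := by
    rw [← div_lt_iff₀ hφ]; exact Nat.lt_floor_add_one _
  -- Negative powers of `w` reach the angle `-kφ` from a white root (angle `0`) for even `k` and
  -- from a negated black root (angle `φ`) for odd `k`.
  have hroot : ∃ j, HasAngle (T.planeMap x φ (P.root j)) (-(k * φ)) := by
    obtain ⟨l, hl⟩ := Nat.even_or_odd' k
    rcases hl with hl | hl
    · obtain ⟨j, hj⟩ := T.exists_root_eq_w_zpow hP (-(l : ℤ)) (α : ι)
      refine ⟨j, ?_⟩
      rw [hj]
      convert T.hasAngle_w_zpow hP hx (T.hasAngle_white hx hα) (-(l : ℤ)) using 1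
      rw [hl]; push_cast; ring
    · obtain ⟨j', hj'⟩ := exists_neg_root (P := P) (β : ι)
      obtain ⟨j, hj⟩ := T.exists_root_eq_w_zpow hP (-((l : ℤ) + 1)) j'
      refine ⟨j, ?_⟩
      rw [hj, hj']
      convert T.hasAngle_w_zpow hP hx (T.hasAngle_neg_black hx hβ) (-((l : ℤ) + 1)) using 1
      rw [hl]; push_cast; ring
  obtain ⟨j, hj⟩ := hroot
  -- If `kφ < π`, the negative of this root has the angle `π - kφ`, strictly between `0` and `φ`.
  rcases lt_or_eq_of_le h1 with hlt | heq
  · exfalso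
    obtain ⟨j', hj'⟩ := exists_neg_root (P := P) j
    refine T.not_hasAngle_of_mem_Ioo hP hx j' (ψ := -(k * φ) + Real.pi) (by linarith)
      (by linarith) ?_
    rw [hj', map_neg]; exact hj.neg
  · refine ⟨k, ?_, heq⟩
    rcases Nat.eq_zero_or_pos k with h0 | h0
    · rw [h0, Nat.cast_zero, zero_mul] at heq
      exact absurd heq Real.pi_pos.ne
    · exact h0

/-- The projections of the roots point into the directions that are multiples of `φ`. -/
theorem exists_int_hasAngle (hP : IsSimplyLaced P) (hx : IsPerron b x φ) (i : ι) :
    ∃ t : ℤ, HasAngle (T.planeMap x φ (P.root i)) (t * φ) := by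
  have hφ := hx.angle_pos
  have hA := HasAngle.arg (T.planeMap_root_ne_zero hP hx i)
  set ψ := Complex.arg (T.planeMap x φ (P.root i))
  set n := ⌊ψ / (2 * φ)⌋ with hn
  have h1 : n * (2 * φ) ≤ ψ := by
    rw [← le_div_iff₀ (by positivity)]; exact Int.floor_le _
  have h2 : ψ < (n + 1) * (2 * φ) := by
    rw [← div_lt_iff₀ (by positivity)]; exact Int.lt_floor_add_one _
  -- Rotation by `w ^ (-n)` brings the angle into `[0, 2φ)`, whose open lower half is the empty
  -- cone.
  obtain ⟨j, hj⟩ := T.exists_root_eq_w_zpow hP (-n) i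
  have hAj := T.hasAngle_w_zpow hP hx hA (-n)
  rw [← hj] at hAj
  push_cast at hAj
  rcases lt_trichotomy ψ ((2 * n + 1) * φ) with hlt | heq | hgt
  · rcases eq_or_lt_of_le h1 with h | h
    · exact ⟨2 * n, by push_cast; convert hA using 1; rw [← h]; ring⟩
    · exact absurd hAj (T.not_hasAngle_of_mem_Ioo hP hx j (by linarith) (by linarith))
  · exact ⟨2 * n + 1, by push_cast; rw [← heq]; exact hA⟩
  · exfalso
    -- On the plane `-blackRefl` sends an angle `χ` to `2φ - χ`, which carries the open upper half
    -- into the empty cone.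
    obtain ⟨k, hk⟩ := T.exists_root_eq_blackRefl j
    obtain ⟨l, hl⟩ := exists_neg_root (P := P) k
    have h3 := (hAj.conj).mul_exp (2 * φ)
    have h4 : T.planeMap x φ (P.root l) = Complex.exp ((2 * φ : ℝ) * Complex.I) *
        starRingEnd ℂ (T.planeMap x φ (P.root j)) := by
      rw [hl, hk, map_neg, T.planeMap_blackRefl hP hx, neg_neg]
    rw [← h4] at h3
    exact T.not_hasAngle_of_mem_Ioo hP hx l (by linarith) (by linarith) h3

end RootAngles

end Data

namespace Data

/-! ### The order of the Coxeter element and the Coxeter number -/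

section Coxeter

variable {r : ℕ} {ι N : Type*} [AddCommGroup N] [Module ℝ N]
  {P : RootPairing ι ℝ (E r) N} {b : P.Base} (T : Data P b) [P.IsRootSystem]
  {x : b.support → ℝ} {φ : ℝ}

open Classical in
/-- The sum `∑ (α, v) α` over the roots `α` whose projection has the angle `t φ`. -/
def angleSum [Fintype ι] (x : b.support → ℝ) (φ : ℝ) (t : ℕ) (v : E r) : E r :=
  ∑ i with HasAngle (T.planeMap x φ (P.root i)) (t * φ), inner ℝ (P.root i) v • P.root i

variable [Fintype ι]

/-- The roots at angle `0` are exactly the white simple ones, whose projections `whiteRefl`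
subtracts. -/
theorem angleSum_zero (hP : IsSimplyLaced P) (hx : IsPerron b x φ) (v : E r) :
    T.angleSum x φ 0 v = v - T.whiteRefl v := by
  classical
  rw [T.whiteRefl_apply hP, sub_sub_cancel, angleSum]
  symm
  refine Finset.sum_nbij (fun a => (a : ι)) (fun a ha => ?_) (fun a _ c _ h => Subtype.ext h)
    (fun i hi => ?_) (fun a _ => rfl)
  · simpa using T.hasAngle_white hx ha
  · obtain ⟨a, ha, rfl⟩ := T.eq_white_of_hasAngle_zero hP hx (i := i) (by simpa using hi)
    exact ⟨a, ha, rfl⟩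

theorem angleSum_one (hP : IsSimplyLaced P) (hx : IsPerron b x φ) (v : E r) :
    T.angleSum x φ 1 v = v - T.blackRefl v := by
  classical
  rw [T.blackRefl_apply hP, sub_sub_cancel, angleSum]
  symm
  have hr : ∀ a : ι, P.root (P.reflectionPerm a a) = -P.root a := fun a => by
    rw [P.root_reflectionPerm, P.reflection_apply_self]
  refine Finset.sum_nbij (fun a => P.reflectionPerm a (a : ι)) (fun a ha => ?_)
    (fun a _ c _ h => ?_) (fun i hi => ?_) (fun a _ => ?_)
  · have := T.hasAngle_neg_black hx ha
    rw [← hr] at this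
    simpa using this
  · have := congrArg P.root h
    simp only [hr, neg_inj] at this
    exact Subtype.ext (P.root.injective this)
  · obtain ⟨a, ha, hia⟩ := T.eq_neg_black_of_hasAngle hP hx (i := i) (by simpa using hi)
    exact ⟨a, ha, P.root.injective ((hr a).trans hia.symm)⟩
  · rw [hr, inner_neg_left, neg_smul_neg]

theorem angleSum_add_two (hP : IsSimplyLaced P) (hx : IsPerron b x φ) (t : ℕ) (v : E r) :
    T.angleSum x φ (t + 2) v = T.w (T.angleSum x φ t (T.w⁻¹ v)) := by
  classical
  choose σ hσ using T.exists_root_eq_w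
  choose τ hτ using T.exists_root_eq_w_inv hP
  rw [angleSum, angleSum, map_sum]
  symm
  refine Finset.sum_nbij' σ τ (fun i hi => ?_) (fun i hi => ?_) (fun i _ => ?_) (fun i _ => ?_)
    (fun i _ => ?_)
  · simp only [Finset.mem_filter, Finset.mem_univ, true_and] at hi ⊢
    rw [hσ]
    have := T.hasAngle_w_zpow hP hx hi 1
    rw [zpow_one] at this
    convert this using 1
    push_cast; ring
  · simp only [Finset.mem_filter, Finset.mem_univ, true_and] at hi ⊢
    rw [hτ]
    have := T.hasAngle_w_zpow hP hx hi (-1)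
    rw [zpow_neg_one] at this
    convert this using 1
    push_cast; ring
  · exact P.root.injective (by rw [hτ, hσ, w_inv_w])
  · exact P.root.injective (by rw [hσ, hτ, w_w_inv])
  · rw [map_smul, hσ, T.inner_w hP]

/-- Conjugation by `w` advances the angle by `2φ`, so everything follows from the two edges `t = 0`
and `t = 1` of the empty cone. Thus `w ^ t` times `whiteRefl` is the dihedral reflection attached to
the angle `tφ`. -/
theorem angleSum_eq (hP : IsSimplyLaced P) (hx : IsPerron b x φ) (t : ℕ) (v : E r) :
    T.angleSum x φ t v = v - (T.w ^ t) (T.whiteRefl v) := by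
  induction t using Nat.strongRec generalizing v with
  | ind t ih =>
    match t with
    | 0 => exact T.angleSum_zero hP hx v
    | 1 => rw [T.angleSum_one hP hx, pow_one, w_apply, T.whiteRefl_whiteRefl hP]
    | t + 2 =>
      have h : T.whiteRefl (T.w⁻¹ v) = T.w (T.whiteRefl v) := by
        rw [T.w_inv_apply hP, T.whiteRefl_whiteRefl hP, w_apply, T.whiteRefl_whiteRefl hP]
      rw [T.angleSum_add_two hP hx, ih t (by omega), map_sub, w_w_inv, h, pow_succ', pow_succ]
      rfl

/-- Negation exchanges the roots at the angles `0` and `π` and preserves each summand. -/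
theorem angleSum_add_of_mul_eq_pi (x : b.support → ℝ) {m : ℕ} (hm : m * φ = Real.pi) (v : E r) :
    T.angleSum x φ m v = T.angleSum x φ 0 v := by
  classical
  have hr : ∀ a : ι, P.root (P.reflectionPerm a a) = -P.root a := fun a => by
    rw [P.root_reflectionPerm, P.reflection_apply_self]
  rw [angleSum, angleSum]
  refine Finset.sum_nbij' (fun i => P.reflectionPerm i i) (fun i => P.reflectionPerm i i)
    (fun i hi => ?_) (fun i hi => ?_) (fun i _ => P.indexNeg.neg_neg i)
    (fun i _ => P.indexNeg.neg_neg i) (fun i _ => ?_)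
  · simp only [Finset.mem_filter, Finset.mem_univ, true_and] at hi ⊢
    rw [hr, map_neg]
    convert (hi.add_two_pi_mul_int (-1)).neg using 1
    rw [hm]; push_cast; ring
  · simp only [Finset.mem_filter, Finset.mem_univ, true_and] at hi ⊢
    rw [hr, map_neg]
    convert hi.neg using 1
    rw [hm]; push_cast; ring
  · rw [hr, inner_neg_left, neg_smul_neg]

theorem w_pow_eq_one_of_mul_eq_pi (hP : IsSimplyLaced P) (hx : IsPerron b x φ) {m : ℕ}
    (hm : m * φ = Real.pi) : T.w ^ m = 1 := by
  ext1 v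
  have h := T.angleSum_add_of_mul_eq_pi x hm (T.whiteRefl v)
  rw [T.angleSum_eq hP hx, T.angleSum_eq hP hx, T.whiteRefl_whiteRefl hP, sub_right_inj] at h
  rw [h]; rfl

-- The sum is invariant under `w`, which has no nonzero fixed vector.
omit [Fintype ι] in
theorem sum_w_pow_eq_zero (hP : IsSimplyLaced P) {n : ℕ} (hn : T.w ^ n = 1) (v : E r) :
    ∑ t ∈ Finset.range n, (T.w ^ t) v = 0 := by
  refine T.eq_zero_of_w_eq hP ?_
  have h := Finset.sum_range_succ (fun t => (T.w ^ t) v) n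
  rw [Finset.sum_range_succ', hn] at h
  have h' := add_right_cancel h
  rw [map_sum, ← h']
  exact Finset.sum_congr rfl fun t _ => by rw [pow_succ']; rfl

/-- Every root has exactly one angle `tφ` with `0 ≤ t < 2m`, so the angles partition the roots. -/
theorem sum_angleSum (hP : IsSimplyLaced P) (hx : IsPerron b x φ) {m : ℕ} (hm0 : 0 < m)
    (hm : m * φ = Real.pi) (v : E r) :
    ∑ t ∈ Finset.range (2 * m), T.angleSum x φ t v = ∑ i, inner ℝ (P.root i) v • P.root i := by
  classical
  have h2m : (0 : ℤ) < 2 * m := by positivity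
  have hmφ : ∀ k : ℤ, 2 * Real.pi * k = 2 * m * k * φ := fun k => by rw [← hm]; ring
  have hex : ∀ i, ∃ t ∈ Finset.range (2 * m), HasAngle (T.planeMap x φ (P.root i)) (t * φ) := by
    intro i
    obtain ⟨s, hs⟩ := T.exists_int_hasAngle hP hx i
    have h0 := Int.emod_nonneg s h2m.ne'
    have h1 := Int.emod_lt_of_pos s h2m
    refine ⟨(s % (2 * m)).toNat, Finset.mem_range.2 (by omega), ?_⟩
    have h3 := hs.add_two_pi_mul_int (-(s / (2 * m)))
    rw [hmφ] at h3
    convert h3 using 1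
    have h4 : (((s % (2 * m)).toNat : ℕ) : ℝ) = (((s % (2 * m)) : ℤ) : ℝ) := by
      rw [← Int.cast_natCast, Int.toNat_of_nonneg h0]
    rw [h4, Int.emod_def]
    push_cast; ring
  choose τ hτ hτ' using hex
  have huniq : ∀ i, ∀ t ∈ Finset.range (2 * m),
      HasAngle (T.planeMap x φ (P.root i)) (t * φ) ↔ τ i = t := by
    intro i t ht
    refine ⟨fun h => ?_, fun h => h ▸ hτ' i⟩
    obtain ⟨n, hn⟩ := (hτ' i).eq_add h
    rw [hmφ, ← add_mul] at hn
    have hn' := mul_right_cancel₀ hx.angle_pos.ne' hn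
    have hn2 : (τ i : ℤ) = t + 2 * m * n := by exact_mod_cast hn'
    have a1 := Finset.mem_range.1 ht
    have a2 := Finset.mem_range.1 (hτ i)
    have a3 : n = 0 := by
      by_contra h0
      rcases lt_or_gt_of_ne h0 with h0 | h0
      · nlinarith
      · nlinarith
    rw [a3] at hn2
    omega
  rw [← Finset.sum_fiberwise_of_maps_to (g := τ) (t := Finset.range (2 * m)) (fun i _ => hτ i)]
  refine Finset.sum_congr rfl fun t ht => ?_
  rw [angleSum]
  refine Finset.sum_congr ?_ fun _ _ => rfl
  ext i
  simp only [Finset.mem_filter, Finset.mem_univ, true_and]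
  exact huniq i t ht

/-- Apply the partition by angles to `α₀` and pair with `α₀`: one side is `2m · 2`, the other `∑ (α,
α₀)² = 4h`. -/
theorem eq_h_of_mul_eq_pi [P.IsCrystallographic] [P.IsReduced] (hP : IsSimplyLaced P)
    (hx : IsPerron b x φ) {m : ℕ} (hm0 : 0 < m) (hm : m * φ = Real.pi) : m = T.h := by
  have h1 := T.sum_angleSum hP hx hm0 hm (P.root T.lowest)
  simp only [T.angleSum_eq hP hx, Finset.sum_sub_distrib] at h1
  rw [T.sum_w_pow_eq_zero hP (by rw [mul_comm, pow_mul, T.w_pow_eq_one_of_mul_eq_pi hP hx hm,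
    one_pow]), sub_zero, Finset.sum_const, Finset.card_range, ← Nat.cast_smul_eq_nsmul ℝ] at h1
  have h2 := congrArg (fun v => (inner ℝ v (P.root T.lowest) : ℝ)) h1
  simp only [inner_smul_left, sum_inner, inner_root_self hP, RCLike.conj_to_real] at h2
  have h3 := T.sum_inner_lowest_sq hP
  simp only [sq] at h3
  rw [h3] at h2
  push_cast at h2
  have h4 : (m : ℝ) = T.h := by linarith
  exact_mod_cast h4

end Coxeter

/-! ### Existence of the spin-1 projection -/

section Existence

variable {r : ℕ} {ι N : Type*} [Finite ι] [AddCommGroup N] [Module ℝ N]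
  {P : RootPairing ι ℝ (E r) N} {b : P.Base} (T : Data P b) [P.IsRootSystem]
  [P.IsCrystallographic] [P.IsReduced] [P.IsIrreducible]

theorem nonempty_support (P : RootPairing ι ℝ (E r) N) [P.IsRootSystem] [P.IsIrreducible]
    (b : P.Base) : Nonempty b.support := by
  have hnt : Nontrivial (E r) := RootPairing.IsIrreducible.nontrivial P
  by_contra hemp
  rw [not_nonempty_iff] at hemp
  have : Subsingleton (E r) := b.toWeightBasis.repr.toEquiv.subsingleton
  exact not_subsingleton (E r) this

theorem exists_isPerron_h (hP : IsSimplyLaced P) : ∃ x φ, IsPerron b x φ ∧ T.h * φ = Real.pi := by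
  have := Fintype.ofFinite ι
  obtain ⟨x, φ, hx⟩ := exists_isPerron hP b
  have := nonempty_support P b
  obtain ⟨m, hm0, hm⟩ := T.exists_nat_mul_angle_eq_pi hP hx
  exact ⟨x, φ, hx, by rw [← T.eq_h_of_mul_eq_pi hP hx hm0 hm]; exact hm⟩

/-- The order of the Coxeter element divides the Coxeter number. -/
theorem w_pow_h (hP : IsSimplyLaced P) : T.w ^ T.h = 1 := by
  have := Fintype.ofFinite ι
  obtain ⟨x, φ, hx, hm⟩ := T.exists_isPerron_h hP
  exact T.w_pow_eq_one_of_mul_eq_pi hP hx hm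

theorem exists_isSpinOneProjection (hP : IsSimplyLaced P) :
    ∃ π : E r →ₗ[ℝ] ℂ, T.IsSpinOneProjection π := by
  obtain ⟨x, φ, hx, hm⟩ := T.exists_isPerron_h hP
  have hh : (T.h : ℝ) ≠ 0 := by
    intro h; rw [h, zero_mul] at hm; exact Real.pi_pos.ne hm
  have hφ : φ = Real.pi / T.h := by rw [← hm]; field_simp
  refine ⟨T.planeMap x φ, fun v => ?_, fun a ha => ⟨x a, hx.pos a, ?_⟩,
    fun a ha => ⟨x a, hx.pos a, ?_⟩⟩
  · rw [T.planeMap_w hP hx, hφ]; push_cast; ring_nf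
  · rw [T.gam_white hP (T.mem_white.2 ha), T.planeMap_white (T.mem_white.2 ha)]
  · rw [T.gam_black hP ha, T.planeMap_whiteRefl hP hx, T.planeMap_black ha, map_neg, neg_neg,
      map_mul, Complex.conj_ofReal, conj_exp_mul_I, hφ]
    push_cast; ring_nf

end Existence

end Data

/-! ### Sums over residues modulo `2h` -/

theorem sum_zmod_eq_sum_range {M : Type*} [AddCommMonoid M] (n : ℕ) [NeZero n] (G : ZMod n → M) :
    ∑ t, G t = ∑ j ∈ Finset.range n, G j := by
  refine Finset.sum_nbij' (fun t => t.val) (fun j => (j : ZMod n))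
    (fun t _ => Finset.mem_range.2 t.val_lt) (fun _ _ => Finset.mem_univ _)
    (fun t _ => ZMod.natCast_zmod_val t)
    (fun j hj => ZMod.val_cast_of_lt (Finset.mem_range.1 hj)) (fun t _ => ?_)
  rw [ZMod.natCast_zmod_val]

theorem sum_range_two_mul {M : Type*} [AddCommMonoid M] (n : ℕ) (g : ℕ → M) :
    ∑ j ∈ Finset.range (2 * n), g j = ∑ p ∈ Finset.range n, (g (2 * p + 1) + g (2 * p)) := by
  induction n with
  | zero => simp
  | succ n ih =>
    rw [show 2 * (n + 1) = 2 * n + 1 + 1 by ring, Finset.sum_range_succ, Finset.sum_range_succ, ih,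
      Finset.sum_range_succ, add_assoc, add_comm (g (2 * n))]

/-- The residues are paired as `2p` and `2p - 1` because white orbits occupy the even positions and
black orbits the odd ones. -/
theorem sum_zmod_two_mul {M : Type*} [AddCommMonoid M] (n : ℕ) [NeZero (2 * n)]
    (G : ZMod (2 * n) → M) :
    ∑ t, G t = ∑ p ∈ Finset.range n, (G (2 * p) + G (2 * p - 1)) := by
  rw [← (Equiv.subRight (1 : ZMod (2 * n))).sum_comp G, sum_zmod_eq_sum_range, sum_range_two_mul]
  refine Finset.sum_congr rfl fun p _ => ?_
  simp

namespace Data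

/-! ### Coxeter orbits and their positions in `ℤ / 2h` -/

section Positions

variable {r : ℕ} {ι N : Type*} [Finite ι] [AddCommGroup N] [Module ℝ N]
  {P : RootPairing ι ℝ (E r) N} {b : P.Base} (T : Data P b)

theorem h_pos : 0 < T.h := by rw [h]; omega

instance : NeZero (2 * T.h) := ⟨by have := T.h_pos; omega⟩

/-- The angle of the projection of a root in units of `π / h`, modulo `2h`. -/
def pos (π : E r →ₗ[ℝ] ℂ) (y : E r) : ZMod (2 * T.h) := (⌊T.u π y⌋ : ℤ)

/-- The power of the Coxeter element with exponent in `ℤ / 2h`. -/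
def wz (t : ZMod (2 * T.h)) : E r ≃ₗ[ℝ] E r := T.w ^ t.val

variable [P.IsRootSystem] [P.IsCrystallographic] [P.IsReduced] [P.IsIrreducible]

theorem w_pow_two_mul_h (hP : IsSimplyLaced P) : T.w ^ (2 * T.h) = 1 := by
  rw [mul_comm, pow_mul, T.w_pow_h hP, one_pow]

theorem wz_intCast (hP : IsSimplyLaced P) (k : ℤ) : T.wz k = T.w ^ k := by
  have h1 : (((k : ZMod (2 * T.h)).val : ℕ) : ℤ) = k % (2 * T.h : ℕ) := ZMod.val_intCast k
  rw [wz, ← zpow_natCast, h1]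
  conv_rhs => rw [← Int.emod_add_mul_ediv k (2 * T.h : ℕ)]
  rw [zpow_add, zpow_mul, zpow_natCast, T.w_pow_two_mul_h hP, one_zpow, mul_one]

theorem wz_add (hP : IsSimplyLaced P) (s t : ZMod (2 * T.h)) : T.wz (s + t) = T.wz s * T.wz t := by
  obtain ⟨s, rfl⟩ := ZMod.intCast_surjective s
  obtain ⟨t, rfl⟩ := ZMod.intCast_surjective t
  rw [← Int.cast_add, T.wz_intCast hP, T.wz_intCast hP, T.wz_intCast hP, zpow_add]

theorem wz_wz (hP : IsSimplyLaced P) (s t : ZMod (2 * T.h)) (v : E r) :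
    T.wz s (T.wz t v) = T.wz (s + t) v := by
  rw [T.wz_add hP]; rfl

theorem wz_zero : T.wz 0 = 1 := by rw [wz, ZMod.val_zero, pow_zero]

theorem wz_one (hP : IsSimplyLaced P) : T.wz 1 = T.w := by
  have := T.wz_intCast hP 1
  rwa [Int.cast_one, zpow_one] at this

theorem inner_wz (hP : IsSimplyLaced P) (t : ZMod (2 * T.h)) (x y : E r) :
    inner ℝ (T.wz t x) y = (inner ℝ x (T.wz (-t) y) : ℝ) := by
  have h1 : ∀ (k : ℕ) (x y : E r), (inner ℝ ((T.w ^ k) x) ((T.w ^ k) y) : ℝ) = inner ℝ x y := by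
    intro k
    induction k with
    | zero => intro x y; rfl
    | succ k ih =>
      intro x y
      rw [pow_succ, LinearEquiv.mul_apply, LinearEquiv.mul_apply, ih, T.inner_w_w hP]
  have h2 : y = T.wz t (T.wz (-t) y) := by
    rw [← LinearEquiv.mul_apply, ← T.wz_add hP, add_neg_cancel, wz_zero]; rfl
  conv_lhs => rw [h2, wz, h1]

theorem whiteRefl_wz (hP : IsSimplyLaced P) (t : ZMod (2 * T.h)) (x : E r) :
    T.whiteRefl (T.wz t x) = T.wz (-t) (T.whiteRefl x) := by
  have h1 : ∀ (k : ℕ) (x : E r), T.whiteRefl ((T.w ^ k) x) = (T.w⁻¹ ^ k) (T.whiteRefl x) := by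
    intro k
    induction k with
    | zero => intro x; rfl
    | succ k ih =>
      intro x
      rw [pow_succ, LinearEquiv.mul_apply, ih, T.whiteRefl_w hP, ← LinearEquiv.mul_apply,
        ← pow_succ]
  have h2 : T.wz (-t) = T.w⁻¹ ^ t.val := by
    have h3 : -t = ((-(t.val : ℤ) : ℤ) : ZMod (2 * T.h)) := by
      rw [Int.cast_neg, Int.cast_natCast, ZMod.natCast_zmod_val]
    rw [h3, T.wz_intCast hP, zpow_neg, zpow_natCast, inv_pow]
  rw [h2, wz, h1]

theorem sum_wz (hP : IsSimplyLaced P) (v : E r) : ∑ t, T.wz t v = 0 := by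
  rw [sum_zmod_eq_sum_range, ← T.sum_w_pow_eq_zero hP (T.w_pow_two_mul_h hP) v]
  refine Finset.sum_congr rfl fun j hj => ?_
  rw [wz, ZMod.val_cast_of_lt (Finset.mem_range.1 hj)]

/-- The operator `∑_{j < 2h} j w^j` inverts `(w - 1) / 2h`. -/
theorem sum_val_smul_wz (hP : IsSimplyLaced P) (v : E r) :
    ∑ t, (t.val : ℝ) • T.wz t (T.w v - v) = (2 * T.h : ℝ) • v := by
  have hn : 0 < 2 * T.h := Nat.pos_of_ne_zero (NeZero.ne _)
  -- Abel summation: `j w^{j+1} = (j + 1) w^{j+1} - w^{j+1}`. The first part telescopes to `2h`, as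
  -- `w ^ (2h) = 1`; the rest sums to zero.
  have h1 : ∑ t, (t.val : ℝ) • T.wz t (T.w v - v) =
      ∑ j ∈ Finset.range (2 * T.h),
        (((j + 1 : ℕ) : ℝ) • (T.w ^ (j + 1)) v - (j : ℝ) • (T.w ^ j) v) -
      ∑ j ∈ Finset.range (2 * T.h), (T.w ^ (j + 1)) v := by
    rw [sum_zmod_eq_sum_range, ← Finset.sum_sub_distrib]
    refine Finset.sum_congr rfl fun j hj => ?_
    rw [wz, ZMod.val_cast_of_lt (Finset.mem_range.1 hj), map_sub, pow_succ, LinearEquiv.mul_apply]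
    push_cast
    module
  rw [h1, Finset.sum_range_sub (fun j => (j : ℝ) • (T.w ^ j) v), T.w_pow_two_mul_h hP]
  have h2 : ∑ j ∈ Finset.range (2 * T.h), (T.w ^ (j + 1)) v = 0 := by
    rw [← T.sum_w_pow_eq_zero hP (T.w_pow_two_mul_h hP) (T.w v)]
    exact Finset.sum_congr rfl fun j _ => by rw [pow_succ]; rfl
  rw [h2]
  simp

variable {π : E r →ₗ[ℝ] ℂ}

theorem pi_div_h_ne_zero : Real.pi / T.h ≠ 0 :=
  div_ne_zero Real.pi_pos.ne' (by exact_mod_cast T.h_pos.ne')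

theorem exists_u_eq {y : E r} {k : ℤ} (hy : HasAngle (π y) (Real.pi / T.h * k)) :
    ∃ m : ℤ, T.u π y = m ∧ (m : ZMod (2 * T.h)) = k := by
  obtain ⟨n, hn⟩ := (HasAngle.arg hy.ne_zero).eq_add hy
  have hh : (T.h : ℝ) ≠ 0 := by exact_mod_cast T.h_pos.ne'
  have hpi := Real.pi_pos.ne'
  refine ⟨k + (2 * T.h : ℕ) * n, ?_, ?_⟩
  · rw [u, hn]; push_cast; field_simp
  · push_cast
    have : ((2 * T.h : ℕ) : ZMod (2 * T.h)) = 0 := ZMod.natCast_self _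
    push_cast at this
    rw [this, zero_mul, add_zero]

/-- At such angles `u` is an integer, so the floor in `pos` loses nothing, and reduction modulo `2h`
removes the dependence on the branch of `arg`. -/
theorem u_eq_and_pos_eq {y : E r} {k : ℤ} (hy : HasAngle (π y) (Real.pi / T.h * k)) :
    T.u π y = (⌊T.u π y⌋ : ℤ) ∧ T.pos π y = k := by
  obtain ⟨m, h1, h2⟩ := T.exists_u_eq hy
  rw [pos, h1, Int.floor_intCast]
  exact ⟨rfl, h2⟩

theorem hasAngle_w (hπ : T.IsSpinOneProjection π) {y : E r} {k : ℤ}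
    (hy : HasAngle (π y) (Real.pi / T.h * k)) :
    HasAngle (π (T.w y)) (Real.pi / T.h * (k + 2 : ℤ)) := by
  rw [hπ.map_w]
  convert hy.mul_exp (2 * Real.pi / T.h) using 1
  · congr 1; push_cast; ring_nf
  · push_cast; ring

theorem hasAngle_w_inv (hπ : T.IsSpinOneProjection π) {y : E r} {k : ℤ}
    (hy : HasAngle (π y) (Real.pi / T.h * k)) :
    HasAngle (π (T.w⁻¹ y)) (Real.pi / T.h * (k - 2 : ℤ)) := by
  have h1 := hπ.map_w (T.w⁻¹ y)
  rw [w_w_inv] at h1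
  have h2 : π (T.w⁻¹ y) = Complex.exp ((-(2 * Real.pi / T.h) : ℝ) * Complex.I) * π y := by
    rw [h1, ← mul_assoc, ← Complex.exp_add]
    push_cast
    rw [show (-(2 * (Real.pi : ℂ) / T.h) * Complex.I + 2 * Real.pi * Complex.I / T.h) = 0 by ring,
      Complex.exp_zero, one_mul]
  rw [h2]
  convert hy.mul_exp (-(2 * Real.pi / T.h)) using 1
  push_cast; ring

/-- The angle of `γ_a`, in units of `π / h`. -/
def gamPos (a : b.support) : ℤ := open Classical in if a ∈ T.black then -1 else 0

theorem hasAngle_gam (hπ : T.IsSpinOneProjection π) (a : b.support) :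
    HasAngle (π (T.gam a)) (Real.pi / T.h * T.gamPos a) := by
  classical
  by_cases ha : a ∈ T.black
  · obtain ⟨t, ht, h⟩ := hπ.black_angle a ha
    refine ⟨t, ht, ?_⟩
    rw [h, gamPos, if_pos ha]; push_cast; ring_nf
  · obtain ⟨t, ht, h⟩ := hπ.white_angle a ha
    refine ⟨t, ht, ?_⟩
    rw [h, gamPos, if_neg ha]; simp

theorem hasAngle_w_pow (hπ : T.IsSpinOneProjection π) {y : E r} {k : ℤ}
    (hy : HasAngle (π y) (Real.pi / T.h * k)) (q : ℕ) :
    HasAngle (π ((T.w ^ q) y)) (Real.pi / T.h * (k + 2 * q : ℤ)) := by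
  induction q with
  | zero => simpa using hy
  | succ q ih =>
    rw [pow_succ', LinearEquiv.mul_apply]
    convert T.hasAngle_w hπ ih using 2
    push_cast; ring

theorem hasAngle_w_inv_pow (hπ : T.IsSpinOneProjection π) {y : E r} {k : ℤ}
    (hy : HasAngle (π y) (Real.pi / T.h * k)) (q : ℕ) :
    HasAngle (π ((T.w⁻¹ ^ q) y)) (Real.pi / T.h * (k - 2 * q : ℤ)) := by
  induction q with
  | zero => simpa using hy
  | succ q ih =>
    rw [pow_succ', LinearEquiv.mul_apply]
    convert T.hasAngle_w_inv hπ ih using 2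
    push_cast; ring

theorem mem_orbit {a : b.support} {y : E r} :
    y ∈ T.orbit a ↔ ∃ q < T.h, (T.w⁻¹ ^ q) (T.gam a) = y := by simp [orbit]

theorem gam_mem_orbit (a : b.support) : T.gam a ∈ T.orbit a :=
  T.mem_orbit.2 ⟨0, T.h_pos, rfl⟩

theorem exists_hasAngle_of_mem_orbit (hπ : T.IsSpinOneProjection π) {a : b.support} {y : E r}
    (hy : y ∈ T.orbit a) : ∃ k : ℤ, HasAngle (π y) (Real.pi / T.h * k) := by
  obtain ⟨q, -, rfl⟩ := T.mem_orbit.1 hy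
  exact ⟨_, T.hasAngle_w_inv_pow hπ (T.hasAngle_gam hπ a) q⟩

theorem u_eq_floor (hπ : T.IsSpinOneProjection π) {a : b.support} {y : E r}
    (hy : y ∈ T.orbit a) : T.u π y = (⌊T.u π y⌋ : ℤ) := by
  obtain ⟨k, hk⟩ := T.exists_hasAngle_of_mem_orbit hπ hy
  exact (T.u_eq_and_pos_eq hk).1

theorem pos_w_pow (hπ : T.IsSpinOneProjection π) {y : E r} {k : ℤ}
    (hy : HasAngle (π y) (Real.pi / T.h * k)) (q : ℕ) :
    T.pos π ((T.w ^ q) y) = T.pos π y + 2 * q := by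
  rw [(T.u_eq_and_pos_eq (T.hasAngle_w_pow hπ hy q)).2, (T.u_eq_and_pos_eq hy).2]
  push_cast; ring

theorem pos_w_inv_pow (hπ : T.IsSpinOneProjection π) {y : E r} {k : ℤ}
    (hy : HasAngle (π y) (Real.pi / T.h * k)) (q : ℕ) :
    T.pos π ((T.w⁻¹ ^ q) y) = T.pos π y - 2 * q := by
  rw [(T.u_eq_and_pos_eq (T.hasAngle_w_inv_pow hπ hy q)).2, (T.u_eq_and_pos_eq hy).2]
  push_cast; ring

theorem w_mem_orbit (hP : IsSimplyLaced P) {a : b.support} {y : E r} (hy : y ∈ T.orbit a) :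
    T.w y ∈ T.orbit a := by
  obtain ⟨q, hq, rfl⟩ := T.mem_orbit.1 hy
  rcases Nat.eq_zero_or_pos q with rfl | h0
  · refine T.mem_orbit.2 ⟨T.h - 1, by omega, ?_⟩
    have h1 : T.w⁻¹ ^ (T.h - 1) = T.w := by
      have h2 : T.w⁻¹ ^ (T.h - 1) * T.w⁻¹ = 1 := by
        rw [← pow_succ, Nat.sub_add_cancel T.h_pos, inv_pow, T.w_pow_h hP, inv_one]
      exact (eq_inv_of_mul_eq_one_left h2).trans (inv_inv _)
    rw [h1]; rfl
  · refine T.mem_orbit.2 ⟨q - 1, by omega, ?_⟩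
    obtain ⟨q, rfl⟩ : ∃ q', q = q' + 1 := ⟨q - 1, by omega⟩
    rw [pow_succ' _ q, LinearEquiv.mul_apply, w_w_inv]; rfl

theorem w_inv_mem_orbit (hP : IsSimplyLaced P) {a : b.support} {y : E r} (hy : y ∈ T.orbit a) :
    T.w⁻¹ y ∈ T.orbit a := by
  have h : ∀ k : ℕ, (T.w ^ k) y ∈ T.orbit a := by
    intro k
    induction k with
    | zero => exact hy
    | succ k ih => rw [pow_succ']; exact T.w_mem_orbit hP ih
  have h2 : T.w⁻¹ = T.w ^ (T.h - 1) := by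
    refine (eq_inv_of_mul_eq_one_left ?_).symm
    rw [← pow_succ, Nat.sub_add_cancel T.h_pos, T.w_pow_h hP]
  rw [h2]; exact h _

theorem sum_orbit_w (hP : IsSimplyLaced P) {M : Type*} [AddCommMonoid M] (a : b.support)
    (f : E r → M) : ∑ β ∈ T.orbit a, f (T.w β) = ∑ β ∈ T.orbit a, f β :=
  Finset.sum_nbij' T.w T.w.symm (fun _ h => T.w_mem_orbit hP h)
    (fun _ h => T.w_inv_mem_orbit hP h) (fun _ _ => T.w_inv_w _) (fun _ _ => T.w_w_inv _)
    (fun _ _ => rfl)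

theorem sum_orbit_w_inv_pow (hP : IsSimplyLaced P) {M : Type*} [AddCommMonoid M] (a : b.support)
    (f : E r → M) (q : ℕ) : ∑ β ∈ T.orbit a, f ((T.w⁻¹ ^ q) β) = ∑ β ∈ T.orbit a, f β := by
  induction q with
  | zero => rfl
  | succ q ih =>
    rw [← ih, ← T.sum_orbit_w hP a fun β => f ((T.w⁻¹ ^ (q + 1)) β)]
    refine Finset.sum_congr rfl fun β _ => ?_
    rw [pow_succ, LinearEquiv.mul_apply, w_inv_w]

/-- The `h` angles differ modulo `2π`, so the image defining the orbit merges no two terms. -/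
theorem sum_orbit (hπ : T.IsSpinOneProjection π) {M : Type*} [AddCommMonoid M] (a : b.support)
    (f : E r → M) :
    ∑ β ∈ T.orbit a, f β = ∑ q ∈ Finset.range T.h, f ((T.w⁻¹ ^ q) (T.gam a)) := by
  classical
  rw [orbit, Finset.sum_image]
  intro p hp q hq hpq
  obtain ⟨n, hn⟩ := (T.hasAngle_w_inv_pow hπ (T.hasAngle_gam hπ a) p).eq_add
    (by rw [show (T.w⁻¹ ^ p) (T.gam a) = _ from hpq]
        exact T.hasAngle_w_inv_pow hπ (T.hasAngle_gam hπ a) q)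
  have hp' : p < T.h := by simpa using hp
  have hq' : q < T.h := by simpa using hq
  have hh : (T.h : ℝ) ≠ 0 := by exact_mod_cast T.h_pos.ne'
  have h1 : (2 * Real.pi * n : ℝ) = Real.pi / T.h * (2 * T.h * n) := by field_simp
  rw [h1, ← mul_add] at hn
  have h2 := mul_left_cancel₀ T.pi_div_h_ne_zero hn
  have h3 : T.gamPos a - 2 * (p : ℤ) = T.gamPos a - 2 * q + 2 * T.h * n := by exact_mod_cast h2
  have h4 : n = 0 := by
    by_contra h0
    rcases lt_or_gt_of_ne h0 with h0 | h0
    · nlinarith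
    · nlinarith
  rw [h4] at h3
  omega

/-- The sum over a Coxeter orbit vanishes. -/
theorem sum_orbit_eq_zero (hP : IsSimplyLaced P) (a : b.support) : ∑ β ∈ T.orbit a, β = 0 := by
  refine T.eq_zero_of_w_eq hP ?_
  rw [map_sum]
  exact T.sum_orbit_w hP a fun β => β

/-- Every root of a Coxeter orbit is inverted by the reflection of the dihedral group that
belongs to its angle. -/
theorem wz_pos_whiteRefl (hP : IsSimplyLaced P) (hπ : T.IsSpinOneProjection π) {a : b.support}
    {y : E r} (hy : y ∈ T.orbit a) : T.wz (T.pos π y) (T.whiteRefl y) = -y := by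
  classical
  obtain ⟨q, -, rfl⟩ := T.mem_orbit.1 hy
  -- It suffices to treat `γ_a`; the dihedral relation carries the identity along the orbit.
  have h0 : T.wz (T.pos π (T.gam a)) (T.whiteRefl (T.gam a)) = -T.gam a := by
    rw [(T.u_eq_and_pos_eq (T.hasAngle_gam hπ a)).2, T.wz_intCast hP, gamPos]
    by_cases ha : a ∈ T.black
    · rw [if_pos ha, zpow_neg_one, T.gam_black hP ha, T.whiteRefl_whiteRefl hP, T.w_inv_apply hP,
        T.blackRefl_root hP ha, map_neg]
    · have ha' := T.mem_white.2 ha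
      rw [if_neg ha, zpow_zero, T.gam_white hP ha', T.whiteRefl_root hP ha']; rfl
  have h1 : T.w⁻¹ ^ q = T.wz (-q : ZMod (2 * T.h)) := by
    have : (-q : ZMod (2 * T.h)) = ((-(q : ℤ) : ℤ) : ZMod (2 * T.h)) := by push_cast; rfl
    rw [this, T.wz_intCast hP, zpow_neg, zpow_natCast, inv_pow]
  rw [T.pos_w_inv_pow hπ (T.hasAngle_gam hπ a), h1, T.whiteRefl_wz hP, ← map_neg, ← h0,
    T.wz_wz hP, T.wz_wz hP]
  congr 2
  ring

end Positions

end Data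

namespace Data

/-! ### Completeness relations for the Coxeter orbits -/

section Completeness

variable {r : ℕ} {ι N : Type*} [Finite ι] [AddCommGroup N] [Module ℝ N]
  {P : RootPairing ι ℝ (E r) N} {b : P.Base} (T : Data P b)
  [P.IsRootSystem] [P.IsCrystallographic] [P.IsReduced] [P.IsIrreducible]
  {π : E r →ₗ[ℝ] ℂ}

theorem sum_white_inner_mul (hP : IsSimplyLaced P) (x y : E r) :
    ∑ e ∈ T.white, (inner ℝ (P.root e) x * inner ℝ (P.root e) y : ℝ) =
      inner ℝ x y - inner ℝ (T.whiteRefl x) y := by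
  rw [T.whiteRefl_apply hP, inner_sub_left, sub_sub_cancel, sum_inner]
  simp [inner_smul_left]

theorem sum_black_inner_mul (hP : IsSimplyLaced P) (x y : E r) :
    ∑ e ∈ T.black, (inner ℝ (P.root e) x * inner ℝ (P.root e) y : ℝ) =
      inner ℝ x y - inner ℝ (T.blackRefl x) y := by
  rw [T.blackRefl_apply hP, inner_sub_left, sub_sub_cancel, sum_inner]
  simp [inner_smul_left]

theorem inner_w_pow (hP : IsSimplyLaced P) (q : ℕ) (x y : E r) :
    inner ℝ ((T.w ^ q) x) y = (inner ℝ x (T.wz (-q) y) : ℝ) := by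
  rw [← T.inner_wz hP, ← Int.cast_natCast (R := ZMod (2 * T.h)), T.wz_intCast hP, zpow_natCast]

/-- The projections to the white simple roots sum to `1 - whiteRefl`; conjugation by `w ^ q`
multiplies the reflection by `w ^ (2q)`. -/
theorem sum_white_w_pow (hP : IsSimplyLaced P) (q : ℕ) (x y : E r) :
    ∑ e ∈ T.white, (inner ℝ ((T.w ^ q) (T.gam e)) x * inner ℝ ((T.w ^ q) (T.gam e)) y : ℝ) =
      inner ℝ x y - inner ℝ (T.wz (2 * q) (T.whiteRefl x)) y := by
  have h := T.sum_white_inner_mul hP (T.wz (-q) x) (T.wz (-q) y)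
  rw [T.whiteRefl_wz hP, T.inner_wz hP, T.inner_wz hP, T.wz_wz hP, T.wz_wz hP] at h
  rw [T.inner_wz hP (2 * q)]
  simp only [neg_neg, add_neg_cancel, wz_zero] at h
  rw [show (-q + -q : ZMod (2 * T.h)) = -(2 * q) by ring] at h
  refine Eq.trans ?_ h
  refine Finset.sum_congr rfl fun e he => ?_
  rw [T.gam_white hP he, T.inner_w_pow hP, T.inner_w_pow hP]

/-- A black `γ_e` is the white reflection of a simple root, and this extra conjugation of
`blackRefl` produces the odd exponent. -/
theorem sum_black_w_pow (hP : IsSimplyLaced P) (q : ℕ) (x y : E r) :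
    ∑ e ∈ T.black, (inner ℝ ((T.w ^ q) (T.gam e)) x * inner ℝ ((T.w ^ q) (T.gam e)) y : ℝ) =
      inner ℝ x y - inner ℝ (T.wz (2 * q - 1) (T.whiteRefl x)) y := by
  have h := T.sum_black_inner_mul hP (T.whiteRefl (T.wz (-q) x)) (T.whiteRefl (T.wz (-q) y))
  rw [← w_apply, ← T.inner_whiteRefl hP, T.whiteRefl_whiteRefl hP, ← T.inner_whiteRefl hP,
    T.whiteRefl_w hP, T.whiteRefl_wz hP, T.inner_wz hP, T.wz_wz hP] at h
  have h1 : T.w⁻¹ = T.wz (-1) := by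
    have := T.wz_intCast hP (-1)
    rw [zpow_neg_one] at this
    rw [← this]; push_cast; rfl
  rw [h1, T.wz_wz hP, T.inner_wz hP, T.wz_wz hP] at h
  simp only [neg_neg, add_neg_cancel, wz_zero] at h
  rw [T.inner_wz hP (2 * q - 1)]
  rw [show (-(-1 + q) + -q : ZMod (2 * T.h)) = -(2 * q - 1) by ring] at h
  refine Eq.trans ?_ h
  refine Finset.sum_congr rfl fun e he => ?_
  rw [T.gam_black hP he, T.inner_w_pow hP, T.inner_w_pow hP, T.inner_whiteRefl hP,
    T.inner_whiteRefl hP, T.whiteRefl_wz hP (-q) x, neg_neg]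

/-- A weighted completeness relation for the Coxeter orbits. -/
theorem sum_weight_inner_mul (hP : IsSimplyLaced P) (hπ : T.IsSpinOneProjection π)
    (F : ZMod (2 * T.h) → ℂ) (x y : E r) :
    ∑ e, ∑ q ∈ Finset.range T.h, ((inner ℝ ((T.w ^ q) (T.gam e)) x : ℝ) : ℂ) *
        ((inner ℝ ((T.w ^ q) (T.gam e)) y : ℝ) : ℂ) * F (T.pos π ((T.w ^ q) (T.gam e))) =
      ∑ t, ((inner ℝ x y - inner ℝ (T.wz t (T.whiteRefl x)) y : ℝ) : ℂ) * F t := by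
  classical
  rw [Finset.sum_comm, sum_zmod_two_mul]
  refine Finset.sum_congr rfl fun q _ => ?_
  rw [← T.sum_black_add_sum_white, ← T.sum_white_w_pow hP, ← T.sum_black_w_pow hP, add_comm,
    Complex.ofReal_sum, Complex.ofReal_sum, Finset.sum_mul, Finset.sum_mul]
  have hp : ∀ e, T.pos π ((T.w ^ q) (T.gam e)) = T.gamPos e + 2 * q := fun e => by
    rw [T.pos_w_pow hπ (T.hasAngle_gam hπ e), (T.u_eq_and_pos_eq (T.hasAngle_gam hπ e)).2]
  congr 1
  · refine Finset.sum_congr rfl fun e he => ?_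
    rw [hp, gamPos, if_neg (T.mem_white.1 he), Complex.ofReal_mul, Int.cast_zero, zero_add]
  · refine Finset.sum_congr rfl fun e he => ?_
    rw [hp, gamPos, if_pos he, Complex.ofReal_mul, Int.cast_neg, Int.cast_one, neg_add_eq_sub]

theorem sum_inner_sub_inner_wz (hP : IsSimplyLaced P) (x y : E r) :
    ∑ t, (inner ℝ x y - inner ℝ (T.wz t (T.whiteRefl x)) y : ℝ) = 2 * T.h * inner ℝ x y := by
  have h : ∑ t, (inner ℝ (T.wz t (T.whiteRefl x)) y : ℝ) = 0 := by
    rw [← sum_inner, T.sum_wz hP, inner_zero_left]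
  rw [Finset.sum_sub_distrib, h, sub_zero,
    Finset.sum_const, Finset.card_univ, ZMod.card, nsmul_eq_mul]
  push_cast; ring

theorem sum_val_sub {n : ℕ} [NeZero n] (s : ZMod n) :
    ∑ t : ZMod n, ((t - s).val : ℝ) = ∑ t : ZMod n, (t.val : ℝ) :=
  (Equiv.subRight s).sum_comp fun t => (t.val : ℝ)

/-- Shifting the summation by the position `s` of `x` absorbs the reflection, which inverts `x`
there. -/
theorem sum_val_mul_wz_left (hP : IsSimplyLaced P) (s : ZMod (2 * T.h)) {x : E r}
    (hx : T.wz s (T.whiteRefl x) = -x) (y : E r) :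
    ∑ t, ((t - s).val : ℝ) * inner ℝ (T.wz t (T.whiteRefl x)) y =
      -∑ t, (t.val : ℝ) * inner ℝ (T.wz t x) y := by
  rw [← Equiv.sum_comp (Equiv.addRight s), ← Finset.sum_neg_distrib]
  refine Finset.sum_congr rfl fun t _ => ?_
  simp only [Equiv.coe_addRight, add_sub_cancel_right]
  rw [← T.wz_wz hP, hx, map_neg, inner_neg_left, mul_neg]

/-- Each `w ^ t` times `whiteRefl` is self-adjoint, so the same shift can be made on the side of
`y`. -/
theorem sum_val_mul_wz_right (hP : IsSimplyLaced P) (s : ZMod (2 * T.h)) {y : E r}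
    (hy : T.wz s (T.whiteRefl y) = -y) (x : E r) :
    ∑ t, ((t - s).val : ℝ) * inner ℝ (T.wz t (T.whiteRefl x)) y =
      -∑ t, (t.val : ℝ) * inner ℝ x (T.wz t y) := by
  refine (Eq.trans ?_ (T.sum_val_mul_wz_left hP s hy x)).trans ?_
  · refine Finset.sum_congr rfl fun t _ => ?_
    rw [T.inner_wz hP, T.inner_whiteRefl hP, T.whiteRefl_wz hP, neg_neg, real_inner_comm]
  · congr 1
    exact Finset.sum_congr rfl fun t _ => by rw [real_inner_comm]

/-- Since `γ_a = (w - 1) w⁻¹ λ_a`, the operator in `sum_val_smul_wz` returns `w⁻¹ λ_a`. -/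
theorem sum_val_mul_gam_left (hP : IsSimplyLaced P) (a : b.support) (y : E r) :
    ∑ t, (t.val : ℝ) * inner ℝ (T.wz t (T.gam a)) y =
      2 * T.h * inner ℝ (T.w⁻¹ (T.fundWeight a)) y := by
  have h := congrArg (fun v => (inner ℝ v y : ℝ)) (T.sum_val_smul_wz hP (T.w⁻¹ (T.fundWeight a)))
  simp only [w_w_inv, sum_inner, inner_smul_left, RCLike.conj_to_real] at h
  exact h

/-- Moving `1 - w⁻¹` across the scalar product gives `-(λ_a, w^t (w y - y))`, to which
`sum_val_smul_wz` applies. -/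
theorem sum_val_mul_gam_right (hP : IsSimplyLaced P) (a : b.support) (y : E r) :
    ∑ t, (t.val : ℝ) * inner ℝ (T.gam a) (T.wz t y) =
      -(2 * T.h * inner ℝ (T.fundWeight a) y) := by
  have h := congrArg (fun v => (inner ℝ (T.fundWeight a) v : ℝ)) (T.sum_val_smul_wz hP y)
  simp only [inner_sum, inner_smul_right] at h
  rw [← h, ← Finset.sum_neg_distrib]
  refine Finset.sum_congr rfl fun t _ => ?_
  have h1 : T.wz t (T.w y) = T.w (T.wz t y) := by
    rw [← T.wz_one hP, T.wz_wz hP, T.wz_wz hP, add_comm]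
  have h2 : (inner ℝ (T.w⁻¹ (T.fundWeight a)) (T.wz t y) : ℝ) =
      inner ℝ (T.fundWeight a) (T.w (T.wz t y)) := by
    rw [real_inner_comm, ← T.inner_w hP, real_inner_comm]
  rw [map_sub, inner_sub_right, h1, gam, inner_sub_left, h2]; ring

/-- The origin of `(1 + w⁻¹) λ_a`. The part constant in `t` cancels, since both families of
representatives run once through `0, …, 2h - 1`. Counting from the position of `γ_a` yields `w⁻¹
λ_a`, counting from that of `y` yields `λ_a`, and the signs make them add. -/
theorem sum_val_sub_val (hP : IsSimplyLaced P) (hπ : T.IsSpinOneProjection π) (a c : b.support)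
    {y : E r} (hy : y ∈ T.orbit c) :
    ∑ t, (inner ℝ (T.gam a) y - inner ℝ (T.wz t (T.whiteRefl (T.gam a))) y : ℝ) *
        (((t - T.pos π (T.gam a)).val : ℝ) - (t - T.pos π y).val) =
      2 * T.h * T.plusPairing a y := by
  have h1 := T.sum_val_mul_wz_left hP _ (T.wz_pos_whiteRefl hP hπ (T.gam_mem_orbit a)) y
  have h2 := T.sum_val_mul_wz_right hP _ (T.wz_pos_whiteRefl hP hπ hy) (T.gam a)
  rw [T.sum_val_mul_gam_left hP] at h1
  rw [T.sum_val_mul_gam_right hP] at h2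
  have h3 := sum_val_sub (T.pos π (T.gam a))
  have h4 := sum_val_sub (T.pos π y)
  have h5 : ∀ t : ZMod (2 * T.h),
      (inner ℝ (T.gam a) y - inner ℝ (T.wz t (T.whiteRefl (T.gam a))) y : ℝ) *
        (((t - T.pos π (T.gam a)).val : ℝ) - (t - T.pos π y).val) =
      inner ℝ (T.gam a) y * ((t - T.pos π (T.gam a)).val : ℝ) -
      inner ℝ (T.gam a) y * ((t - T.pos π y).val : ℝ) -
      ((t - T.pos π (T.gam a)).val : ℝ) * inner ℝ (T.wz t (T.whiteRefl (T.gam a))) y +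
      ((t - T.pos π y).val : ℝ) * inner ℝ (T.wz t (T.whiteRefl (T.gam a))) y := fun t => by ring
  simp only [h5, Finset.sum_add_distrib, Finset.sum_sub_distrib, ← Finset.mul_sum]
  rw [h1, h2, h3, h4, plusPairing, inner_add_left]
  ring

/-- The sum over the intermediate particles and over pairs of roots in two Coxeter orbits. -/
theorem sum_orbit_orbit (hP : IsSimplyLaced P) (hπ : T.IsSpinOneProjection π) (a c : b.support)
    (C : ZMod (2 * T.h) → ℂ) (x κ : ℂ) :
    ∑ e, ∑ β ∈ T.orbit a, ∑ β' ∈ T.orbit c,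
        ((inner ℝ (T.gam e) β : ℝ) : ℂ) * ((inner ℝ (T.gam e) β' : ℝ) : ℂ) *
          (C (T.pos π β - T.pos π β') * (x + κ * (((T.pos π (T.gam e) - T.pos π β).val : ℂ) -
            (T.pos π (T.gam e) - T.pos π β').val))) =
      2 * T.h * ∑ β' ∈ T.orbit c, C (T.pos π (T.gam a) - T.pos π β') *
        (x * ((inner ℝ (T.gam a) β' : ℝ) : ℂ) + κ * (T.plusPairing a β' : ℂ)) := by
  have h1 : ∀ e, ∑ β ∈ T.orbit a, ∑ β' ∈ T.orbit c,
        ((inner ℝ (T.gam e) β : ℝ) : ℂ) * ((inner ℝ (T.gam e) β' : ℝ) : ℂ) *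
          (C (T.pos π β - T.pos π β') * (x + κ * (((T.pos π (T.gam e) - T.pos π β).val : ℂ) -
            (T.pos π (T.gam e) - T.pos π β').val))) =
      ∑ β' ∈ T.orbit c, ∑ q ∈ Finset.range T.h,
        ((inner ℝ ((T.w ^ q) (T.gam e)) (T.gam a) : ℝ) : ℂ) *
        ((inner ℝ ((T.w ^ q) (T.gam e)) β' : ℝ) : ℂ) *
          (C (T.pos π (T.gam a) - T.pos π β') *
            (x + κ * (((T.pos π ((T.w ^ q) (T.gam e)) - T.pos π (T.gam a)).val : ℂ) -
            (T.pos π ((T.w ^ q) (T.gam e)) - T.pos π β').val))) := by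
    intro e
    -- Write `β = w^{-q} γ_a` and shift `β'` along its orbit by the same power. Only differences of
    -- positions occur, so `w ^ q` can be moved onto `γ_e`.
    rw [T.sum_orbit hπ a, Finset.sum_comm (s := T.orbit c)]
    refine Finset.sum_congr rfl fun q _ => ?_
    rw [← T.sum_orbit_w_inv_pow hP c _ q]
    refine Finset.sum_congr rfl fun β' hβ' => ?_
    obtain ⟨k, hk⟩ := T.exists_hasAngle_of_mem_orbit hπ hβ'
    have hi : ∀ y, (inner ℝ (T.gam e) ((T.w⁻¹ ^ q) y) : ℝ) = inner ℝ ((T.w ^ q) (T.gam e)) y := by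
      intro y
      rw [T.inner_w_pow hP, ← Int.cast_natCast (R := ZMod (2 * T.h)), ← Int.cast_neg,
        T.wz_intCast hP, zpow_neg, zpow_natCast, inv_pow]
    rw [hi, hi, T.pos_w_inv_pow hπ hk, T.pos_w_inv_pow hπ (T.hasAngle_gam hπ a),
      T.pos_w_pow hπ (T.hasAngle_gam hπ e), sub_sub_sub_cancel_right]
    congr 3
    ring_nf
  rw [Finset.sum_congr rfl fun e _ => h1 e, Finset.sum_comm, Finset.mul_sum]
  refine Finset.sum_congr rfl fun β' hβ' => ?_
  -- With `β'` fixed, the sum over `e` and `q` runs through all the orbits and is a weighted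
  -- completeness sum.
  rw [T.sum_weight_inner_mul hP hπ (fun t => C (T.pos π (T.gam a) - T.pos π β') *
    (x + κ * (((t - T.pos π (T.gam a)).val : ℂ) - (t - T.pos π β').val))) (T.gam a) β']
  have h2 := congrArg (fun z : ℝ => (z : ℂ)) (T.sum_inner_sub_inner_wz hP (T.gam a) β')
  have h3 := congrArg (fun z : ℝ => (z : ℂ)) (T.sum_val_sub_val hP hπ a c hβ')
  simp only [Complex.ofReal_sum, Complex.ofReal_mul] at h2 h3
  have h4 : ∀ t, ((inner ℝ (T.gam a) β' - inner ℝ (T.wz t (T.whiteRefl (T.gam a))) β' : ℝ) : ℂ) *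
      (C (T.pos π (T.gam a) - T.pos π β') *
        (x + κ * (((t - T.pos π (T.gam a)).val : ℂ) - (t - T.pos π β').val))) =
      C (T.pos π (T.gam a) - T.pos π β') * x *
        ((inner ℝ (T.gam a) β' - inner ℝ (T.wz t (T.whiteRefl (T.gam a))) β' : ℝ) : ℂ) +
      C (T.pos π (T.gam a) - T.pos π β') * κ *
        (((inner ℝ (T.gam a) β' - inner ℝ (T.wz t (T.whiteRefl (T.gam a))) β' : ℝ) : ℂ) *
        (((((t - T.pos π (T.gam a)).val : ℝ) - (t - T.pos π β').val : ℝ)) : ℂ)) := by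
    intro t; push_cast; ring
  simp only [h4, Finset.sum_add_distrib, ← Finset.mul_sum]
  rw [h2, h3]
  push_cast; ring

end Completeness

end Data

/-! ### The contour integral of `z G(z)` for periodic `G` -/

section Contour

open Filter Topology

/-- The strip below the real line, without the points `c₁` and `c₂`. -/
def lowerStrip (δ c₁ c₂ : ℝ) : Set ℂ := {z | -δ < z.im ∧ z.im ≤ 0 ∧ z ≠ c₁ ∧ z ≠ c₂}

variable {f G H : ℂ → ℂ} {c₁ c₂ δ R ε : ℝ}

/-- The contour with parameters `R` and `ε` stays within the strip `lowerStrip δ c₁ c₂`. -/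
structure IsAdmissible (c₁ c₂ δ R ε : ℝ) : Prop where
  ε_pos : 0 < ε
  ε_lt : ε < δ
  two_ε_lt : 2 * ε < c₂ - c₁
  left : -R < c₁ - ε
  right : c₂ + ε < R

theorem eventually_isAdmissible (h : c₁ < c₂) (hδ : 0 < δ) :
    ∀ᶠ q in contourFilter, IsAdmissible c₁ c₂ δ q.1 q.2 := by
  have hm : 0 < min δ (min ((c₂ - c₁) / 2) 1) := by
    refine lt_min hδ (lt_min ?_ one_pos); linarith
  have h1 : ∀ᶠ ε : ℝ in 𝓝[>] 0, 0 < ε ∧ ε < min δ (min ((c₂ - c₁) / 2) 1) :=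
    Ioo_mem_nhdsGT hm
  have h2 : ∀ᶠ R : ℝ in atTop, |c₁| + |c₂| + 1 < R := eventually_gt_atTop _
  filter_upwards [h2.prod_mk h1] with q hq
  obtain ⟨hR, h0, h3⟩ := hq
  simp only [lt_min_iff] at h3
  obtain ⟨h4, h5, h6⟩ := h3
  have := neg_abs_le c₁
  have := le_abs_self c₂
  have := abs_nonneg c₁
  have := abs_nonneg c₂
  exact ⟨h0, h4, by linarith, by linarith, by linarith⟩

theorem ofReal_mem_lowerStrip (hδ : 0 < δ) {t : ℝ} (h1 : t ≠ c₁) (h2 : t ≠ c₂) :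
    (t : ℂ) ∈ lowerStrip δ c₁ c₂ :=
  ⟨by simpa using hδ, by simp, by exact_mod_cast h1, by exact_mod_cast h2⟩

theorem halfCircle_mem_lowerStrip (hε : 0 < ε) (hεδ : ε < δ) {c : ℝ} (h1 : c = c₁ ∨ ε < |c - c₁|)
    (h2 : c = c₂ ∨ ε < |c - c₂|) {φ : ℝ} (hφ : φ ∈ Set.Icc Real.pi (2 * Real.pi)) :
    (c : ℂ) + ε * Complex.exp (φ * Complex.I) ∈ lowerStrip δ c₁ c₂ := by
  have him : ((c : ℂ) + ε * Complex.exp (φ * Complex.I)).im = ε * Real.sin φ := by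
    rw [Complex.add_im, Complex.ofReal_im, Complex.im_ofReal_mul, Complex.exp_ofReal_mul_I_im,
      zero_add]
  have hs : Real.sin φ ≤ 0 := by
    have := Real.sin_nonneg_of_nonneg_of_le_pi (x := φ - Real.pi) (by linarith [hφ.1])
      (by linarith [hφ.2])
    rw [Real.sin_sub_pi] at this; linarith
  have hs' := Real.neg_one_le_sin φ
  have hne : ∀ d : ℝ, (c = d ∨ ε < |c - d|) →
      (c : ℂ) + ε * Complex.exp (φ * Complex.I) ≠ d := by
    intro d hd h
    have h3 : (ε : ℂ) * Complex.exp (φ * Complex.I) = ((d - c : ℝ) : ℂ) := by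
      push_cast; linear_combination h
    have h4 := congrArg norm h3
    rw [norm_mul, Complex.norm_exp_ofReal_mul_I, Complex.norm_real, Complex.norm_real, mul_one,
      Real.norm_eq_abs, Real.norm_eq_abs, abs_of_pos hε, abs_sub_comm] at h4
    rcases hd with rfl | hd
    · rw [sub_self, abs_zero] at h4; exact hε.ne' h4
    · exact hd.ne h4
  refine ⟨?_, ?_, hne _ h1, hne _ h2⟩
  · rw [him]; nlinarith
  · rw [him]; exact mul_nonpos_of_nonneg_of_nonpos hε.le hs

theorem intervalIntegrable_halfCircle (hG : ContinuousOn G (lowerStrip δ c₁ c₂)) (hε : 0 < ε)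
    (hεδ : ε < δ) {c : ℝ} (h1 : c = c₁ ∨ ε < |c - c₁|) (h2 : c = c₂ ∨ ε < |c - c₂|) :
    IntervalIntegrable (fun φ : ℝ => G (c + ε * Complex.exp (φ * Complex.I)) *
      (ε * Complex.I * Complex.exp (φ * Complex.I))) MeasureTheory.volume Real.pi
      (2 * Real.pi) := by
  have hle : Real.pi ≤ 2 * Real.pi := by linarith [Real.pi_pos]
  refine ContinuousOn.intervalIntegrable ?_
  rw [Set.uIcc_of_le hle]
  refine ContinuousOn.mul (hG.comp (by fun_prop)
    fun φ hφ => halfCircle_mem_lowerStrip hε hεδ h1 h2 hφ) (by fun_prop)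

theorem intervalIntegrable_real (hG : ContinuousOn G (lowerStrip δ c₁ c₂)) (hδ : 0 < δ) {s t : ℝ}
    (hst : s ≤ t) (h : ∀ y ∈ Set.Icc s t, y ≠ c₁ ∧ y ≠ c₂) :
    IntervalIntegrable (fun y : ℝ => G y) MeasureTheory.volume s t := by
  refine ContinuousOn.intervalIntegrable ?_
  rw [Set.uIcc_of_le hst]
  exact hG.comp (by fun_prop) fun y hy => ofReal_mem_lowerStrip hδ (h y hy).1 (h y hy).2

theorem lowerHalfCircle_eq_sub (hG : ContinuousOn G (lowerStrip δ c₁ c₂))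
    (hH : ∀ z ∈ lowerStrip δ c₁ c₂, HasDerivAt H (G z) z) (hε : 0 < ε)
    (hεδ : ε < δ) {c : ℝ} (h1 : c = c₁ ∨ ε < |c - c₁|) (h2 : c = c₂ ∨ ε < |c - c₂|) :
    lowerHalfCircle G c ε = H ((c + ε : ℝ) : ℂ) - H ((c - ε : ℝ) : ℂ) := by
  have hle : Real.pi ≤ 2 * Real.pi := by linarith [Real.pi_pos]
  have key := intervalIntegral.integral_eq_sub_of_hasDerivAt
    (f := fun φ : ℝ => H (c + ε * Complex.exp (φ * Complex.I)))
    (f' := fun φ : ℝ => G (c + ε * Complex.exp (φ * Complex.I)) *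
      (ε * Complex.I * Complex.exp (φ * Complex.I))) (fun φ hφ => ?_)
    (intervalIntegrable_halfCircle hG hε hεδ h1 h2)
  · rw [lowerHalfCircle, key]
    have e1 : Complex.exp (((2 * Real.pi : ℝ) : ℂ) * Complex.I) = 1 := by
      push_cast; exact Complex.exp_two_pi_mul_I
    rw [e1, Complex.exp_pi_mul_I]
    push_cast
    rw [mul_one, mul_neg_one, ← sub_eq_add_neg]
  · rw [Set.uIcc_of_le hle] at hφ
    have h3 := hH _ (halfCircle_mem_lowerStrip hε hεδ h1 h2 hφ)
    have h4 : HasDerivAt (fun φ : ℝ => (c : ℂ) + ε * Complex.exp (φ * Complex.I))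
        (ε * Complex.I * Complex.exp (φ * Complex.I)) φ := by
      have h5 : HasDerivAt (fun φ : ℝ => (φ : ℂ) * Complex.I) (1 * Complex.I) φ :=
        (Complex.ofRealCLM.hasDerivAt (x := φ)).mul_const Complex.I
      refine ((h5.cexp.const_mul (ε : ℂ)).const_add (c : ℂ)).congr_deriv ?_
      rw [one_mul]; ring
    exact h3.comp φ h4

theorem integral_eq_sub_of_lowerStrip (hG : ContinuousOn G (lowerStrip δ c₁ c₂))
    (hH : ∀ z ∈ lowerStrip δ c₁ c₂, HasDerivAt H (G z) z) (hδ : 0 < δ) {s t : ℝ}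
    (hst : s ≤ t) (h : ∀ y ∈ Set.Icc s t, y ≠ c₁ ∧ y ≠ c₂) :
    ∫ y in s..t, G y = H t - H s := by
  refine intervalIntegral.integral_eq_sub_of_hasDerivAt (f := fun y : ℝ => H y) (fun y hy => ?_)
    (intervalIntegrable_real hG hδ hst h)
  rw [Set.uIcc_of_le hst] at hy
  exact (hH _ (ofReal_mem_lowerStrip hδ (h y hy).1 (h y hy).2)).comp_ofReal

theorem IsAdmissible.ne_left (hA : IsAdmissible c₁ c₂ δ R ε) :
    ∀ y ∈ Set.Icc (-R) (c₁ - ε), y ≠ c₁ ∧ y ≠ c₂ := fun y hy => by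
  have := hA.ε_pos; have := hA.two_ε_lt; have := hy.2
  exact ⟨by linarith, by linarith⟩

theorem IsAdmissible.ne_mid (hA : IsAdmissible c₁ c₂ δ R ε) :
    ∀ y ∈ Set.Icc (c₁ + ε) (c₂ - ε), y ≠ c₁ ∧ y ≠ c₂ := fun y hy => by
  have := hA.ε_pos; have := hA.two_ε_lt; have := hy.2; have := hy.1
  exact ⟨by linarith, by linarith⟩

theorem IsAdmissible.ne_right (hA : IsAdmissible c₁ c₂ δ R ε) :
    ∀ y ∈ Set.Icc (c₂ + ε) R, y ≠ c₁ ∧ y ≠ c₂ := fun y hy => by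
  have := hA.ε_pos; have := hA.two_ε_lt; have := hy.1
  exact ⟨by linarith, by linarith⟩

theorem IsAdmissible.lt_abs (hA : IsAdmissible c₁ c₂ δ R ε) : ε < |c₁ - c₂| := by
  have := hA.ε_pos; have := hA.two_ε_lt; have := neg_abs_le (c₁ - c₂); linarith

/-- The five pieces telescope, since the half-circles stay in the domain of the primitive. The value
does not depend on `ε`, so only the limit in `R` will matter. -/
theorem indentedLine_eq_sub (hG : ContinuousOn G (lowerStrip δ c₁ c₂))
    (hH : ∀ z ∈ lowerStrip δ c₁ c₂, HasDerivAt H (G z) z) (hA : IsAdmissible c₁ c₂ δ R ε) :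
    indentedLine G c₁ c₂ R ε = H R - H (-R : ℝ) := by
  have hδ : 0 < δ := hA.ε_pos.trans hA.ε_lt
  rw [indentedLine, integral_eq_sub_of_lowerStrip hG hH hδ hA.left.le hA.ne_left,
    integral_eq_sub_of_lowerStrip hG hH hδ (by linarith [hA.two_ε_lt]) hA.ne_mid,
    integral_eq_sub_of_lowerStrip hG hH hδ hA.right.le hA.ne_right,
    lowerHalfCircle_eq_sub hG hH hA.ε_pos hA.ε_lt (Or.inl rfl) (Or.inr hA.lt_abs),
    lowerHalfCircle_eq_sub hG hH hA.ε_pos hA.ε_lt (Or.inr (abs_sub_comm c₁ c₂ ▸ hA.lt_abs))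
      (Or.inl rfl)]
  ring

theorem indentedLine_add_const_mul (hf : ContinuousOn f (lowerStrip δ c₁ c₂))
    (hG : ContinuousOn G (lowerStrip δ c₁ c₂)) (hA : IsAdmissible c₁ c₂ δ R ε) (k : ℂ) :
    indentedLine (fun z => f z + k * G z) c₁ c₂ R ε =
      indentedLine f c₁ c₂ R ε + k * indentedLine G c₁ c₂ R ε := by
  have hδ : 0 < δ := hA.ε_pos.trans hA.ε_lt
  have hr : ∀ s t : ℝ, s ≤ t → (∀ y ∈ Set.Icc s t, y ≠ c₁ ∧ y ≠ c₂) →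
      ∫ y in s..t, (f y + k * G y) = (∫ y in s..t, f y) + k * ∫ y in s..t, G y := by
    intro s t hst h
    rw [intervalIntegral.integral_add (intervalIntegrable_real hf hδ hst h)
      ((intervalIntegrable_real hG hδ hst h).const_mul k), intervalIntegral.integral_const_mul]
  have hh : ∀ c : ℝ, (c = c₁ ∨ ε < |c - c₁|) → (c = c₂ ∨ ε < |c - c₂|) →
      lowerHalfCircle (fun z => f z + k * G z) c ε =
        lowerHalfCircle f c ε + k * lowerHalfCircle G c ε := by
    intro c h1 h2
    rw [lowerHalfCircle, lowerHalfCircle, lowerHalfCircle, ← intervalIntegral.integral_const_mul,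
      ← intervalIntegral.integral_add
        (intervalIntegrable_halfCircle hf hA.ε_pos hA.ε_lt h1 h2)
        ((intervalIntegrable_halfCircle hG hA.ε_pos hA.ε_lt h1 h2).const_mul k)]
    refine intervalIntegral.integral_congr fun φ _ => ?_
    ring
  rw [indentedLine, indentedLine, indentedLine, hr _ _ hA.left.le hA.ne_left,
    hr _ _ (by linarith [hA.two_ε_lt]) hA.ne_mid, hr _ _ hA.right.le hA.ne_right,
    hh _ (Or.inl rfl) (Or.inr hA.lt_abs), hh _ (Or.inr (abs_sub_comm c₁ c₂ ▸ hA.lt_abs))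
      (Or.inl rfl)]
  ring

/-- The contour integral of `z G(z)` for a function `G` of period `2πi` that decays at infinity is
`-2πi` times the integral of `G` along the indented line. -/
theorem tendsto_indentedRectangle {L : ℂ} (hc : c₁ < c₂) (hδ : 0 < δ)
    (hper : ∀ z, G (z + 2 * Real.pi * Complex.I) = G z)
    (hG : ContinuousOn G (lowerStrip δ c₁ c₂))
    (hH : ∀ z ∈ lowerStrip δ c₁ c₂, HasDerivAt H (G z) z)
    (hL : Tendsto (fun R : ℝ => H R - H (-R : ℝ)) atTop (𝓝 L))
    (hright : Tendsto (fun R : ℝ => ∫ y in (0 : ℝ)..(2 * Real.pi),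
      (R + y * Complex.I) * G (R + y * Complex.I)) atTop (𝓝 0))
    (hleft : Tendsto (fun R : ℝ => ∫ y in (0 : ℝ)..(2 * Real.pi),
      (-R + y * Complex.I) * G (-R + y * Complex.I)) atTop (𝓝 0)) :
    Tendsto (fun q : ℝ × ℝ => indentedRectangle 2 (fun z => z * G z) c₁ c₂ q.1 q.2)
      contourFilter (𝓝 (-(2 * Real.pi * Complex.I) * L)) := by
  have hlim : Tendsto (fun R : ℝ => -(2 * Real.pi * Complex.I) * (H R - H (-R : ℝ)) +
      Complex.I * (∫ y in (0 : ℝ)..(2 * Real.pi), (R + y * Complex.I) * G (R + y * Complex.I)) -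
      Complex.I * (∫ y in (0 : ℝ)..(2 * Real.pi), (-R + y * Complex.I) * G (-R + y * Complex.I)))
      atTop (𝓝 (-(2 * Real.pi * Complex.I) * L)) := by
    have := ((hL.const_mul (-(2 * Real.pi * Complex.I))).add (hright.const_mul Complex.I)).sub
      (hleft.const_mul Complex.I)
    simpa using this
  have h1 : Tendsto (fun q : ℝ × ℝ => q.1) contourFilter atTop := tendsto_fst
  refine (hlim.comp h1).congr' ?_
  filter_upwards [eventually_isAdmissible hc hδ] with q hA
  have hf : ContinuousOn (fun z => z * G z) (lowerStrip δ c₁ c₂) := continuousOn_id.mul hG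
  -- On the upper side the integrand is `(z + 2πi) G(z)`, so the two sides differ by `2πi G` and no
  -- primitive of `z G(z)` is needed.
  have h2 : (fun z : ℂ => (z + ((2 : ℕ) : ℂ) * Real.pi * Complex.I) *
      G (z + ((2 : ℕ) : ℂ) * Real.pi * Complex.I)) =
      fun z => z * G z + (2 * Real.pi * Complex.I) * G z := by
    funext z
    push_cast
    rw [hper]; ring
  rw [indentedRectangle, h2, indentedLine_add_const_mul hf hG hA,
    indentedLine_eq_sub hG hH hA]
  simp only [Function.comp]
  push_cast
  ring

end Contour

/-! ### Primitive, addition formula and decay of `coth` -/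

section Coth

open Filter Topology Asymptotics

theorem sinh_re_im (z : ℂ) : (Complex.sinh z).re = Real.sinh z.re * Real.cos z.im ∧
    (Complex.sinh z).im = Real.cosh z.re * Real.sin z.im := by
  have h : Complex.sinh z = ((Real.sinh z.re * Real.cos z.im : ℝ) : ℂ) +
      ((Real.cosh z.re * Real.sin z.im : ℝ) : ℂ) * Complex.I := by
    conv_lhs => rw [← Complex.re_add_im z, Complex.sinh_add, Complex.sinh_mul_I,
      Complex.cosh_mul_I]
    push_cast; ring
  rw [h, Complex.add_re, Complex.add_im, Complex.ofReal_re, Complex.ofReal_im,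
    Complex.re_ofReal_mul, Complex.im_ofReal_mul, Complex.I_re, Complex.I_im]
  constructor <;> ring

/-- Strictly below the axis the real part `-cosh · sin` is positive; on the axis away from `0` the
imaginary part is nonzero. This makes the logarithm in `cothPrim` holomorphic near every point
needed, real ones included. -/
theorem I_mul_sinh_mem_slitPlane {y : ℂ} (h1 : -(2 * Real.pi) < y.im) (h2 : y.im ≤ 0)
    (h0 : y ≠ 0) : Complex.I * Complex.sinh (y / 2) ∈ Complex.slitPlane := by
  obtain ⟨hre, him⟩ := sinh_re_im (y / 2)
  have e1 : (y / 2).re = y.re / 2 := by simp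
  have e2 : (y / 2).im = y.im / 2 := by simp
  rw [Complex.mem_slitPlane_iff, Complex.I_mul_re, Complex.I_mul_im, hre, him, e1, e2]
  rcases lt_or_eq_of_le h2 with h | h
  · left
    have := Real.sin_neg_of_neg_of_neg_pi_lt (x := y.im / 2) (by linarith) (by linarith)
    have := Real.cosh_pos (y.re / 2)
    nlinarith
  · right
    rw [h, zero_div, Real.cos_zero, mul_one]
    intro h3
    have h4 : y.re = 0 := by
      have := Real.sinh_eq_zero.1 h3; linarith
    exact h0 (Complex.ext h4 h)

/-- A primitive of `coth ((z - z₀) / 2)` below the point `z₀`. -/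
def cothPrim (z₀ z : ℂ) : ℂ := 2 * Complex.log (Complex.I * Complex.sinh ((z - z₀) / 2))

theorem hasDerivAt_cothPrim {z₀ z : ℂ} (h1 : -(2 * Real.pi) < (z - z₀).im) (h2 : (z - z₀).im ≤ 0)
    (h0 : z ≠ z₀) : HasDerivAt (cothPrim z₀) (coth ((z - z₀) / 2)) z := by
  have hs := I_mul_sinh_mem_slitPlane h1 h2 (sub_ne_zero.2 h0)
  have hne : Complex.sinh ((z - z₀) / 2) ≠ 0 := right_ne_zero_of_mul (Complex.slitPlane_ne_zero hs)
  have h3 : HasDerivAt (fun z => (z - z₀) / 2) (1 / 2) z :=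
    ((hasDerivAt_id z).sub_const z₀).div_const 2
  refine (((h3.csinh.const_mul Complex.I).clog hs).const_mul 2).congr_deriv ?_
  rw [coth]
  field_simp

/-- Pulling out the positive factor `e^{R/2}` changes the logarithm by exactly `R/2`; the remaining
factor has a limit off the branch cut. -/
theorem tendsto_log_I_mul_sinh {w : ℂ} (hw : Complex.I * Complex.exp w ∈ Complex.slitPlane) :
    Tendsto (fun R : ℝ => Complex.log (Complex.I * Complex.sinh (R / 2 + w)) - R / 2) atTop
      (𝓝 (Complex.log (Complex.I * Complex.exp w / 2))) := by
  have hw2 : Complex.I * Complex.exp w / 2 ∈ Complex.slitPlane := by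
    have := (Complex.mem_slitPlane_iff.1 hw)
    rw [Complex.mem_slitPlane_iff]
    have e1 : (Complex.I * Complex.exp w / 2).re = (Complex.I * Complex.exp w).re / 2 := by simp
    have e2 : (Complex.I * Complex.exp w / 2).im = (Complex.I * Complex.exp w).im / 2 := by simp
    rw [e1, e2]
    rcases this with h | h
    · left; linarith
    · right; intro h'; exact h (by linarith)
  have hexp : Tendsto (fun R : ℝ => Complex.exp (-(R : ℂ))) atTop (𝓝 0) := by
    have h1 : Tendsto (fun R : ℝ => ((Real.exp (-R) : ℝ) : ℂ)) atTop (𝓝 ((0 : ℝ) : ℂ)) :=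
      (Complex.continuous_ofReal.tendsto 0).comp (Real.tendsto_exp_neg_atTop_nhds_zero)
    simpa using h1
  have hin : Tendsto (fun R : ℝ => Complex.I * (Complex.exp w - Complex.exp (-(R : ℂ)) *
      Complex.exp (-w)) / 2) atTop (𝓝 (Complex.I * Complex.exp w / 2)) := by
    have := (((hexp.mul_const (Complex.exp (-w))).const_sub (Complex.exp w)).const_mul
      Complex.I).div_const 2
    simpa using this
  have hev : ∀ᶠ R : ℝ in atTop, Complex.I * (Complex.exp w - Complex.exp (-(R : ℂ)) *
      Complex.exp (-w)) / 2 ≠ 0 :=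
    hin.eventually_ne (Complex.slitPlane_ne_zero hw2)
  refine (hin.clog hw2).congr' ?_
  filter_upwards [hev] with R hR
  have h1 : Complex.I * Complex.sinh (R / 2 + w) = ((Real.exp (R / 2) : ℝ) : ℂ) *
      (Complex.I * (Complex.exp w - Complex.exp (-(R : ℂ)) * Complex.exp (-w)) / 2) := by
    have h2 : Complex.exp (-(R / 2 + w)) =
        Complex.exp (R / 2) * (Complex.exp (-(R : ℂ)) * Complex.exp (-w)) := by
      rw [← Complex.exp_add, ← Complex.exp_add]; ring_nf
    rw [Complex.sinh, h2, Complex.exp_add]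
    push_cast; ring
  rw [h1, Complex.log_ofReal_mul (Real.exp_pos _) hR, Real.log_exp]
  push_cast; ring

theorem I_mul_exp_mem_slitPlane {w : ℂ} (h1 : -Real.pi < w.im) (h2 : w.im ≤ 0) :
    Complex.I * Complex.exp w ∈ Complex.slitPlane := by
  rw [Complex.mem_slitPlane_iff, Complex.I_mul_re, Complex.I_mul_im, Complex.exp_re,
    Complex.exp_im]
  have := Real.exp_pos w.re
  rcases lt_or_eq_of_le h2 with h | h
  · left
    have := Real.sin_neg_of_neg_of_neg_pi_lt h h1
    nlinarith
  · right; rw [h, Real.cos_zero, mul_one]; exact this.ne'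

theorem neg_I_mul_exp_mem_slitPlane {w : ℂ} (h1 : 0 ≤ w.im) (h2 : w.im < Real.pi) :
    -(Complex.I * Complex.exp w) ∈ Complex.slitPlane := by
  rw [Complex.mem_slitPlane_iff, Complex.neg_re, Complex.neg_im, Complex.I_mul_re,
    Complex.I_mul_im, Complex.exp_re, Complex.exp_im, neg_neg]
  have := Real.exp_pos w.re
  rcases lt_or_eq_of_le h1 with h | h
  · left
    have := Real.sin_pos_of_pos_of_lt_pi h h2
    positivity
  · right; rw [← h, Real.cos_zero, mul_one]; exact neg_ne_zero.2 this.ne'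

theorem I_mul_exp_div_two (w : ℂ) : Complex.I * Complex.exp w / 2 =
    Complex.exp (w + Real.pi / 2 * Complex.I - Real.log 2) := by
  rw [Complex.exp_sub, Complex.exp_add, Complex.exp_pi_div_two_mul_I, ← Complex.ofReal_exp,
    Real.exp_log two_pos]
  push_cast; ring

/-- The integral of `coth ((z - z₀) / 2)` along the real line, passing below `z₀`. -/
theorem tendsto_cothPrim_sub {z₀ : ℂ} (h1 : 0 ≤ z₀.im) (h2 : z₀.im < 2 * Real.pi) :
    Tendsto (fun R : ℝ => cothPrim z₀ R - cothPrim z₀ (-R : ℝ)) atTop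
      (𝓝 (-(2 * z₀) + 2 * Real.pi * Complex.I)) := by
  have e2 : (-(z₀ / 2)).im = -(z₀.im / 2) := by simp
  have e3 : (z₀ / 2).im = z₀.im / 2 := by simp
  have hpi := Real.pi_pos
  have t1 := tendsto_log_I_mul_sinh (w := -(z₀ / 2))
    (I_mul_exp_mem_slitPlane (by rw [e2]; linarith) (by rw [e2]; linarith))
  -- The shift by `-πi` makes `sinh (R/2 + w)` equal to `sinh ((-R - z₀)/2)` and keeps the limiting
  -- exponent within the range of the principal logarithm.
  have t2 := tendsto_log_I_mul_sinh (w := z₀ / 2 - Real.pi * Complex.I) (by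
    rw [Complex.exp_sub, Complex.exp_pi_mul_I, div_neg, div_one, mul_neg]
    exact neg_I_mul_exp_mem_slitPlane (by rw [e3]; linarith) (by rw [e3]; linarith))
  have t3 := (t1.sub t2).const_mul 2
  have him : ∀ w : ℂ, (w + Real.pi / 2 * Complex.I - Real.log 2).im = w.im + Real.pi / 2 := by
    intro w
    have : ((Real.pi : ℂ) / 2 * Complex.I) = ((Real.pi / 2 : ℝ) : ℂ) * Complex.I := by push_cast; rfl
    rw [this, Complex.sub_im, Complex.add_im, Complex.ofReal_im, Complex.im_ofReal_mul,
      Complex.I_im]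
    ring
  have e4 : (z₀ / 2 - Real.pi * Complex.I).im = z₀.im / 2 - Real.pi := by
    rw [Complex.sub_im, e3, Complex.im_ofReal_mul, Complex.I_im, mul_one]
  rw [I_mul_exp_div_two, I_mul_exp_div_two,
    Complex.log_exp (by rw [him, e2]; linarith) (by rw [him, e2]; linarith),
    Complex.log_exp (by rw [him, e4]; linarith) (by rw [him, e4]; linarith)] at t3
  refine (t3.congr fun R => ?_).trans (le_of_eq ?_)
  · have h3 : ((R : ℂ) - z₀) / 2 = R / 2 + -(z₀ / 2) := by ring
    have h4 : Complex.sinh ((((-R : ℝ) : ℂ) - z₀) / 2) =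
        Complex.sinh (R / 2 + (z₀ / 2 - Real.pi * Complex.I)) := by
      rw [show (R : ℂ) / 2 + (z₀ / 2 - Real.pi * Complex.I) =
        -(((-R : ℝ) : ℂ) - z₀) / 2 - Real.pi * Complex.I by push_cast; ring, Complex.sinh_sub,
        Complex.sinh_mul_I, Complex.cosh_mul_I, Complex.sin_pi, Complex.cos_pi, neg_div,
        Complex.sinh_neg]
      ring
    rw [cothPrim, cothPrim, h3, h4]; ring
  · congr 1; ring

theorem coth_add_pi_mul_I (z : ℂ) : coth (z + Real.pi * Complex.I) = coth z := by
  rw [coth, coth, Complex.cosh_add, Complex.sinh_add, Complex.sinh_mul_I, Complex.cosh_mul_I,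
    Complex.sin_pi, Complex.cos_pi]
  simp

theorem sinh_add_int_mul_pi_mul_I (z : ℂ) (n : ℤ) :
    Complex.sinh (z + n * (Real.pi * Complex.I)) = (-1) ^ n * Complex.sinh z ∧
    Complex.cosh (z + n * (Real.pi * Complex.I)) = (-1) ^ n * Complex.cosh z := by
  have hs : Complex.sin (n * Real.pi) = 0 := Complex.sin_int_mul_pi n
  have hc : Complex.cos (n * Real.pi) = (-1) ^ n := by
    have := congrArg Complex.ofReal (Real.cos_int_mul_pi n)
    rw [Complex.ofReal_cos] at this
    push_cast at this
    exact this
  rw [← mul_assoc, Complex.sinh_add, Complex.cosh_add, Complex.sinh_mul_I, Complex.cosh_mul_I, hs,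
    hc]
  constructor <;> ring

theorem coth_add_int_mul_pi_mul_I (z : ℂ) (n : ℤ) :
    coth (z + n * (Real.pi * Complex.I)) = coth z := by
  obtain ⟨h1, h2⟩ := sinh_add_int_mul_pi_mul_I z n
  rw [coth, coth, h1, h2, mul_div_mul_left]
  exact zpow_ne_zero _ (by norm_num)

theorem coth_neg (z : ℂ) : coth (-z) = -coth z := by
  rw [coth, coth, Complex.cosh_neg, Complex.sinh_neg, div_neg]

/-- The addition formula solved for the product: two factors with different poles become a linear
combination of single ones when `A - B` is constant. -/
theorem coth_mul_coth {A B : ℂ} (hA : Complex.sinh A ≠ 0) (hB : Complex.sinh B ≠ 0)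
    (hAB : Complex.sinh (A - B) ≠ 0) :
    coth A * coth B = 1 + coth (A - B) * (coth B - coth A) := by
  rw [Complex.sinh_sub] at hAB
  rw [coth, coth, coth, Complex.sinh_sub, Complex.cosh_sub]
  field_simp
  ring

theorem hasDerivAt_coth {z : ℂ} (hz : Complex.sinh z ≠ 0) :
    HasDerivAt coth (-(1 / Complex.sinh z ^ 2)) z := by
  refine ((Complex.hasDerivAt_cosh z).div (Complex.hasDerivAt_sinh z) hz).congr_deriv ?_
  have := Complex.cosh_sq_sub_sinh_sq z
  field_simp
  linear_combination (-1 : ℂ) * this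

/-- This rests on the exact formula `coth (u / 2) - 1 = 2 / (exp u - 1)`, used where `‖exp u‖ ≥ 2`.
-/
theorem isBigO_coth_sub_one (w : ℂ) :
    (fun z : ℂ => coth ((z - w) / 2) - 1) =O[comap Complex.re atTop]
      fun z : ℂ => Real.exp (-z.re) := by
  refine IsBigO.of_bound (4 * Real.exp w.re) ?_
  have hev : ∀ᶠ z : ℂ in comap Complex.re atTop, w.re + 1 ≤ z.re :=
    tendsto_comap.eventually (eventually_ge_atTop (w.re + 1))
  filter_upwards [hev] with z hz
  set u := z - w with hu
  have hure : u.re = z.re - w.re := Complex.sub_re z w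
  have hbig : (2 : ℝ) ≤ Real.exp u.re := by
    have := Real.add_one_le_exp u.re; linarith
  have hnorm : Real.exp u.re / 2 ≤ ‖Complex.exp u - 1‖ := by
    have h1 := norm_sub_norm_le (Complex.exp u) 1
    rw [Complex.norm_exp, norm_one] at h1
    linarith
  have hpos : 0 < ‖Complex.exp u - 1‖ := by linarith
  have hne : Complex.exp u - 1 ≠ 0 := norm_pos_iff.1 hpos
  have h2 : coth (u / 2) - 1 = 2 / (Complex.exp u - 1) := by
    have e1 : Complex.exp u = Complex.exp (u / 2) * Complex.exp (u / 2) := by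
      rw [← Complex.exp_add, add_halves]
    have e2 : Complex.exp (u / 2) * Complex.exp (-(u / 2)) = 1 := by
      rw [← Complex.exp_add, add_neg_cancel, Complex.exp_zero]
    have hs : Complex.sinh (u / 2) ≠ 0 := by
      intro h
      rw [Complex.sinh, div_eq_zero_iff] at h
      have h := h.resolve_right two_ne_zero
      apply hne
      rw [e1]; linear_combination Complex.exp (u / 2) * h + e2
    rw [coth, div_sub_one hs, div_eq_div_iff hs hne, Complex.cosh, Complex.sinh, e1]
    linear_combination Complex.exp (u / 2) * e2
  rw [h2, norm_div, Complex.norm_ofNat, Real.norm_eq_abs, abs_of_pos (Real.exp_pos _),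
    div_le_iff₀ hpos]
  have h3 : Real.exp (-z.re) * Real.exp u.re * Real.exp w.re = 1 := by
    rw [← Real.exp_add, ← Real.exp_add, hure]; ring_nf; exact Real.exp_zero
  have h4 : 0 < Real.exp (-z.re) * Real.exp w.re := by positivity
  nlinarith

theorem isBigO_coth_add_one (w : ℂ) :
    (fun z : ℂ => coth ((z - w) / 2) + 1) =O[comap Complex.re atBot]
      fun z : ℂ => Real.exp z.re := by
  have h1 : Tendsto (fun z : ℂ => -z) (comap Complex.re atBot) (comap Complex.re atTop) := by
    rw [tendsto_comap_iff]
    exact tendsto_neg_atBot_atTop.comp tendsto_comap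
  have h2 := ((isBigO_coth_sub_one (-w)).comp_tendsto h1).neg_left
  refine (h2.congr (fun z => ?_) fun z => ?_)
  · simp only [Function.comp]
    rw [show (-z - -w) / 2 = -((z - w) / 2) by ring, coth_neg]; ring
  · simp

/-- The exponential decay is uniform in the height and beats the factor `z`, of norm at most `R +
2π`. -/
theorem tendsto_integral_vertical_right {G : ℂ → ℂ}
    (hG : G =O[comap Complex.re atTop] fun z : ℂ => Real.exp (-z.re)) :
    Tendsto (fun R : ℝ => ∫ y in (0 : ℝ)..(2 * Real.pi),
      (R + y * Complex.I) * G (R + y * Complex.I)) atTop (𝓝 0) := by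
  obtain ⟨C, hC⟩ := hG.bound
  obtain ⟨s, hs, hsub⟩ := hC
  obtain ⟨M, hM⟩ := mem_atTop_sets.1 hs
  have hlim : Tendsto (fun R : ℝ => (R + 2 * Real.pi) * (|C| * Real.exp (-R)) *
      |2 * Real.pi - 0|) atTop (𝓝 0) := by
    have h1 : Tendsto (fun R : ℝ => R * Real.exp (-R)) atTop (𝓝 0) := by
      simpa using Real.tendsto_pow_mul_exp_neg_atTop_nhds_zero 1
    have h2 := (((h1.add (Real.tendsto_exp_neg_atTop_nhds_zero.const_mul (2 * Real.pi))).mul_const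
      |C|).mul_const |2 * Real.pi - 0|)
    refine (h2.congr fun R => by ring).trans (le_of_eq (by simp))
  refine squeeze_zero_norm' ?_ hlim
  filter_upwards [eventually_ge_atTop (max M 0)] with R hR
  have hR0 : 0 ≤ R := (le_max_right _ _).trans hR
  refine intervalIntegral.norm_integral_le_of_norm_le_const fun y hy => ?_
  rw [Set.uIoc_of_le (by positivity)] at hy
  have hre : ((R : ℂ) + y * Complex.I).re = R := by simp
  have hb := hsub (a := (R : ℂ) + y * Complex.I) (hM _ (by rw [hre]; exact (le_max_left _ _).trans hR))
  simp only [Set.mem_ofPred_eq, hre, Real.norm_eq_abs, abs_of_pos (Real.exp_pos _)] at hb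
  rw [norm_mul]
  refine mul_le_mul ?_ (hb.trans (mul_le_mul_of_nonneg_right (le_abs_self C) (Real.exp_pos _).le))
    (norm_nonneg _) (by positivity)
  refine (norm_add_le _ _).trans ?_
  rw [norm_mul, Complex.norm_I, mul_one, Complex.norm_real, Complex.norm_real, Real.norm_eq_abs,
    Real.norm_eq_abs, abs_of_nonneg hR0, abs_of_pos hy.1]
  linarith [hy.2]

theorem tendsto_integral_vertical_left {G : ℂ → ℂ}
    (hG : G =O[comap Complex.re atBot] fun z : ℂ => Real.exp z.re) :
    Tendsto (fun R : ℝ => ∫ y in (0 : ℝ)..(2 * Real.pi),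
      (-R + y * Complex.I) * G (-R + y * Complex.I)) atTop (𝓝 0) := by
  obtain ⟨C, hC⟩ := hG.bound
  obtain ⟨s, hs, hsub⟩ := hC
  obtain ⟨M, hM⟩ := mem_atBot_sets.1 hs
  have hlim : Tendsto (fun R : ℝ => (R + 2 * Real.pi) * (|C| * Real.exp (-R)) *
      |2 * Real.pi - 0|) atTop (𝓝 0) := by
    have h1 : Tendsto (fun R : ℝ => R * Real.exp (-R)) atTop (𝓝 0) := by
      simpa using Real.tendsto_pow_mul_exp_neg_atTop_nhds_zero 1
    have h2 := (((h1.add (Real.tendsto_exp_neg_atTop_nhds_zero.const_mul (2 * Real.pi))).mul_const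
      |C|).mul_const |2 * Real.pi - 0|)
    refine (h2.congr fun R => by ring).trans (le_of_eq (by simp))
  refine squeeze_zero_norm' ?_ hlim
  filter_upwards [eventually_ge_atTop (max (-M) 0)] with R hR
  have hR0 : 0 ≤ R := (le_max_right _ _).trans hR
  have hRM : -M ≤ R := (le_max_left _ _).trans hR
  refine intervalIntegral.norm_integral_le_of_norm_le_const fun y hy => ?_
  rw [Set.uIoc_of_le (by positivity)] at hy
  have hre : (-(R : ℂ) + y * Complex.I).re = -R := by simp
  have hb := hsub (a := -(R : ℂ) + y * Complex.I) (hM _ (by rw [hre]; linarith))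
  simp only [Set.mem_ofPred_eq, hre, Real.norm_eq_abs, abs_of_pos (Real.exp_pos _)] at hb
  rw [norm_mul]
  refine mul_le_mul ?_ (hb.trans (mul_le_mul_of_nonneg_right (le_abs_self C) (Real.exp_pos _).le))
    (norm_nonneg _) (by positivity)
  refine (norm_add_le _ _).trans ?_
  rw [norm_mul, norm_neg, Complex.norm_I, mul_one, Complex.norm_real, Complex.norm_real,
    Real.norm_eq_abs, Real.norm_eq_abs, abs_of_nonneg hR0, abs_of_pos hy.1]
  linarith [hy.2]

end Coth

theorem sinh_ne_zero_of_re_ne_zero {z : ℂ} (hz : z.re ≠ 0) : Complex.sinh z ≠ 0 := by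
  intro h
  obtain ⟨h1, h2⟩ := sinh_re_im z
  rw [h, Complex.zero_re] at h1
  rw [h, Complex.zero_im] at h2
  have hs : Real.sin z.im = 0 := (mul_eq_zero.1 h2.symm).resolve_left (Real.cosh_pos _).ne'
  have hc : Real.cos z.im ≠ 0 := by
    intro hc
    have := Real.sin_sq_add_cos_sq z.im
    rw [hs, hc] at this; norm_num at this
  exact hz (Real.sinh_eq_zero.1 ((mul_eq_zero.1 h1.symm).resolve_right hc))

namespace Data

open Filter Topology Asymptotics

/-! ### Evaluation of the loop integral -/

section Loop

variable {r : ℕ} {ι N : Type*} [Finite ι] [AddCommGroup N] [Module ℝ N]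
  {P : RootPairing ι ℝ (E r) N} {b : P.Base} (T : Data P b)

/-- The argument `θ/2 - iπs/(2h)` for `s` in `ℤ / 2h`, represented by `0 ≤ s < 2h`. -/
def zArg (s : ZMod (2 * T.h)) (θ : ℂ) : ℂ := (θ - Complex.I * Real.pi * s.val / T.h) / 2

/-- Reducing modulo `2h` changes the argument by a multiple of `iπ`, invisible to `coth` and to
`sinh ^ 2`. -/
theorem halfArg_intCast (θ : ℂ) (k : ℤ) :
    ∃ n : ℤ, T.halfArg θ k = T.zArg k θ + n * (Real.pi * Complex.I) := by
  have h1 : (((k : ZMod (2 * T.h)).val : ℕ) : ℤ) = k % (2 * T.h : ℕ) := ZMod.val_intCast k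
  have h2 := Int.emod_add_mul_ediv k (2 * T.h : ℕ)
  rw [← h1] at h2
  refine ⟨-(k / (2 * T.h : ℕ)), ?_⟩
  have hh : (T.h : ℂ) ≠ 0 := by exact_mod_cast T.h_pos.ne'
  have h3 : (k : ℂ) = ((k : ZMod (2 * T.h)).val : ℂ) + 2 * T.h * (k / (2 * T.h : ℕ) : ℤ) := by
    exact_mod_cast congrArg (fun n : ℤ => (n : ℂ)) h2.symm
  rw [halfArg, zArg, Complex.ofReal_intCast, Int.cast_neg]
  generalize (k / (2 * T.h : ℕ) : ℤ) = q at h3 ⊢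
  rw [h3]
  field_simp
  ring

theorem zArg_sub_zArg (s t : ZMod (2 * T.h)) (x y : ℂ) :
    ∃ n : ℤ, T.zArg s x - T.zArg t y = T.zArg (s - t) (x - y) + n * (Real.pi * Complex.I) := by
  have h1 : s - t = (((s.val : ℤ) - t.val : ℤ) : ZMod (2 * T.h)) := by
    push_cast; rw [ZMod.natCast_zmod_val, ZMod.natCast_zmod_val]
  obtain ⟨n, hn⟩ := T.halfArg_intCast (x - y) ((s.val : ℤ) - t.val)
  rw [← h1] at hn
  refine ⟨n, ?_⟩
  rw [← hn, halfArg, zArg, zArg]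
  have hh : (T.h : ℂ) ≠ 0 := by exact_mod_cast T.h_pos.ne'
  push_cast
  field_simp
  ring

variable [P.IsRootSystem] [P.IsCrystallographic] [P.IsReduced] [P.IsIrreducible]
  {π : E r →ₗ[ℝ] ℂ}

theorem exists_halfArg_eq (hπ : T.IsSpinOneProjection π) {a c : b.support} {y y' : E r}
    (hy : y ∈ T.orbit a) (hy' : y' ∈ T.orbit c) (θ : ℂ) :
    ∃ n : ℤ, T.halfArg θ (T.uDiff π y y') =
      T.zArg (T.pos π y - T.pos π y') θ + n * (Real.pi * Complex.I) := by
  have h1 : T.uDiff π y y' = ((⌊T.u π y⌋ - ⌊T.u π y'⌋ : ℤ) : ℝ) := by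
    rw [uDiff]; push_cast; rw [← T.u_eq_floor hπ hy, ← T.u_eq_floor hπ hy']
  have h2 : T.pos π y - T.pos π y' = ((⌊T.u π y⌋ - ⌊T.u π y'⌋ : ℤ) : ZMod (2 * T.h)) := by
    rw [pos, pos]; push_cast; rfl
  rw [h1, h2]
  exact T.halfArg_intCast θ _

theorem coth_halfArg (hπ : T.IsSpinOneProjection π) {a c : b.support} {y y' : E r}
    (hy : y ∈ T.orbit a) (hy' : y' ∈ T.orbit c) (θ : ℂ) :
    coth (T.halfArg θ (T.uDiff π y y')) = coth (T.zArg (T.pos π y - T.pos π y') θ) := by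
  obtain ⟨n, hn⟩ := T.exists_halfArg_eq hπ hy hy' θ
  rw [hn, coth_add_int_mul_pi_mul_I]

theorem treeS_eq (hπ : T.IsSpinOneProjection π) (g : ℝ) (a c : b.support) (θ : ℂ) :
    T.treeS π g a c θ = -(Complex.I * g ^ 2 / (4 * T.h)) *
      ∑ β ∈ T.orbit c, ((inner ℝ (T.gam a) β : ℝ) : ℂ) *
        coth (T.zArg (T.pos π (T.gam a) - T.pos π β) θ) := by
  rw [treeS]
  congr 1
  exact Finset.sum_congr rfl fun β hβ => by rw [T.coth_halfArg hπ (T.gam_mem_orbit a) hβ]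

theorem treeS_add_two_pi_mul_I (π : E r →ₗ[ℝ] ℂ) (g : ℝ) (a c : b.support) (θ : ℂ) :
    T.treeS π g a c (θ + 2 * Real.pi * Complex.I) = T.treeS π g a c θ := by
  rw [treeS, treeS]
  congr 1
  refine Finset.sum_congr rfl fun β _ => ?_
  rw [show T.halfArg (θ + 2 * Real.pi * Complex.I) (T.uDiff π (T.gam a) β) =
    T.halfArg θ (T.uDiff π (T.gam a) β) + Real.pi * Complex.I by rw [halfArg, halfArg]; ring,
    coth_add_pi_mul_I]

theorem sum_inner_orbit (hP : IsSimplyLaced P) (a : b.support) (x : E r) :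
    ∑ β ∈ T.orbit a, ((inner ℝ x β : ℝ) : ℂ) = 0 := by
  rw [← Complex.ofReal_sum, ← inner_sum, T.sum_orbit_eq_zero hP, inner_zero_right,
    Complex.ofReal_zero]

/-- The coefficients sum to zero over the orbit, so each `coth` may be replaced by `coth - 1`. -/
theorem treeS_isBigO_atTop (hP : IsSimplyLaced P) (hπ : T.IsSpinOneProjection π) (g : ℝ)
    (a c : b.support) (p : ℝ) :
    (fun z : ℂ => T.treeS π g a c (z - p)) =O[comap Complex.re atTop]
      fun z : ℂ => Real.exp (-z.re) := by
  have h : (fun z : ℂ => T.treeS π g a c (z - p)) = fun z : ℂ =>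
      -(Complex.I * g ^ 2 / (4 * T.h)) * ∑ β ∈ T.orbit c, ((inner ℝ (T.gam a) β : ℝ) : ℂ) *
        (coth ((z - (p + Complex.I * Real.pi * (T.pos π (T.gam a) - T.pos π β).val / T.h)) / 2)
          - 1) := by
    funext z
    simp only [mul_sub, mul_one, Finset.sum_sub_distrib]
    rw [T.sum_inner_orbit hP, mul_zero, sub_zero, T.treeS_eq hπ]
    simp only [zArg, sub_sub]
  rw [h]
  exact (IsBigO.fun_sum fun β _ => (isBigO_coth_sub_one _).const_mul_left _).const_mul_left _

theorem treeS_isBigO_atBot (hP : IsSimplyLaced P) (hπ : T.IsSpinOneProjection π) (g : ℝ)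
    (a c : b.support) (p : ℝ) :
    (fun z : ℂ => T.treeS π g a c (z - p)) =O[comap Complex.re atBot]
      fun z : ℂ => Real.exp z.re := by
  have h : (fun z : ℂ => T.treeS π g a c (z - p)) = fun z : ℂ =>
      -(Complex.I * g ^ 2 / (4 * T.h)) * ∑ β ∈ T.orbit c, ((inner ℝ (T.gam a) β : ℝ) : ℂ) *
        (coth ((z - (p + Complex.I * Real.pi * (T.pos π (T.gam a) - T.pos π β).val / T.h)) / 2)
          + 1) := by
    funext z
    simp only [mul_add, mul_one, Finset.sum_add_distrib]
    rw [T.sum_inner_orbit hP, mul_zero, add_zero, T.treeS_eq hπ]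
    simp only [zArg, sub_sub]
  rw [h]
  exact (IsBigO.fun_sum fun β _ => (isBigO_coth_add_one _).const_mul_left _).const_mul_left _

theorem treeS_mul_isBigO_atTop (hP : IsSimplyLaced P) (hπ : T.IsSpinOneProjection π) (g : ℝ)
    (e a c : b.support) (p p' : ℝ) :
    (fun z : ℂ => T.treeS π g e a (z - p) * T.treeS π g e c (z - p')) =O[comap Complex.re atTop]
      fun z : ℂ => Real.exp (-z.re) := by
  refine ((T.treeS_isBigO_atTop hP hπ g e a p).mul
    (T.treeS_isBigO_atTop hP hπ g e c p')).trans (IsBigO.of_bound 1 ?_)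
  have hev : ∀ᶠ z : ℂ in comap Complex.re atTop, 0 ≤ z.re :=
    tendsto_comap.eventually (eventually_ge_atTop 0)
  filter_upwards [hev] with z hz
  rw [norm_mul, one_mul]
  refine mul_le_of_le_one_right (norm_nonneg _) ?_
  rw [Real.norm_eq_abs, abs_of_pos (Real.exp_pos _)]
  exact Real.exp_le_one_iff.2 (by linarith)

theorem treeS_mul_isBigO_atBot (hP : IsSimplyLaced P) (hπ : T.IsSpinOneProjection π) (g : ℝ)
    (e a c : b.support) (p p' : ℝ) :
    (fun z : ℂ => T.treeS π g e a (z - p) * T.treeS π g e c (z - p')) =O[comap Complex.re atBot]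
      fun z : ℂ => Real.exp z.re := by
  refine ((T.treeS_isBigO_atBot hP hπ g e a p).mul
    (T.treeS_isBigO_atBot hP hπ g e c p')).trans (IsBigO.of_bound 1 ?_)
  have hev : ∀ᶠ z : ℂ in comap Complex.re atBot, z.re ≤ 0 :=
    tendsto_comap.eventually (eventually_le_atBot 0)
  filter_upwards [hev] with z hz
  rw [norm_mul, one_mul]
  refine mul_le_of_le_one_right (norm_nonneg _) ?_
  rw [Real.norm_eq_abs, abs_of_pos (Real.exp_pos _)]
  exact Real.exp_le_one_iff.2 hz

/-- The pole at the angle `s` of `coth ((z - p) / 2 - iπs/(2h))`. -/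
def polePos (p : ℝ) (s : ZMod (2 * T.h)) : ℂ := p + Complex.I * Real.pi * s.val / T.h

theorem polePos_im (p : ℝ) (s : ZMod (2 * T.h)) : (T.polePos p s).im = Real.pi / T.h * s.val := by
  have : T.polePos p s = p + ((Real.pi / T.h * s.val : ℝ) : ℂ) * Complex.I := by
    rw [polePos]; push_cast; ring
  rw [this]; simp

theorem zArg_sub_eq (p : ℝ) (s : ZMod (2 * T.h)) (z : ℂ) :
    T.zArg s (z - p) = (z - T.polePos p s) / 2 := by
  rw [zArg, polePos, sub_sub]

/-- The representatives in `[0, 2h)` leave a gap of `π / h` below the height `2π`; this gap is the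
usable depth of the strip under the real line. -/
theorem polePos_im_mem (p : ℝ) (s : ZMod (2 * T.h)) :
    0 ≤ (T.polePos p s).im ∧ (T.polePos p s).im + Real.pi / T.h ≤ 2 * Real.pi := by
  have hh : (0 : ℝ) < T.h := by exact_mod_cast T.h_pos
  have h1 : 0 < Real.pi / T.h := div_pos Real.pi_pos hh
  have hs : (s.val : ℝ) + 1 ≤ 2 * T.h := by exact_mod_cast s.val_lt
  rw [polePos_im]
  refine ⟨by positivity, ?_⟩
  calc Real.pi / T.h * s.val + Real.pi / T.h = Real.pi / T.h * (s.val + 1) := by ring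
    _ ≤ Real.pi / T.h * (2 * T.h) := mul_le_mul_of_nonneg_left hs h1.le
    _ = 2 * Real.pi := by field_simp

/-- Within that depth every pole meets the conditions of `hasDerivAt_cothPrim`. Only the pole with
`s = 0` touches the strip, at `p`, which is excluded. -/
theorem sub_polePos {p : ℝ} (s : ZMod (2 * T.h)) {z : ℂ} (h1 : -(Real.pi / T.h) < z.im)
    (h2 : z.im ≤ 0) (hz : z ≠ p) :
    -(2 * Real.pi) < (z - T.polePos p s).im ∧ (z - T.polePos p s).im ≤ 0 ∧
      z ≠ T.polePos p s := by
  obtain ⟨h3, h4⟩ := T.polePos_im_mem p s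
  rw [Complex.sub_im]
  refine ⟨by linarith, by linarith, fun h => ?_⟩
  have h5 : (T.polePos p s).im = 0 := le_antisymm (h ▸ h2) h3
  rw [polePos_im] at h5
  have h6 : (s.val : ℝ) = 0 := (mul_eq_zero.1 h5).resolve_left T.pi_div_h_ne_zero
  have h7 : s.val = 0 := by exact_mod_cast h6
  rw [h, polePos, h7] at hz
  exact hz (by simp)

theorem sinh_zArg_ne_zero {p : ℝ} (s : ZMod (2 * T.h)) {z : ℂ} (h1 : -(Real.pi / T.h) < z.im)
    (h2 : z.im ≤ 0) (hz : z ≠ p) : Complex.sinh (T.zArg s (z - p)) ≠ 0 := by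
  obtain ⟨h3, h4, h5⟩ := T.sub_polePos s h1 h2 hz
  rw [zArg_sub_eq]
  exact right_ne_zero_of_mul
    (Complex.slitPlane_ne_zero (I_mul_sinh_mem_slitPlane h3 h4 (sub_ne_zero.2 h5)))

theorem hasDerivAt_cothPrim_polePos {p : ℝ} (s : ZMod (2 * T.h)) {z : ℂ}
    (h1 : -(Real.pi / T.h) < z.im) (h2 : z.im ≤ 0) (hz : z ≠ p) :
    HasDerivAt (cothPrim (T.polePos p s)) (coth (T.zArg s (z - p))) z := by
  obtain ⟨h3, h4, h5⟩ := T.sub_polePos s h1 h2 hz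
  rw [zArg_sub_eq]
  exact hasDerivAt_cothPrim h3 h4 h5

theorem hasDerivAt_coth_zArg {s : ZMod (2 * T.h)} {z : ℂ} (hz : Complex.sinh (T.zArg s z) ≠ 0) :
    HasDerivAt (fun z => coth (T.zArg s z)) (-(1 / Complex.sinh (T.zArg s z) ^ 2) * (1 / 2)) z :=
  (hasDerivAt_coth hz).comp z
    (((hasDerivAt_id z).sub_const (Complex.I * Real.pi * s.val / T.h)).div_const 2)

theorem differentiableAt_treeS (hπ : T.IsSpinOneProjection π) (g : ℝ) (a c : b.support) {z : ℂ}
    (hz : ∀ s, Complex.sinh (T.zArg s z) ≠ 0) : DifferentiableAt ℂ (T.treeS π g a c) z := by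
  rw [funext (T.treeS_eq hπ g a c)]
  exact (DifferentiableAt.fun_sum fun β _ =>
    (T.hasDerivAt_coth_zArg (hz _)).differentiableAt.const_mul _).const_mul _

theorem sinh_zArg_ofReal_ne_zero (s : ZMod (2 * T.h)) {t : ℝ} (ht : t ≠ 0) :
    Complex.sinh (T.zArg s t) ≠ 0 := by
  refine sinh_ne_zero_of_re_ne_zero ?_
  have : T.zArg s t = ((t / 2 : ℝ) : ℂ) + ((-(Real.pi * s.val / T.h / 2) : ℝ) : ℂ) * Complex.I := by
    rw [zArg]; push_cast; ring
  rw [this]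
  simpa using ht

/-- The value of the contour integral as a function of the difference of rapidities. -/
def loopValue (π : E r →ₗ[ℝ] ℂ) (g : ℝ) (e a c : b.support) (t : ℂ) : ℂ :=
  4 * Real.pi * Complex.I * (-(Complex.I * g ^ 2 / (4 * T.h))) ^ 2 *
    ∑ β ∈ T.orbit a, ∑ β' ∈ T.orbit c,
      ((inner ℝ (T.gam e) β : ℝ) : ℂ) * ((inner ℝ (T.gam e) β' : ℝ) : ℂ) *
        (coth (T.zArg (T.pos π β - T.pos π β') t) *
          (t + Complex.I * Real.pi / T.h * (((T.pos π (T.gam e) - T.pos π β).val : ℂ) -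
            (T.pos π (T.gam e) - T.pos π β').val)))

/-- In the addition formula the difference of the arguments involves neither `z` nor `e`, so the
product is linear in single `coth`'s of `z`. The constant `1` drops out because the orbit sums
vanish. -/
theorem treeS_mul_treeS (hP : IsSimplyLaced P) (hπ : T.IsSpinOneProjection π) (g : ℝ)
    (e a c : b.support) {p p' : ℝ} (hp : p' < p) {z : ℂ}
    (hz : z ∈ lowerStrip (Real.pi / T.h) p' p) :
    T.treeS π g e a (z - p) * T.treeS π g e c (z - p') =
      (-(Complex.I * g ^ 2 / (4 * T.h))) ^ 2 * ∑ β ∈ T.orbit a, ∑ β' ∈ T.orbit c,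
        ((inner ℝ (T.gam e) β : ℝ) : ℂ) * ((inner ℝ (T.gam e) β' : ℝ) : ℂ) *
        (coth (T.zArg (T.pos π β - T.pos π β') ((p - p' : ℝ) : ℂ)) *
          (coth (T.zArg (T.pos π (T.gam e) - T.pos π β) (z - p)) -
            coth (T.zArg (T.pos π (T.gam e) - T.pos π β') (z - p')))) := by
  obtain ⟨h1, h2, h3, h4⟩ := hz
  have hterm : ∀ β β', coth (T.zArg (T.pos π β - T.pos π β') ((p - p' : ℝ) : ℂ)) *
      (coth (T.zArg (T.pos π (T.gam e) - T.pos π β) (z - p)) -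
        coth (T.zArg (T.pos π (T.gam e) - T.pos π β') (z - p'))) =
      coth (T.zArg (T.pos π (T.gam e) - T.pos π β) (z - p)) *
        coth (T.zArg (T.pos π (T.gam e) - T.pos π β') (z - p')) - 1 := by
    intro β β'
    obtain ⟨n, hn⟩ := T.zArg_sub_zArg (T.pos π (T.gam e) - T.pos π β')
      (T.pos π (T.gam e) - T.pos π β) (z - p') (z - p)
    rw [sub_sub_sub_cancel_left, sub_sub_sub_cancel_left, ← Complex.ofReal_sub] at hn
    have hne := T.sinh_zArg_ofReal_ne_zero (T.pos π β - T.pos π β') (sub_ne_zero.2 hp.ne')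
    have hk := coth_mul_coth (T.sinh_zArg_ne_zero (T.pos π (T.gam e) - T.pos π β') h1 h2 h3)
      (T.sinh_zArg_ne_zero (T.pos π (T.gam e) - T.pos π β) h1 h2 h4) (by
        rw [hn, (sinh_add_int_mul_pi_mul_I _ n).1]
        exact mul_ne_zero (zpow_ne_zero _ (by norm_num)) hne)
    rw [hn, coth_add_int_mul_pi_mul_I] at hk
    linear_combination -hk
  simp only [hterm, mul_sub, mul_one, Finset.sum_sub_distrib]
  have hzero : ∑ β ∈ T.orbit a, ∑ β' ∈ T.orbit c,
      ((inner ℝ (T.gam e) β : ℝ) : ℂ) * ((inner ℝ (T.gam e) β' : ℝ) : ℂ) = 0 := by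
    simp only [← Finset.mul_sum, T.sum_inner_orbit hP, mul_zero, Finset.sum_const_zero]
  rw [hzero, mul_zero, sub_zero, T.treeS_eq hπ, T.treeS_eq hπ, mul_mul_mul_comm, ← sq,
    Finset.sum_mul_sum]
  congr 1
  exact Finset.sum_congr rfl fun β _ => Finset.sum_congr rfl fun β' _ => by ring

/-- A primitive of the product of two tree-level S-matrices. -/
def loopPrim (π : E r →ₗ[ℝ] ℂ) (g : ℝ) (e a c : b.support) (p p' : ℝ) (z : ℂ) : ℂ :=
  (-(Complex.I * g ^ 2 / (4 * T.h))) ^ 2 * ∑ β ∈ T.orbit a, ∑ β' ∈ T.orbit c,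
    ((inner ℝ (T.gam e) β : ℝ) : ℂ) * ((inner ℝ (T.gam e) β' : ℝ) : ℂ) *
      (coth (T.zArg (T.pos π β - T.pos π β') ((p - p' : ℝ) : ℂ)) *
        (cothPrim (T.polePos p (T.pos π (T.gam e) - T.pos π β)) z -
          cothPrim (T.polePos p' (T.pos π (T.gam e) - T.pos π β')) z))

theorem hasDerivAt_loopPrim (hP : IsSimplyLaced P) (hπ : T.IsSpinOneProjection π) (g : ℝ)
    (e a c : b.support) {p p' : ℝ} (hp : p' < p) {z : ℂ}
    (hz : z ∈ lowerStrip (Real.pi / T.h) p' p) :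
    HasDerivAt (T.loopPrim π g e a c p p')
      (T.treeS π g e a (z - p) * T.treeS π g e c (z - p')) z := by
  rw [T.treeS_mul_treeS hP hπ g e a c hp hz]
  unfold loopPrim
  refine HasDerivAt.const_mul _ (HasDerivAt.fun_sum fun β _ => HasDerivAt.fun_sum fun β' _ =>
    HasDerivAt.const_mul _ (HasDerivAt.const_mul _ (HasDerivAt.fun_sub ?_ ?_)))
  · exact T.hasDerivAt_cothPrim_polePos _ hz.1 hz.2.1 hz.2.2.2
  · exact T.hasDerivAt_cothPrim_polePos _ hz.1 hz.2.1 hz.2.2.1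

theorem tendsto_sum_sum_sub {α : Type*} (s t : Finset α) (K : ℂ) (k C : α → α → ℂ)
    (H H' : α → ℂ → ℂ) (L L' : α → ℂ)
    (hH : ∀ x, Tendsto (fun R : ℝ => H x R - H x (-R : ℝ)) atTop (𝓝 (L x)))
    (hH' : ∀ x, Tendsto (fun R : ℝ => H' x R - H' x (-R : ℝ)) atTop (𝓝 (L' x))) :
    Tendsto (fun R : ℝ => K * ∑ x ∈ s, ∑ y ∈ t, k x y * (C x y * (H x R - H' y R)) -
      K * ∑ x ∈ s, ∑ y ∈ t, k x y * (C x y * (H x (-R : ℝ) - H' y (-R : ℝ)))) atTop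
      (𝓝 (K * ∑ x ∈ s, ∑ y ∈ t, k x y * (C x y * (L x - L' y)))) := by
  have h := (tendsto_finsetSum s fun x _ => tendsto_finsetSum t fun y _ =>
    (((hH x).sub (hH' y)).const_mul (C x y)).const_mul (k x y)).const_mul K
  refine h.congr fun R => ?_
  rw [← mul_sub, ← Finset.sum_sub_distrib]
  congr 1
  refine Finset.sum_congr rfl fun x _ => ?_
  rw [← Finset.sum_sub_distrib]
  exact Finset.sum_congr rfl fun y _ => by ring

theorem tendsto_loopPrim_sub (π : E r →ₗ[ℝ] ℂ) (g : ℝ) (e a c : b.support) (p p' : ℝ) :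
    Tendsto (fun R : ℝ => T.loopPrim π g e a c p p' R - T.loopPrim π g e a c p p' (-R : ℝ)) atTop
      (𝓝 ((-(Complex.I * g ^ 2 / (4 * T.h))) ^ 2 * ∑ β ∈ T.orbit a, ∑ β' ∈ T.orbit c,
        ((inner ℝ (T.gam e) β : ℝ) : ℂ) * ((inner ℝ (T.gam e) β' : ℝ) : ℂ) *
          (coth (T.zArg (T.pos π β - T.pos π β') ((p - p' : ℝ) : ℂ)) *
            ((-(2 * T.polePos p (T.pos π (T.gam e) - T.pos π β)) + 2 * Real.pi * Complex.I) -
              (-(2 * T.polePos p' (T.pos π (T.gam e) - T.pos π β')) +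
                2 * Real.pi * Complex.I))))) := by
  have hh : 0 < Real.pi / T.h := div_pos Real.pi_pos (by exact_mod_cast T.h_pos)
  have h1 : ∀ (q : ℝ) (s : ZMod (2 * T.h)), Tendsto (fun R : ℝ =>
      cothPrim (T.polePos q s) R - cothPrim (T.polePos q s) (-R : ℝ)) atTop
      (𝓝 (-(2 * T.polePos q s) + 2 * Real.pi * Complex.I)) := fun q s =>
    tendsto_cothPrim_sub (T.polePos_im_mem q s).1 (by linarith [(T.polePos_im_mem q s).2])
  unfold loopPrim
  exact tendsto_sum_sum_sub (T.orbit a) (T.orbit c) _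
    (fun β β' => ((inner ℝ (T.gam e) β : ℝ) : ℂ) * ((inner ℝ (T.gam e) β' : ℝ) : ℂ))
    (fun β β' => coth (T.zArg (T.pos π β - T.pos π β') ((p - p' : ℝ) : ℂ)))
    (fun β => cothPrim (T.polePos p (T.pos π (T.gam e) - T.pos π β)))
    (fun β' => cothPrim (T.polePos p' (T.pos π (T.gam e) - T.pos π β'))) _ _
    (fun β => h1 p _) fun β' => h1 p' _

theorem continuousAt_treeS_sub (hπ : T.IsSpinOneProjection π) (g : ℝ) (e a : b.support) {p : ℝ}
    {z : ℂ} (h1 : -(Real.pi / T.h) < z.im) (h2 : z.im ≤ 0) (hz : z ≠ p) :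
    ContinuousAt (fun z : ℂ => T.treeS π g e a (z - p)) z := by
  have h3 : ContinuousAt (T.treeS π g e a) (z - p) :=
    (T.differentiableAt_treeS hπ g e a fun s => T.sinh_zArg_ne_zero s h1 h2 hz).continuousAt
  exact ContinuousAt.comp' h3 (continuousAt_id.sub continuousAt_const)

theorem continuousOn_treeS_mul_treeS (hπ : T.IsSpinOneProjection π) (g : ℝ) (e a c : b.support)
    (p p' : ℝ) : ContinuousOn (fun z : ℂ => T.treeS π g e a (z - p) * T.treeS π g e c (z - p'))
      (lowerStrip (Real.pi / T.h) p' p) := fun _ hz =>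
  ((T.continuousAt_treeS_sub hπ g e a hz.1 hz.2.1 hz.2.2.2).mul
    (T.continuousAt_treeS_sub hπ g e c hz.1 hz.2.1 hz.2.2.1)).continuousWithinAt

theorem tendsto_indentedRectangle_of_isBigO {G H : ℂ → ℂ} {c₁ c₂ δ : ℝ} {L : ℂ} (hc : c₁ < c₂)
    (hδ : 0 < δ) (hper : ∀ z, G (z + 2 * Real.pi * Complex.I) = G z)
    (hG : ContinuousOn G (lowerStrip δ c₁ c₂))
    (hH : ∀ z ∈ lowerStrip δ c₁ c₂, HasDerivAt H (G z) z)
    (hL : Tendsto (fun R : ℝ => H R - H (-R : ℝ)) atTop (𝓝 L))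
    (hright : G =O[comap Complex.re atTop] fun z : ℂ => Real.exp (-z.re))
    (hleft : G =O[comap Complex.re atBot] fun z : ℂ => Real.exp z.re) :
    Tendsto (fun q : ℝ × ℝ => indentedRectangle 2 (fun z => z * G z) c₁ c₂ q.1 q.2)
      contourFilter (𝓝 (-(2 * Real.pi * Complex.I) * L)) :=
  tendsto_indentedRectangle hc hδ hper hG hH hL (tendsto_integral_vertical_right hright)
    (tendsto_integral_vertical_left hleft)

theorem tendsto_loop (hP : IsSimplyLaced P) (hπ : T.IsSpinOneProjection π) (g : ℝ)
    (e a c : b.support) {p p' : ℝ} (hp : p' < p) :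
    Tendsto (fun q : ℝ × ℝ => indentedRectangle 2 (T.integrand π g e a c p p') p' p q.1 q.2)
      contourFilter (𝓝 (T.loopValue π g e a c ((p - p' : ℝ) : ℂ))) := by
  have hint : T.integrand π g e a c p p' =
      fun z => z * (T.treeS π g e a (z - p) * T.treeS π g e c (z - p')) := by
    funext z; rw [integrand, mul_assoc]
  have hh : 0 < Real.pi / T.h := div_pos Real.pi_pos (by exact_mod_cast T.h_pos)
  have hper : ∀ z : ℂ, T.treeS π g e a (z + 2 * Real.pi * Complex.I - p) *
      T.treeS π g e c (z + 2 * Real.pi * Complex.I - p') =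
      T.treeS π g e a (z - p) * T.treeS π g e c (z - p') := fun z => by
    rw [add_sub_right_comm, add_sub_right_comm, treeS_add_two_pi_mul_I, treeS_add_two_pi_mul_I]
  have key := tendsto_indentedRectangle_of_isBigO hp hh hper
    (T.continuousOn_treeS_mul_treeS hπ g e a c p p')
    (fun z hz => T.hasDerivAt_loopPrim hP hπ g e a c hp hz)
    (T.tendsto_loopPrim_sub π g e a c p p') (T.treeS_mul_isBigO_atTop hP hπ g e a c p p')
    (T.treeS_mul_isBigO_atBot hP hπ g e a c p p')
  rw [hint]
  refine key.trans (le_of_eq ?_)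
  congr 1
  rw [loopValue]
  generalize (-(Complex.I * (g : ℂ) ^ 2 / (4 * T.h))) ^ 2 = K
  rw [mul_left_comm, mul_comm _ K, mul_assoc K]
  congr 1
  rw [Finset.mul_sum, Finset.mul_sum]
  refine Finset.sum_congr rfl fun β _ => ?_
  rw [Finset.mul_sum, Finset.mul_sum]
  refine Finset.sum_congr rfl fun β' _ => ?_
  -- The two terms `2πi` cancel, `(-2πi)(-2)` gives the prefactor `4πi`, and the difference of the
  -- poles is the last factor of `loopValue`.
  rw [polePos, polePos]
  generalize coth _ = X
  push_cast
  ring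

instance : contourFilter.NeBot := by rw [contourFilter]; infer_instance

theorem loopIntegral_eq (hP : IsSimplyLaced P) (hπ : T.IsSpinOneProjection π) (g : ℝ)
    (e a c : b.support) {p p' : ℝ} (hp : p' < p) :
    T.loopIntegral π g e a c p p' = T.loopValue π g e a c ((p - p' : ℝ) : ℂ) :=
  (T.tendsto_loop hP hπ g e a c hp).limUnder_eq

/-- `sum_orbit_orbit` with `x = t` and `κ = iπ/h`: the part with `x` rebuilds the tree amplitude,
the part with `κ` comes from the heights of the poles. -/
theorem sum_loopValue (hP : IsSimplyLaced P) (hπ : T.IsSpinOneProjection π) (g : ℝ)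
    (a c : b.support) (t : ℂ) :
    ∑ e, T.loopValue π g e a c t = 2 * g ^ 2 * Real.pi * t * T.treeS π g a c t +
      Real.pi ^ 2 * g ^ 4 / (2 * T.h ^ 2) * ∑ β ∈ T.orbit c,
        (T.plusPairing a β : ℂ) * coth (T.halfArg t (T.uDiff π (T.gam a) β)) := by
  have h1 : ∑ β ∈ T.orbit c,
        (T.plusPairing a β : ℂ) * coth (T.halfArg t (T.uDiff π (T.gam a) β)) =
      ∑ β ∈ T.orbit c, (T.plusPairing a β : ℂ) *
        coth (T.zArg (T.pos π (T.gam a) - T.pos π β) t) :=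
    Finset.sum_congr rfl fun β hβ => by rw [T.coth_halfArg hπ (T.gam_mem_orbit a) hβ]
  have hh : (T.h : ℂ) ≠ 0 := by exact_mod_cast T.h_pos.ne'
  simp only [loopValue]
  rw [← Finset.mul_sum, T.sum_orbit_orbit hP hπ a c (fun s => coth (T.zArg s t)) t
    (Complex.I * Real.pi / T.h), h1, T.treeS_eq hπ]
  have h2 : ∀ β, coth (T.zArg (T.pos π (T.gam a) - T.pos π β) t) *
      (t * ((inner ℝ (T.gam a) β : ℝ) : ℂ) +
        Complex.I * Real.pi / T.h * (T.plusPairing a β : ℂ)) =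
      t * (((inner ℝ (T.gam a) β : ℝ) : ℂ) *
        coth (T.zArg (T.pos π (T.gam a) - T.pos π β) t)) +
      Complex.I * Real.pi / T.h * ((T.plusPairing a β : ℂ) *
        coth (T.zArg (T.pos π (T.gam a) - T.pos π β) t)) := fun β => by ring
  simp only [h2, Finset.sum_add_distrib, ← Finset.mul_sum]
  generalize ∑ β ∈ T.orbit c, ((inner ℝ (T.gam a) β : ℝ) : ℂ) *
    coth (T.zArg (T.pos π (T.gam a) - T.pos π β) t) = X
  generalize ∑ β ∈ T.orbit c, (T.plusPairing a β : ℂ) *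
    coth (T.zArg (T.pos π (T.gam a) - T.pos π β) t) = Y
  have hI4 : Complex.I ^ 4 = 1 := Complex.I_pow_four
  have hI3 : Complex.I ^ 3 = -Complex.I := Complex.I_pow_three
  field_simp
  ring_nf
  simp only [hI4, hI3]
  ring

end Loop

end Data

/-! ### Local expansions of `log sinh`, of `exp` and of `B` -/

open Filter Topology Asymptotics

/-- The mean value inequality on the ball of radius `‖z‖` gains one order. -/
theorem isBigO_pow_succ_of_hasDerivAt {f f' : ℂ → ℂ} {n : ℕ} (h0 : f 0 = 0)
    (hf : ∀ᶠ z in 𝓝 0, HasDerivAt f (f' z) z) (hf' : f' =O[𝓝 0] fun z => z ^ n) :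
    f =O[𝓝 0] fun z => z ^ (n + 1) := by
  obtain ⟨C, hC⟩ := hf'.bound
  obtain ⟨δ, hδ, hball⟩ := Metric.eventually_nhds_iff_ball.1 (hf.and hC)
  refine IsBigO.of_bound C ?_
  filter_upwards [Metric.ball_mem_nhds (0 : ℂ) hδ] with z hz
  have hsub : ∀ x ∈ Metric.closedBall (0 : ℂ) ‖z‖, x ∈ Metric.ball (0 : ℂ) δ := fun x hx =>
    Metric.mem_ball.2 ((Metric.mem_closedBall.1 hx).trans_lt (by simpa using hz))
  have hbound : ∀ x ∈ Metric.closedBall (0 : ℂ) ‖z‖, ‖f' x‖ ≤ C * ‖z‖ ^ n := by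
    intro x hx
    have h1 := (hball x (hsub x hx)).2
    have h2 := (hball z hz).2
    rw [norm_pow] at h1
    have hx' : ‖x‖ ≤ ‖z‖ := by simpa using hx
    rcases le_or_gt 0 C with hC0 | hC0
    · exact h1.trans (mul_le_mul_of_nonneg_left (pow_le_pow_left₀ (norm_nonneg _) hx' n) hC0)
    -- A negative `C` is possible only if the powers of the norms vanish.
    · have h3 := (hball 0 (Metric.mem_ball_self hδ)).2
      rw [norm_pow] at h2
      have h4 : ‖z‖ ^ n ≤ 0 := by
        by_contra! h
        exact absurd ((norm_nonneg _).trans h2) (not_le.2 (mul_neg_of_neg_of_pos hC0 h))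
      have h5 : ‖x‖ ^ n ≤ 0 := (pow_le_pow_left₀ (norm_nonneg _) hx' n).trans h4
      have h6 : ‖z‖ ^ n = 0 := le_antisymm h4 (by positivity)
      have h7 : ‖x‖ ^ n = 0 := le_antisymm h5 (by positivity)
      rw [h6, ← h7]; exact h1
  have := (convex_closedBall (0 : ℂ) ‖z‖).norm_image_sub_le_of_norm_hasDerivWithin_le
    (fun x hx => (hball x (hsub x hx)).1.hasDerivWithinAt) hbound
    (Metric.mem_closedBall_self (norm_nonneg z)) (y := z) (by simp)
  rw [h0, sub_zero, sub_zero] at this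
  rw [norm_pow, pow_succ, ← mul_assoc]
  exact this

/-- `l` is the principal logarithm of a ratio close to `1`. The second derivative of the remainder
is `1 / sinh y ^ 2 - 1 / sinh (y + s) ^ 2 = O(s)`, and two integrations give third order. -/
theorem exists_sinh_add_eq {y : ℂ} (hy : Complex.sinh y ≠ 0) : ∃ l : ℂ → ℂ,
    (∀ᶠ s in 𝓝 0, Complex.sinh (y + s) = Complex.sinh y * Complex.exp (l s)) ∧
    (fun s => l s - (s * coth y - s ^ 2 * (1 / Complex.sinh y ^ 2) / 2)) =O[𝓝 0]
      fun s => s ^ 3 := by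
  have hcont : ContinuousAt (fun s : ℂ => Complex.sinh (y + s) / Complex.sinh y) 0 := by fun_prop
  have h1 : ∀ᶠ s in 𝓝 (0 : ℂ), Complex.sinh (y + s) / Complex.sinh y ∈ Complex.slitPlane :=
    hcont.eventually_mem (by
      rw [add_zero, div_self hy]
      exact Complex.isOpen_slitPlane.mem_nhds Complex.one_mem_slitPlane)
  have h2 : ∀ᶠ s in 𝓝 (0 : ℂ), Complex.sinh (y + s) ≠ 0 := h1.mono fun s hs h => by
    rw [h, zero_div] at hs; exact Complex.slitPlane_ne_zero hs rfl
  refine ⟨fun s => Complex.log (Complex.sinh (y + s) / Complex.sinh y), ?_, ?_⟩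
  · filter_upwards [h2] with s hs
    rw [Complex.exp_log (div_ne_zero hs hy), mul_div_cancel₀ _ hy]
  have hadd : ∀ s : ℂ, HasDerivAt (fun s : ℂ => y + s) 1 s := fun s =>
    (hasDerivAt_id s).const_add y
  have hcoth : ∀ᶠ s in 𝓝 (0 : ℂ), HasDerivAt (fun s => coth (y + s) - coth y +
      s * (1 / Complex.sinh y ^ 2)) (1 / Complex.sinh y ^ 2 - 1 / Complex.sinh (y + s) ^ 2) s := by
    filter_upwards [h2] with s hs
    have := (((hasDerivAt_coth hs).comp s (hadd s)).sub_const (coth y)).add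
      ((hasDerivAt_id s).mul_const (1 / Complex.sinh y ^ 2))
    refine this.congr_deriv ?_
    ring
  have hO1 : (fun s : ℂ => 1 / Complex.sinh y ^ 2 - 1 / Complex.sinh (y + s) ^ 2) =O[𝓝 0]
      fun s => s ^ 1 := by
    have hd : DifferentiableAt ℂ (fun s : ℂ => 1 / Complex.sinh y ^ 2 -
        1 / Complex.sinh (y + s) ^ 2) 0 := by
      have h3 : DifferentiableAt ℂ (fun s : ℂ => Complex.sinh (y + s) ^ 2) 0 := by fun_prop
      exact (differentiableAt_const _).sub
        ((differentiableAt_const _).div h3 (by simpa using hy))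
    simpa using hd.isBigO_sub
  have hO2 := isBigO_pow_succ_of_hasDerivAt (by simp) hcoth hO1
  refine isBigO_pow_succ_of_hasDerivAt (by simp [hy]) ?_ hO2
  filter_upwards [h1, h2] with s hs1 hs2
  have e1 : HasDerivAt (fun s : ℂ => Complex.sinh (y + s) / Complex.sinh y)
      (Complex.cosh (y + s) * 1 / Complex.sinh y) s :=
    ((Complex.hasDerivAt_sinh _).comp s (hadd s)).div_const _
  have e2 := ((hasDerivAt_id s).mul_const (coth y)).sub
    ((((hasDerivAt_id s).pow 2).mul_const (1 / Complex.sinh y ^ 2)).div_const 2)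
  refine ((e1.clog hs1).sub e2).congr_deriv ?_
  simp only [id, coth]
  field_simp
  ring

theorem mul_isBigO_of_continuousAt (n : ℕ) {u : ℝ → ℂ} (hu : ContinuousAt u 0) :
    (fun x : ℝ => (x : ℂ) ^ n * u x) =O[𝓝 0] fun x : ℝ => x ^ n := by
  have h1 : (fun x : ℝ => (x : ℂ) ^ n) =O[𝓝 0] fun x : ℝ => x ^ n :=
    IsBigO.of_bound 1 (Eventually.of_forall fun x => by simp)
  simpa using h1.mul (hu.tendsto.isBigO_one ℝ)

theorem exp_isBigO (a b : ℂ) {E : ℝ → ℂ} (hE : E =O[𝓝 0] fun x : ℝ => x ^ 3) :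
    (fun x : ℝ => Complex.exp (a * x + b * x ^ 2 + E x) -
      (1 + a * x + (b + a ^ 2 / 2) * x ^ 2)) =O[𝓝 0] fun x : ℝ => x ^ 3 := by
  have hz : Tendsto (fun x : ℝ => a * x + b * x ^ 2) (𝓝 0) (𝓝 0) := by
    have : Continuous fun x : ℝ => a * (x : ℂ) + b * x ^ 2 := by fun_prop
    simpa using this.tendsto 0
  have hE0 : Tendsto E (𝓝 0) (𝓝 0) := hE.trans_tendsto (by
    simpa using (continuous_pow 3).tendsto (0 : ℝ))
  have h1 : (fun x : ℝ => Complex.exp (E x) - 1) =O[𝓝 0] fun x : ℝ => x ^ 3 := by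
    have := (Complex.exp_sub_sum_range_isBigO_pow 1).comp_tendsto hE0
    simp only [Finset.sum_range_one, pow_zero, Nat.factorial_zero, Nat.cast_one, div_one,
      pow_one] at this
    exact this.trans hE
  have h2 : (fun x : ℝ => Complex.exp (a * x + b * x ^ 2) * (Complex.exp (E x) - 1)) =O[𝓝 0]
      fun x : ℝ => x ^ 3 := by
    have h3 : (fun x : ℝ => Complex.exp (a * x + b * x ^ 2)) =O[𝓝 0] fun _ => (1 : ℝ) :=
      Tendsto.isBigO_one ℝ (ContinuousAt.tendsto (by fun_prop))
    simpa using h3.mul h1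
  have h3 : (fun x : ℝ => Complex.exp (a * x + b * x ^ 2) -
      (1 + (a * x + b * x ^ 2) + (a * x + b * x ^ 2) ^ 2 / 2)) =O[𝓝 0] fun x : ℝ => x ^ 3 := by
    have h4 := (Complex.exp_sub_sum_range_isBigO_pow 3).comp_tendsto hz
    have h5 : (fun x : ℝ => (a * (x : ℂ) + b * x ^ 2) ^ 3) =O[𝓝 0] fun x : ℝ => x ^ 3 :=
      (mul_isBigO_of_continuousAt 3 (u := fun x => (a + b * x) ^ 3) (by fun_prop)).congr_left fun x => by ring
    refine (h4.trans h5).congr_left fun x => ?_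
    simp [Finset.sum_range_succ, Nat.factorial]
  refine ((h2.add h3).add (mul_isBigO_of_continuousAt 3 (u := fun x => a * b + b ^ 2 * x / 2) (by fun_prop))).congr_left
    fun x => ?_
  rw [Complex.exp_add _ (E x)]
  ring

theorem B_tendsto : Tendsto B (𝓝 0) (𝓝 0) := by
  have h : ContinuousAt B 0 := by
    have : (1 + (0 : ℝ) ^ 2 / (4 * Real.pi)) ≠ 0 := by simp
    unfold B
    exact ContinuousAt.mul (by fun_prop)
      (ContinuousAt.div continuousAt_const (by fun_prop) this)
  simpa [ContinuousAt, B] using h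

theorem B_eq (g : ℝ) : B g = g ^ 2 / (2 * Real.pi) - g ^ 4 / (8 * Real.pi ^ 2) +
    g ^ 6 * (1 / (32 * Real.pi ^ 3 * (1 + g ^ 2 / (4 * Real.pi)))) := by
  have hpi := Real.pi_pos
  have h : 0 < 1 + g ^ 2 / (4 * Real.pi) := by positivity
  have h' : 0 < 4 * Real.pi + g ^ 2 := by positivity
  rw [B]
  field_simp
  ring

/-- The expansion in `g` of a function that is known up to third order in `B`. -/
theorem isBigO_comp_B {S : ℝ → ℂ} {a d : ℂ}
    (hS : (fun x : ℝ => S x - (1 + a * x + d * x ^ 2)) =O[𝓝 0] fun x : ℝ => x ^ 3) :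
    (fun g : ℝ => S (B g) - (1 + a * (g ^ 2 / (2 * Real.pi) - g ^ 4 / (8 * Real.pi ^ 2)) +
      d * (g ^ 4 / (4 * Real.pi ^ 2)))) =O[𝓝 0] fun g : ℝ => g ^ 6 := by
  have hv : ContinuousAt (fun g : ℝ => 1 / (32 * Real.pi ^ 3 * (1 + g ^ 2 / (4 * Real.pi)))) 0 :=
    ContinuousAt.div continuousAt_const (by fun_prop) (by
      have := Real.pi_pos; simp [this.ne'])
  generalize hvdef : (fun g : ℝ => 1 / (32 * Real.pi ^ 3 * (1 + g ^ 2 / (4 * Real.pi)))) = v at hv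
  have hB : ∀ g, B g = g ^ 2 / (2 * Real.pi) - g ^ 4 / (8 * Real.pi ^ 2) + g ^ 6 * v g :=
    fun g => by rw [B_eq, ← hvdef]
  have hvc : ContinuousAt (fun g => (v g : ℂ)) 0 :=
    Complex.continuous_ofReal.continuousAt.comp hv
  have h1 : (fun g => B g ^ 3) =O[𝓝 0] fun g : ℝ => g ^ 6 := by
    have hc : ContinuousAt (fun g => 1 / (2 * Real.pi) - g ^ 2 / (8 * Real.pi ^ 2) + g ^ 4 * v g)
      (0 : ℝ) := by fun_prop
    have := ((isBigO_refl (fun g : ℝ => g ^ 6) (𝓝 0)).mul ((hc.pow 3).tendsto.isBigO_one ℝ))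
    simp only [mul_one] at this
    refine this.congr_left fun g => ?_
    simp only [Pi.pow_apply]
    rw [hB]
    ring
  have h2 := (hS.comp_tendsto B_tendsto).trans h1
  -- `u` is what remains of `a B + d B²` beyond order `g⁴`, divided by `g⁶`.
  have h3 := mul_isBigO_of_continuousAt 6 (u := fun g => a * v g +
    d * ((v g : ℂ) * (1 / Real.pi - g ^ 2 / (4 * Real.pi ^ 2) + g ^ 4 * v g) * g ^ 2 +
      (-1 / (8 * Real.pi ^ 3) + g ^ 2 / (64 * Real.pi ^ 4)))) (by fun_prop)
  refine (h2.add h3).congr_left fun g => ?_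
  simp only [Function.comp_apply, hB]
  push_cast
  have : (Real.pi : ℂ) ≠ 0 := by exact_mod_cast Real.pi_ne_zero
  field_simp
  ring

namespace Data

/-! ### Weak-coupling expansion of the bootstrap S-matrix -/

section Expansion

variable {r : ℕ} {ι N : Type*} [Finite ι] [AddCommGroup N] [Module ℝ N]
  {P : RootPairing ι ℝ (E r) N} {b : P.Base} (T : Data P b)

theorem halfArg_add (θ : ℂ) (x y : ℝ) :
    T.halfArg θ (x + y) = T.halfArg θ x + -(Complex.I * Real.pi / (2 * T.h)) * y := by
  rw [halfArg, halfArg]; push_cast; ring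

theorem block_eq (θ : ℂ) (x B : ℝ) : T.block B θ (1 + x) =
    Complex.sinh (T.halfArg θ x + -(Complex.I * Real.pi / (2 * T.h)) * B) *
      Complex.sinh (T.halfArg θ (x + 2) + Complex.I * Real.pi / (2 * T.h) * B) /
      (Complex.sinh (T.halfArg θ x) * Complex.sinh (T.halfArg θ (x + 2))) := by
  have h1 : T.halfArg θ (x + 2 - B) =
      T.halfArg θ (x + 2) + Complex.I * Real.pi / (2 * T.h) * B := by
    rw [sub_eq_add_neg, halfArg_add]; push_cast; ring
  rw [block, show 1 + x - 1 + B = x + B by ring, show 1 + x - 1 = x by ring,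
    show 1 + x + 1 - B = x + 2 - B by ring, show 1 + x + 1 = x + 2 by ring]
  simp only [bracket, h1]
  rw [T.halfArg_add θ x B, one_div_mul_one_div, one_div_mul_one_div, div_div_div_eq, one_mul, mul_one]

/-- The block tends to `1` as `B → 0`. Eventually its principal logarithm is therefore the sum of
the two local logarithms, and the complex power multiplies that sum by `c`. -/
theorem exists_block_cpow {θ : ℂ} {x : ℝ} (h1 : Complex.sinh (T.halfArg θ x) ≠ 0)
    (h2 : Complex.sinh (T.halfArg θ (x + 2)) ≠ 0) (c : ℂ) :
    ∃ E : ℝ → ℂ, E =O[𝓝 0] (fun B : ℝ => B ^ 3) ∧ ∀ᶠ B : ℝ in 𝓝 0,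
      T.block B θ (1 + x) ^ c = Complex.exp (
        -(Complex.I * Real.pi / (2 * T.h)) *
          (c * (coth (T.halfArg θ x) - coth (T.halfArg θ (x + 2)))) * B +
        -((Complex.I * Real.pi / (2 * T.h)) ^ 2 / 2) *
          (c * (1 / Complex.sinh (T.halfArg θ x) ^ 2 +
            1 / Complex.sinh (T.halfArg θ (x + 2)) ^ 2)) * B ^ 2 + E B) := by
  have hblock := T.block_eq θ x
  generalize T.halfArg θ x = y at *
  generalize T.halfArg θ (x + 2) = y' at *
  generalize Complex.I * Real.pi / (2 * T.h) = κ at *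
  obtain ⟨l, hl, hlO⟩ := exists_sinh_add_eq h1
  obtain ⟨l', hl', hlO'⟩ := exists_sinh_add_eq h2
  have hlin : ∀ k : ℂ, Tendsto (fun B : ℝ => k * B) (𝓝 0) (𝓝 0) := fun k => by
    have : Continuous fun B : ℝ => k * (B : ℂ) := by fun_prop
    simpa using this.tendsto 0
  have hcube : ∀ k : ℂ, (fun B : ℝ => (k * B) ^ 3) =O[𝓝 0] fun B : ℝ => B ^ 3 := fun k =>
    (mul_isBigO_of_continuousAt 3 (u := fun _ => k ^ 3) (by fun_prop)).congr_left
      fun B => by ring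
  have hO := (hlO.comp_tendsto (hlin (-κ))).trans (hcube (-κ))
  have hO' := (hlO'.comp_tendsto (hlin κ)).trans (hcube κ)
  have hl0 : ∀ {l : ℂ → ℂ} {u v : ℂ}, (fun s => l s - (s * u - s ^ 2 * v / 2)) =O[𝓝 0]
      (fun s : ℂ => s ^ 3) → Tendsto l (𝓝 0) (𝓝 0) := fun {l u v} h => by
    have e1 : Tendsto (fun s : ℂ => l s - (s * u - s ^ 2 * v / 2)) (𝓝 0) (𝓝 0) :=
      h.trans_tendsto (by simpa using (continuous_pow 3).tendsto (0 : ℂ))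
    have e2 : Tendsto (fun s : ℂ => s * u - s ^ 2 * v / 2) (𝓝 0) (𝓝 0) := by
      have : Continuous fun s : ℂ => s * u - s ^ 2 * v / 2 := by fun_prop
      simpa using this.tendsto 0
    simpa using e1.add e2
  have hsum : Tendsto (fun B : ℝ => l (-κ * B) + l' (κ * B)) (𝓝 0) (𝓝 0) := by
    simpa using ((hl0 hlO).comp (hlin (-κ))).add ((hl0 hlO').comp (hlin κ))
  have him : ∀ᶠ B : ℝ in 𝓝 0, |(l (-κ * B) + l' (κ * B)).im| < Real.pi := by
    have e := (continuous_abs.comp Complex.continuous_im).continuousAt.tendsto.comp hsum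
    simp only [Function.comp_apply, Complex.zero_im, abs_zero] at e
    exact e.eventually (gt_mem_nhds Real.pi_pos)
  refine ⟨_, (hO.add hO').const_mul_left c, ?_⟩
  filter_upwards [(hlin (-κ)).eventually hl, (hlin κ).eventually hl', him] with B e1 e2 e3
  have e4 : T.block B θ (1 + x) = Complex.exp (l (-κ * B) + l' (κ * B)) := by
    rw [hblock, e1, e2, Complex.exp_add]
    field_simp
  obtain ⟨e5, e6⟩ := abs_lt.1 e3
  rw [e4, Complex.cpow_def_of_ne_zero (Complex.exp_ne_zero _), Complex.log_exp e5 e6.le]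
  congr 1
  simp only [Function.comp_apply]
  ring

variable [P.IsRootSystem]

theorem exists_prod_block {θ : ℂ} (s : Finset (E r)) (x : E r → ℝ) (c : E r → ℂ)
    (h : ∀ β ∈ s, Complex.sinh (T.halfArg θ (x β)) ≠ 0 ∧
      Complex.sinh (T.halfArg θ (x β + 2)) ≠ 0) :
    ∃ E : ℝ → ℂ, E =O[𝓝 0] (fun B : ℝ => B ^ 3) ∧ ∀ᶠ B : ℝ in 𝓝 0,
      ∏ β ∈ s, T.block B θ (1 + x β) ^ c β = Complex.exp (
        -(Complex.I * Real.pi / (2 * T.h)) *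
          (∑ β ∈ s, c β * (coth (T.halfArg θ (x β)) - coth (T.halfArg θ (x β + 2)))) * B +
        -((Complex.I * Real.pi / (2 * T.h)) ^ 2 / 2) *
          (∑ β ∈ s, c β * (1 / Complex.sinh (T.halfArg θ (x β)) ^ 2 +
            1 / Complex.sinh (T.halfArg θ (x β + 2)) ^ 2)) * B ^ 2 + E B) := by
  classical
  induction s using Finset.induction_on with
  | empty => exact ⟨fun _ => 0, isBigO_zero _ _, by simp⟩
  | insert β s hβ ih =>
    obtain ⟨E, hE, hS⟩ := ih fun β' hβ' => h β' (Finset.mem_insert_of_mem hβ')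
    obtain ⟨h1, h2⟩ := h β (Finset.mem_insert_self β s)
    obtain ⟨E', hE', hS'⟩ := T.exists_block_cpow h1 h2 (c β)
    refine ⟨_, hE'.add hE, ?_⟩
    filter_upwards [hS, hS'] with B e1 e2
    rw [Finset.prod_insert hβ, e1, e2, ← Complex.exp_add, Finset.sum_insert hβ,
      Finset.sum_insert hβ]
    congr 1
    ring

variable [P.IsCrystallographic] [P.IsReduced] [P.IsIrreducible] {π : E r →ₗ[ℝ] ℂ}

theorem sinh_zArg_ne_zero_of_regular {θ : ℂ} (hθ : θ ∈ T.regular) (s : ZMod (2 * T.h)) :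
    Complex.sinh (T.zArg s θ) ≠ 0 := by
  intro h
  have h' : Complex.sin (T.zArg s θ * Complex.I) = 0 := by rw [Complex.sin_mul_I, h, zero_mul]
  obtain ⟨n, hn⟩ := Complex.sin_eq_zero_iff.1 h'
  refine hθ (s.val - 2 * T.h * n) ?_
  have hh : (T.h : ℂ) ≠ 0 := by exact_mod_cast T.h_pos.ne'
  rw [zArg] at hn
  push_cast
  field_simp at hn ⊢
  linear_combination -Complex.I * hn + (θ * T.h - Complex.I * Real.pi * s.val) * Complex.I_sq

/-- Applying `w⁻¹` lowers a position by `2`, so the second shift in a block is the first one taken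
at `w⁻¹ y'`. -/
theorem exists_halfArg_add_two (hπ : T.IsSpinOneProjection π) {a c : b.support} {y y' : E r}
    (hy : y ∈ T.orbit a) (hy' : y' ∈ T.orbit c) (θ : ℂ) :
    ∃ n : ℤ, T.halfArg θ (T.uDiff π y y' + 2) =
      T.zArg (T.pos π y - T.pos π (T.w⁻¹ y')) θ + n * (Real.pi * Complex.I) := by
  have h1 : T.uDiff π y y' + 2 = ((⌊T.u π y⌋ - ⌊T.u π y'⌋ + 2 : ℤ) : ℝ) := by
    rw [uDiff]; push_cast; rw [← T.u_eq_floor hπ hy, ← T.u_eq_floor hπ hy']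
  obtain ⟨k, hk⟩ := T.exists_hasAngle_of_mem_orbit hπ hy'
  have h2 : T.pos π y - T.pos π (T.w⁻¹ y') =
      ((⌊T.u π y⌋ - ⌊T.u π y'⌋ + 2 : ℤ) : ZMod (2 * T.h)) := by
    have h3 := T.pos_w_inv_pow hπ hk 1
    rw [pow_one] at h3
    rw [h3, pos, pos]; push_cast; ring
  rw [h1, h2]
  exact T.halfArg_intCast θ _

theorem sum_orbit_inner_w_inv (hP : IsSimplyLaced P) (x : E r) (c : b.support) (f : E r → ℂ) :
    ∑ β ∈ T.orbit c, ((inner ℝ x β : ℝ) : ℂ) * f (T.w⁻¹ β) =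
      ∑ β ∈ T.orbit c, ((inner ℝ (T.w⁻¹ x) β : ℝ) : ℂ) * f β := by
  rw [← T.sum_orbit_w hP c]
  refine Finset.sum_congr rfl fun β _ => ?_
  rw [T.w_inv_w, real_inner_comm (T.w β), T.inner_w hP, real_inner_comm (T.w⁻¹ x)]

theorem sinh_sq_add_int_mul_pi_mul_I (z : ℂ) (n : ℤ) :
    Complex.sinh (z + n * (Real.pi * Complex.I)) ^ 2 = Complex.sinh z ^ 2 := by
  rw [(sinh_add_int_mul_pi_mul_I z n).1, mul_pow, ← zpow_natCast, ← zpow_mul, mul_comm n,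
    zpow_mul]
  norm_num

/-- The product of blocks as a function of `B`. -/
theorem prod_block_isBigO (hP : IsSimplyLaced P) (hπ : T.IsSpinOneProjection π)
    (a c : b.support) {θ : ℂ} (hθ : θ ∈ T.regular) :
    ∃ E : ℝ → ℂ, E =O[𝓝 0] (fun B : ℝ => B ^ 3) ∧ ∀ᶠ B : ℝ in 𝓝 0,
      ∏ β ∈ T.orbit c, T.block B θ (1 + T.uDiff π (T.gam a) β) ^
        ((inner ℝ (T.fundWeight a) β : ℝ) : ℂ) = Complex.exp (
        -(Complex.I * Real.pi / (2 * T.h)) * (∑ β ∈ T.orbit c,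
          ((inner ℝ (T.gam a) β : ℝ) : ℂ) * coth (T.halfArg θ (T.uDiff π (T.gam a) β))) * B +
        -((Complex.I * Real.pi / (2 * T.h)) ^ 2 / 2) *
          (∑ β ∈ T.orbit c, (T.plusPairing a β : ℂ) /
            Complex.sinh (T.halfArg θ (T.uDiff π (T.gam a) β)) ^ 2) * B ^ 2 + E B) := by
  have hγ := T.gam_mem_orbit a
  have hn := fun (β : E r) (hβ : β ∈ T.orbit c) => T.exists_halfArg_eq hπ hγ hβ θ
  have hn' := fun (β : E r) (hβ : β ∈ T.orbit c) => T.exists_halfArg_add_two hπ hγ hβ θ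
  have hs := T.sinh_zArg_ne_zero_of_regular hθ
  obtain ⟨E, hE, h⟩ := T.exists_prod_block (θ := θ) (T.orbit c)
    (fun β => T.uDiff π (T.gam a) β) (fun β => ((inner ℝ (T.fundWeight a) β : ℝ) : ℂ))
    fun β hβ => by
      obtain ⟨n, hn⟩ := hn β hβ
      obtain ⟨n', hn'⟩ := hn' β hβ
      rw [hn, hn', ← pow_ne_zero_iff two_ne_zero, sinh_sq_add_int_mul_pi_mul_I,
        ← pow_ne_zero_iff (a := Complex.sinh _) two_ne_zero, sinh_sq_add_int_mul_pi_mul_I]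
      exact ⟨pow_ne_zero _ (hs _), pow_ne_zero _ (hs _)⟩
  refine ⟨E, hE, h.mono fun B hB => hB.trans ?_⟩
  -- At first order the two shifts have opposite signs, and reindexing leaves `λ_a - w⁻¹ λ_a = γ_a`.
  have e1 : ∑ β ∈ T.orbit c, ((inner ℝ (T.fundWeight a) β : ℝ) : ℂ) *
      (coth (T.halfArg θ (T.uDiff π (T.gam a) β)) -
        coth (T.halfArg θ (T.uDiff π (T.gam a) β + 2))) = ∑ β ∈ T.orbit c,
      ((inner ℝ (T.gam a) β : ℝ) : ℂ) * coth (T.halfArg θ (T.uDiff π (T.gam a) β)) := by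
    have e2 := T.sum_orbit_inner_w_inv hP (T.fundWeight a) c
      fun β => coth (T.zArg (T.pos π (T.gam a) - T.pos π β) θ)
    calc _ = ∑ β ∈ T.orbit c, ((inner ℝ (T.fundWeight a) β : ℝ) : ℂ) *
          coth (T.zArg (T.pos π (T.gam a) - T.pos π β) θ) -
        ∑ β ∈ T.orbit c, ((inner ℝ (T.fundWeight a) β : ℝ) : ℂ) *
          coth (T.zArg (T.pos π (T.gam a) - T.pos π (T.w⁻¹ β)) θ) := by
          rw [← Finset.sum_sub_distrib]
          refine Finset.sum_congr rfl fun β hβ => ?_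
          obtain ⟨n, hn⟩ := hn β hβ
          obtain ⟨n', hn'⟩ := hn' β hβ
          rw [hn, hn', coth_add_int_mul_pi_mul_I, coth_add_int_mul_pi_mul_I, mul_sub]
      _ = _ := by
          rw [e2, ← Finset.sum_sub_distrib]
          refine Finset.sum_congr rfl fun β hβ => ?_
          rw [T.coth_halfArg hπ hγ hβ, ← sub_mul, ← Complex.ofReal_sub, ← inner_sub_left, gam]
  -- At second order the signs agree, which leaves `λ_a + w⁻¹ λ_a`.
  have e3 : ∑ β ∈ T.orbit c, ((inner ℝ (T.fundWeight a) β : ℝ) : ℂ) *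
      (1 / Complex.sinh (T.halfArg θ (T.uDiff π (T.gam a) β)) ^ 2 +
        1 / Complex.sinh (T.halfArg θ (T.uDiff π (T.gam a) β + 2)) ^ 2) = ∑ β ∈ T.orbit c,
      (T.plusPairing a β : ℂ) / Complex.sinh (T.halfArg θ (T.uDiff π (T.gam a) β)) ^ 2 := by
    have e2 := T.sum_orbit_inner_w_inv hP (T.fundWeight a) c
      fun β => 1 / Complex.sinh (T.zArg (T.pos π (T.gam a) - T.pos π β) θ) ^ 2
    calc _ = ∑ β ∈ T.orbit c, ((inner ℝ (T.fundWeight a) β : ℝ) : ℂ) *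
          (1 / Complex.sinh (T.zArg (T.pos π (T.gam a) - T.pos π β) θ) ^ 2) +
        ∑ β ∈ T.orbit c, ((inner ℝ (T.fundWeight a) β : ℝ) : ℂ) *
          (1 / Complex.sinh (T.zArg (T.pos π (T.gam a) - T.pos π (T.w⁻¹ β)) θ) ^ 2) := by
          rw [← Finset.sum_add_distrib]
          refine Finset.sum_congr rfl fun β hβ => ?_
          obtain ⟨n, hn⟩ := hn β hβ
          obtain ⟨n', hn'⟩ := hn' β hβ
          rw [hn, hn', sinh_sq_add_int_mul_pi_mul_I, sinh_sq_add_int_mul_pi_mul_I, mul_add]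
      _ = _ := by
          rw [e2, ← Finset.sum_add_distrib]
          refine Finset.sum_congr rfl fun β hβ => ?_
          obtain ⟨n, hn⟩ := hn β hβ
          rw [hn, sinh_sq_add_int_mul_pi_mul_I, ← add_mul, ← Complex.ofReal_add, ← inner_add_left,
            plusPairing, mul_one_div]
  simp only [e1, e3]

/-- Inserting `B = g²/2π - g⁴/8π² + O(g⁶)`, the linear exponent gives the tree amplitude and
`-(g²/4π)` times it. The square from the exponential series gives half its square, the quadratic
exponent the `1 / sinh ^ 2` sum. -/
theorem bootstrapS_isBigO (hP : IsSimplyLaced P) (hπ : T.IsSpinOneProjection π)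
    (a c : b.support) {θ : ℂ} (hθ : θ ∈ T.regular) :
    (fun g : ℝ => T.bootstrapS π g a c θ -
      (1 + T.treeS π g a c θ + T.bootstrapS₁ π g a c θ)) =O[𝓝 0] fun g : ℝ => g ^ 6 := by
  obtain ⟨E, hE, h⟩ := T.prod_block_isBigO hP hπ a c hθ
  have h1 := (exp_isBigO _ _ hE).congr' (h.mono fun B hB => by
    simp only; rw [← hB]) EventuallyEq.rfl
  refine (isBigO_comp_B h1).congr_left fun g => ?_
  have hpi : (Real.pi : ℂ) ≠ 0 := by exact_mod_cast Real.pi_ne_zero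
  have hh : (T.h : ℂ) ≠ 0 := by exact_mod_cast T.h_pos.ne'
  rw [bootstrapS, bootstrapS₁, treeS]
  generalize ∑ β ∈ T.orbit c,
    ((inner ℝ (T.gam a) β : ℝ) : ℂ) * coth (T.halfArg θ (T.uDiff π (T.gam a) β)) = X
  generalize ∑ β ∈ T.orbit c, (T.plusPairing a β : ℂ) /
    Complex.sinh (T.halfArg θ (T.uDiff π (T.gam a) β)) ^ 2 = Y
  rw [sub_right_inj, add_assoc, add_assoc]
  congr 1
  field_simp
  ring_nf
  simp only [Complex.I_sq]
  ring

end Expansion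

end Data

namespace Data

open Filter Topology

/-! ### The one-loop formula and its analytic continuation -/

section OneLoop

variable {r : ℕ} {ι N : Type*} [Finite ι] [AddCommGroup N] [Module ℝ N]
  {P : RootPairing ι ℝ (E r) N} {b : P.Base} (T : Data P b)
  [P.IsRootSystem] [P.IsCrystallographic] [P.IsReduced] [P.IsIrreducible]
  {π : E r →ₗ[ℝ] ℂ}

theorem loopIntegral_add (hP : IsSimplyLaced P) (hπ : T.IsSpinOneProjection π) (g : ℝ)
    (e a c : b.support) {p p' : ℝ} (hp : p' < p) (s : ℝ) :
    T.loopIntegral π g e a c (p + s) (p' + s) = T.loopIntegral π g e a c p p' := by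
  rw [T.loopIntegral_eq hP hπ g e a c hp, T.loopIntegral_eq hP hπ g e a c (by linarith),
    add_sub_add_right_eq_sub]

theorem differentiableAt_loopValue (π : E r →ₗ[ℝ] ℂ) (g : ℝ) (e a c : b.support) {z : ℂ}
    (hz : ∀ s, Complex.sinh (T.zArg s z) ≠ 0) :
    DifferentiableAt ℂ (T.loopValue π g e a c) z := by
  unfold loopValue
  refine DifferentiableAt.const_mul (DifferentiableAt.fun_sum fun β _ =>
    DifferentiableAt.fun_sum fun β' _ => DifferentiableAt.const_mul (DifferentiableAt.mul ?_ ?_)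
      _) _
  · exact (T.hasDerivAt_coth_zArg (hz _)).differentiableAt
  · exact differentiableAt_id.add_const _

theorem loopIntegral_eventuallyEq (hP : IsSimplyLaced P) (hπ : T.IsSpinOneProjection π) (g : ℝ)
    (e a c : b.support) (p' : ℝ) {t : ℝ} (ht : 0 < t) :
    (fun t : ℝ => T.loopIntegral π g e a c (p' + t) p') =ᶠ[𝓝 t]
      fun t : ℝ => T.loopValue π g e a c t := by
  filter_upwards [lt_mem_nhds ht] with x hx
  rw [T.loopIntegral_eq hP hπ g e a c (by linarith), add_sub_cancel_left]

theorem differentiableAt_loopValue_ofReal (π : E r →ₗ[ℝ] ℂ) (g : ℝ) (e a c : b.support) {t : ℝ}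
    (ht : t ≠ 0) : DifferentiableAt ℝ (fun t : ℝ => T.loopValue π g e a c t) t :=
  (T.differentiableAt_loopValue π g e a c
    fun s => T.sinh_zArg_ofReal_ne_zero s ht).hasDerivAt.comp_ofReal.differentiableAt

theorem differentiableAt_loopIntegral (hP : IsSimplyLaced P) (hπ : T.IsSpinOneProjection π)
    (g : ℝ) (e a c : b.support) (p' : ℝ) {t : ℝ} (ht : 0 < t) :
    DifferentiableAt ℝ (fun t : ℝ => T.loopIntegral π g e a c (p' + t) p') t :=
  (T.differentiableAt_loopValue_ofReal π g e a c ht.ne').congr_of_eventuallyEq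
    (T.loopIntegral_eventuallyEq hP hπ g e a c p' ht)

theorem differentiableAt_treeS_ofReal (hπ : T.IsSpinOneProjection π) (g : ℝ) (a c : b.support)
    {t : ℝ} (ht : t ≠ 0) : DifferentiableAt ℝ (fun t : ℝ => T.treeS π g a c t) t :=
  (T.differentiableAt_treeS hπ g a c
    fun s => T.sinh_zArg_ofReal_ne_zero s ht).hasDerivAt.comp_ofReal.differentiableAt

theorem sinh_halfArg_ne_zero (x : ℝ) {t : ℝ} (ht : t ≠ 0) :
    Complex.sinh (T.halfArg t x) ≠ 0 := by
  refine sinh_ne_zero_of_re_ne_zero ?_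
  have : T.halfArg t x = ((t / 2 : ℝ) : ℂ) + ((-(Real.pi * x / (2 * T.h)) : ℝ) : ℂ) * Complex.I := by
    rw [halfArg]; push_cast; ring
  rw [this, Complex.add_re, Complex.ofReal_re, Complex.re_ofReal_mul, Complex.I_re, mul_zero,
    add_zero]
  exact div_ne_zero ht two_ne_zero

theorem hasDerivAt_coth_halfArg (x : ℝ) {t : ℝ} (ht : t ≠ 0) :
    HasDerivAt (fun t : ℝ => coth (T.halfArg t x))
      (-(1 / Complex.sinh (T.halfArg t x) ^ 2) * (1 / 2)) t := by
  have h1 : HasDerivAt (fun z : ℂ => T.halfArg z x) (1 / 2) t :=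
    ((hasDerivAt_id (t : ℂ)).div_const 2).sub_const _
  exact ((hasDerivAt_coth (T.sinh_halfArg_ne_zero x ht)).comp (t : ℂ) h1).comp_ofReal

/-- After the factor `-1/8π²`, differentiating `2π g² t S⁽⁰⁾` gives `-(g²/4π)(S⁽⁰⁾ + t ∂S⁽⁰⁾)`; its
second part cancels the explicit derivative term. Differentiating `coth` gives the `1 / sinh ^ 2`
sum. -/
theorem loopS₁_eq (hP : IsSimplyLaced P) (hπ : T.IsSpinOneProjection π) (g : ℝ)
    (a c : b.support) {p p' : ℝ} (hp : p' < p) :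
    T.loopS₁ π g a c p p' = T.bootstrapS₁ π g a c ((p - p' : ℝ) : ℂ) := by
  have ht : 0 < p - p' := sub_pos.2 hp
  rw [loopS₁, bootstrapS₁]
  generalize p - p' = t at ht
  have hS := (T.differentiableAt_treeS_ofReal hπ g a c ht.ne').hasDerivAt
  have hsum : ∑ e, deriv (fun t : ℝ => T.loopIntegral π g e a c (p' + t) p') t =
      2 * g ^ 2 * Real.pi * (T.treeS π g a c t + t * deriv (fun t : ℝ => T.treeS π g a c t) t) -
        Real.pi ^ 2 * g ^ 4 / (4 * T.h ^ 2) * ∑ β ∈ T.orbit c, (T.plusPairing a β : ℂ) /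
          Complex.sinh (T.halfArg t (T.uDiff π (T.gam a) β)) ^ 2 := by
    have h1 : HasDerivAt (fun t : ℝ => ∑ e, T.loopValue π g e a c t)
        (∑ e, deriv (fun t : ℝ => T.loopIntegral π g e a c (p' + t) p') t) t :=
      HasDerivAt.fun_sum fun e _ => by
        rw [(T.loopIntegral_eventuallyEq hP hπ g e a c p' ht).deriv_eq]
        exact (T.differentiableAt_loopValue_ofReal π g e a c ht.ne').hasDerivAt
    have h2 : HasDerivAt (fun t : ℝ => ∑ β ∈ T.orbit c,
        (T.plusPairing a β : ℂ) * coth (T.halfArg t (T.uDiff π (T.gam a) β))) _ t :=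
      HasDerivAt.fun_sum fun β _ => (T.hasDerivAt_coth_halfArg _ ht.ne').const_mul _
    have h3 := ((Complex.ofRealCLM.hasDerivAt (x := t)).const_mul (2 * (g : ℂ) ^ 2 * Real.pi)).mul hS
    have h4 := h3.add (h2.const_mul ((Real.pi : ℂ) ^ 2 * g ^ 4 / (2 * T.h ^ 2)))
    rw [funext fun t : ℝ => T.sum_loopValue hP hπ g a c (t : ℂ)] at h1
    refine (h1.unique h4).trans ?_
    have h5 : ∑ β ∈ T.orbit c, (T.plusPairing a β : ℂ) *
        (-(1 / Complex.sinh (T.halfArg t (T.uDiff π (T.gam a) β)) ^ 2) * (1 / 2)) =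
        -(1 / 2) * ∑ β ∈ T.orbit c, (T.plusPairing a β : ℂ) /
          Complex.sinh (T.halfArg t (T.uDiff π (T.gam a) β)) ^ 2 := by
      rw [Finset.mul_sum]
      exact Finset.sum_congr rfl fun β _ => by ring
    rw [h5]
    simp only [Complex.ofRealCLM_apply, Complex.ofReal_one]
    ring
  have hpi : (Real.pi : ℂ) ≠ 0 := by exact_mod_cast Real.pi_ne_zero
  have hh : (T.h : ℂ) ≠ 0 := by exact_mod_cast T.h_pos.ne'
  rw [hsum]
  field_simp
  ring

theorem regular_eq : T.regular =
    (Set.range fun k : ℤ => Complex.I * Real.pi * k / T.h)ᶜ := by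
  ext θ
  simp [regular, eq_comm]

theorem isOpen_regular : IsOpen T.regular := by
  have hh : (T.h : ℂ) ≠ 0 := by exact_mod_cast T.h_pos.ne'
  have h : T.regular = {θ : ℂ | Complex.sin (T.h * θ * Complex.I) ≠ 0} := by
    ext θ
    simp only [regular, Set.mem_ofPred_eq, Complex.sin_ne_zero_iff]
    constructor
    · intro H k hk
      refine H (-k) ?_
      push_cast
      field_simp
      linear_combination -Complex.I * hk + T.h * θ * Complex.I_sq
    · intro H k hk
      refine H (-k) ?_
      rw [hk]
      push_cast
      field_simp
      linear_combination k * Complex.I_sq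
  rw [h]
  exact isOpen_ne_fun (by fun_prop) continuous_const

/-- Removing countably many points from a real vector space of dimension two leaves it path
connected. -/
theorem isPreconnected_regular : IsPreconnected T.regular := by
  rw [regular_eq]
  exact ((Set.countable_range _).isPathConnected_compl_of_one_lt_rank
    (by rw [Complex.rank_real_complex]; norm_num)).isConnected.isPreconnected

theorem ofReal_mem_regular {t : ℝ} (ht : t ≠ 0) : (t : ℂ) ∈ T.regular := by
  intro k hk
  have h1 : Complex.I * Real.pi * k / T.h = ((Real.pi * k / T.h : ℝ) : ℂ) * Complex.I := by
    push_cast; ring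
  have := congrArg Complex.re hk
  rw [h1] at this
  exact ht (by simpa using this)

theorem differentiableOn_bootstrapS₁ (hπ : T.IsSpinOneProjection π) (g : ℝ) (a c : b.support) :
    DifferentiableOn ℂ (T.bootstrapS₁ π g a c) T.regular := by
  intro θ hθ
  have h1 := T.differentiableAt_treeS hπ g a c (T.sinh_zArg_ne_zero_of_regular hθ)
  refine DifferentiableAt.differentiableWithinAt ?_
  unfold bootstrapS₁
  refine (((h1.pow 2).div_const 2).sub (h1.const_mul _)).add
    (DifferentiableAt.const_mul (DifferentiableAt.fun_sum fun β hβ => ?_) _)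
  have h2 : Complex.sinh (T.halfArg θ (T.uDiff π (T.gam a) β)) ^ 2 ≠ 0 := by
    obtain ⟨n, hn⟩ := T.exists_halfArg_eq hπ (T.gam_mem_orbit a) hβ θ
    rw [hn, sinh_sq_add_int_mul_pi_mul_I]
    exact pow_ne_zero _ (T.sinh_zArg_ne_zero_of_regular hθ _)
  refine (differentiableAt_const _).div ?_ h2
  unfold halfArg
  fun_prop

/-- Agreement at the real points `t > 1`, which accumulate at the regular point `1`, suffices for
the identity theorem. -/
theorem eqOn_bootstrapS₁ (hP : IsSimplyLaced P) (hπ : T.IsSpinOneProjection π) (g : ℝ)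
    (a c : b.support) {F : ℂ → ℂ} (hF : DifferentiableOn ℂ F T.regular)
    (h : ∀ p p' : ℝ, p' < p → F ((p - p' : ℝ) : ℂ) = T.loopS₁ π g a c p p') :
    Set.EqOn F (T.bootstrapS₁ π g a c) T.regular := by
  have hreal : ∀ t : ℝ, 0 < t → F t = T.bootstrapS₁ π g a c t := fun t ht => by
    have := h t 0 ht
    rw [T.loopS₁_eq hP hπ g a c ht] at this
    simpa using this
  refine (hF.analyticOnNhd T.isOpen_regular).eqOn_of_preconnected_of_frequently_eq
    ((T.differentiableOn_bootstrapS₁ hπ g a c).analyticOnNhd T.isOpen_regular)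
    T.isPreconnected_regular (z₀ := ((1 : ℝ) : ℂ)) (T.ofReal_mem_regular one_ne_zero) ?_
  have h1 : Tendsto (fun t : ℝ => (t : ℂ)) (𝓝[>] 1) (𝓝[≠] ((1 : ℝ) : ℂ)) := by
    refine tendsto_nhdsWithin_iff.2
      ⟨(Complex.continuous_ofReal.tendsto 1).mono_left nhdsWithin_le_nhds, ?_⟩
    filter_upwards [self_mem_nhdsWithin] with t ht
    simpa using (ne_of_gt (Set.mem_Ioi.1 ht))
  refine h1.frequently (Eventually.frequently ?_)
  filter_upwards [self_mem_nhdsWithin] with t ht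
  exact hreal t (zero_lt_one.trans ht)

end OneLoop

end Data

end Toda

end

/-! ### Assembly of the main theorem -/

theorem mainTheorem3 {r : ℕ} {ι N : Type*} [Finite ι] [AddCommGroup N] [Module ℝ N]
    (P : RootPairing ι ℝ (Toda.E r) N) [P.IsRootSystem] [P.IsCrystallographic] [P.IsReduced]
    [P.IsIrreducible] (hP : Toda.IsSimplyLaced P) (b : P.Base) (T : Toda.Data P b) :
    -- the frame in which the angles are measured exists
    (∃ π : Toda.E r →ₗ[ℝ] ℂ, T.IsSpinOneProjection π) ∧
    ∀ π : Toda.E r →ₗ[ℝ] ℂ, T.IsSpinOneProjection π → ∀ a c : b.support,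
      -- weak-coupling expansion of the bootstrap S-matrix up to order `g⁴`
      (∀ θ ∈ T.regular,
        (fun g : ℝ => T.bootstrapS π g a c θ -
            (1 + T.treeS π g a c θ + T.bootstrapS₁ π g a c θ))
          =O[nhds 0] fun g : ℝ => g ^ 6) ∧
      ∀ g : ℝ,
        (∀ θp θp' : ℝ, θp' < θp →
          -- the contour integrals converge, depend on `θ_p - θ_{p'}` only, and are differentiable
          (∀ e : b.support,
            (∃ L : ℂ, Filter.Tendsto
              (fun q : ℝ × ℝ => Toda.indentedRectangle 2 (T.integrand π g e a c θp θp')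
                θp' θp q.1 q.2) Toda.contourFilter (nhds L)) ∧
            (∀ s : ℝ, T.loopIntegral π g e a c (θp + s) (θp' + s) =
              T.loopIntegral π g e a c θp θp') ∧
            DifferentiableAt ℝ (fun t : ℝ => T.loopIntegral π g e a c (θp' + t) θp')
              (θp - θp')) ∧
          DifferentiableAt ℝ (fun t : ℝ => T.treeS π g a c (t : ℂ)) (θp - θp') ∧
          -- value of the contour integral
          (∑ e, T.loopIntegral π g e a c θp θp' =
            2 * g ^ 2 * Real.pi * ((θp - θp' : ℝ) : ℂ) * T.treeS π g a c ((θp - θp' : ℝ) : ℂ) +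
              Real.pi ^ 2 * g ^ 4 / (2 * T.h ^ 2) * ∑ β ∈ T.orbit c,
                (T.plusPairing a β : ℂ) *
                  Toda.coth (T.halfArg ((θp - θp' : ℝ) : ℂ) (T.uDiff π (T.gam a) β))) ∧
          -- the one-loop formula reproduces the order-`g⁴` term of the bootstrap S-matrix
          T.loopS₁ π g a c θp θp' = T.bootstrapS₁ π g a c ((θp - θp' : ℝ) : ℂ)) ∧
        -- the same for the analytic continuation to complex rapidities
        DifferentiableOn ℂ (T.bootstrapS₁ π g a c) T.regular ∧
        ∀ F : ℂ → ℂ, DifferentiableOn ℂ F T.regular →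
          (∀ θp θp' : ℝ, θp' < θp → F ((θp - θp' : ℝ) : ℂ) = T.loopS₁ π g a c θp θp') →
          Set.EqOn F (T.bootstrapS₁ π g a c) T.regular := by
  refine ⟨T.exists_isSpinOneProjection hP, fun π hπ a c =>
    ⟨fun θ hθ => T.bootstrapS_isBigO hP hπ a c hθ, fun g => ⟨fun p p' hp => ⟨fun e =>
      ⟨⟨_, T.tendsto_loop hP hπ g e a c hp⟩, T.loopIntegral_add hP hπ g e a c hp,
        T.differentiableAt_loopIntegral hP hπ g e a c p' (sub_pos.2 hp)⟩,
      T.differentiableAt_treeS_ofReal hπ g a c (sub_pos.2 hp).ne', ?_,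
      T.loopS₁_eq hP hπ g a c hp⟩, T.differentiableOn_bootstrapS₁ hπ g a c,
      fun F hF h => T.eqOn_bootstrapS₁ hP hπ g a c hF h⟩⟩⟩
  simp only [T.loopIntegral_eq hP hπ g _ a c hp]
  exact T.sum_loopValue hP hπ g a c _
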